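/- **Setting.** Let $(A_1(t))_{t\ge0},(A_2(t))_{t\ge0},\ldots$ be independent families of events on a probability space (i.e. the $\sigma$-algebras $\sigma(A_k(t):t\ge0)$, $k\in\mathbb N$, are independent), with $\sum_{k\ge1}\mathbb P(A_k(t))<\infty$ for each $t\ge0$. Put $X(t)=\sum_{k\ge1}\mathbf 1_{A_k(t)}$, $b(t)=\mathbb E X(t)$, $a(t)=\mathrm{Var}\,X(t)$. Assume: (A1) $\lim_{t\to\infty}a(t)=\infty$. (A2) There is a nondecreasing function $a_0$ with $a(t)/a_0(t)\to1$ as $t\to\infty$. (A3) There is $\mu^*\ge1$ with $b(t)=O(a(t)^{\mu^*})$ as $t\to\infty$; let $\mu\geq 1$ be the infimum of all such $\mu^*$. If $\mu=1$, then moreover - $b$ is eventually continuous (continuous on some half-line $(T,\infty)$) or $\liminf_{t\to\infty}\log b(t-1)/\log b(t)>0$; and - for some $q\ge0$ and some slowly varying (measurable, eventually positive) function $\mathcal L$, with $f_s(x)=(\log x)^s\mathcal L(\log x)$, one has $b(t)/a(t)=O(f_q(a(t)))$ as $t\to\infty$ and, if $q>0$, $b(t)/a(t)\ne O(f_s(a(t)))$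 for every $s\in(0,q)$. (A4) $A_k(s)\subseteq A_k(t)$ for all $k$ and all $0<s<t$. (A5) For $\kappa,\varrho\in(0,1)$ and $n\in\mathbb N$ let $t_n=\inf\{t>0:b(t)>v_n\}$, where $v_n=\exp(n^{(1-\kappa)/(q+\varrho+1)})$ if $\mu=1$ and $v_n=n^{(\mu+\varrho)(1-\kappa)/(\mu+\varrho-1)}$ if $\mu>1$. For every $\varrho\in(0,1)$ and every sufficiently small $\kappa>0$ there is a constant $C>1$ such that for all large $n$ there is a partition $t_n=t_{0,n}<t_{1,n}<\dots<t_{j_n,n}=t_{n+1}$ with $1\le b(t_{k,n})-b(t_{k-1,n})\le C$ for $1\le k\le j_n$, and $\sum_n j_n\exp(-\varepsilon\, a(t_n)^{1/2})<\infty$ for all $\varepsilon>0$. (B1) Either $a$ is eventually continuous, or $\lim_{t\to\infty}\log a(t-1)/\log a(t)=1$ in the case $\mu=1$ and $\lim_{t\to\infty}a(t-1)/a(t)=1$ in the case $\mu>1$. For $\gamma>0$ put $\tau_n(\gamma)=\inf\{t>0:a(t)>w_n\}$, where $w_n=\exp(n^{(1+\gamma)/(q+1)})$ if $\mu=1$ and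 $w_n=n^{(1+\gamma)/(\mu-1)}$ if $\mu>1$. At least one of the following holds: (B21) There are $t_0>0$, $\varsigma_0>0$ and sets $R_\varsigma(t)\subseteq\mathbb N$ ($0<\varsigma<\varsigma_0$, $t>t_0$) such that for each $\gamma>0$ close to $0$ and all $\varsigma\in(0,\varsigma_0)$ there is $n_0=n_0(\varsigma,\gamma)$ for which $R_\varsigma(\tau_{n_0}(\gamma)),R_\varsigma(\tau_{n_0+1}(\gamma)),\ldots$ are pairwise disjoint, and for all $\varsigma\in(0,\varsigma_0)$ $$\lim_{t\to\infty}\frac{\mathrm{Var}\big(\sum_{k\in R_\varsigma(t)}\mathbf 1_{A_k(t)}\big)}{\mathrm{Var}\,X(t)}=1-\varsigma.$$ (B22) There are $t_0>0$ and sets $R_0(t)\subseteq\mathbb N$ ($t>t_0$) such that for each $\gamma>0$ close to $0$ there is $n_0=n_0(\gamma)$ for which $R_0(\tau_{n_0}(\gamma)),R_0(\tau_{n_0+1}(\gamma)),\ldots$ are pairwise disjoint, and $$\lim_{t\to\infty}\frac{\mathrm{Var}\big(\sum_{k\in R_0(t)}\mathbf 1_{A_k(t)}\big)}{\mathrm{Var}\,X(t)}=1.$$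 **Theorem.** If $\mu=1$, then $$\limsup_{t\to\infty}\frac{X(t)-\mathbb EX(t)}{(2(q+1)\,\mathrm{Var}X(t)\,\log\log\mathrm{Var}X(t))^{1/2}}=1\quad\text{a.s.},$$ and if $\mu>1$, then $$\limsup_{t\to\infty}\frac{X(t)-\mathbb EX(t)}{(2(\mu-1)\,\mathrm{Var}X(t)\,\log\mathrm{Var}X(t))^{1/2}}=1\quad\text{a.s.}$$ -/

import Mathlib

open MeasureTheory ProbabilityTheory Filter Asymptotics
open scoped Topology ENNReal

noncomputable section

namespace IndicatorLIL

/-- `X(t) = ∑ₖ 1_{A_k(t)}`, the number of the events `A_k(t)` that occur. In the theorem this sum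
is almost surely finite. -/
def count {Ω : Type*} (A : ℕ → ℝ → Set Ω) (t : ℝ) (ω : Ω) : ℝ :=
  ∑' k, (A k t).indicator (fun _ => (1 : ℝ)) ω

/-- The partial sum `∑_{k ∈ R} 1_{A_k(t)}`. -/
def countOn {Ω : Type*} (A : ℕ → ℝ → Set Ω) (R : Set ℕ) (t : ℝ) (ω : Ω) : ℝ :=
  ∑' k : R, (A k t).indicator (fun _ => (1 : ℝ)) ω

/-- `b(t) = E X(t)`. -/
def mean {Ω : Type*} [MeasurableSpace Ω] (P : Measure Ω) (A : ℕ → ℝ → Set Ω) (t : ℝ) : ℝ :=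
  ∫ ω, count A t ω ∂P

/-- `a(t) = Var X(t)`. -/
def var {Ω : Type*} [MeasurableSpace Ω] (P : Measure Ω) (A : ℕ → ℝ → Set Ω) (t : ℝ) : ℝ :=
  variance (count A t) P

/-- The exponents `m ≥ 1` with `b(t) = O(a(t)^m)` as `t → ∞`. -/
def growthExponents (a b : ℝ → ℝ) : Set ℝ :=
  {m | 1 ≤ m ∧ b =O[atTop] fun t => a t ^ m}

/-- `μ`, the infimum of the exponents `m` with `b(t) = O(a(t)^m)`. -/
def growthExponent (a b : ℝ → ℝ) : ℝ := sInf (growthExponents a b)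

/-- `f` is continuous on some half-line `(T, ∞)`. -/
def EventuallyContinuous (f : ℝ → ℝ) : Prop := ∃ T : ℝ, ContinuousOn f (Set.Ioi T)

/-- Slow variation at infinity (in the sense of Karamata). -/
structure SlowlyVarying (L : ℝ → ℝ) : Prop where
  measurable : Measurable L
  eventually_pos : ∀ᶠ x in atTop, 0 < L x
  tendsto : ∀ c : ℝ, 0 < c → Tendsto (fun x => L (c * x) / L x) atTop (𝓝 1)

/-- `f_s(x) = (log x)^s L(log x)`. -/
def logScale (L : ℝ → ℝ) (s x : ℝ) : ℝ := Real.log x ^ s * L (Real.log x)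

/-- The number `q` (with the slowly varying function `L`) is the logarithmic order of `b / a`:
`b/a = O(f_q(a))`, and if `q > 0` then `b/a ≠ O(f_s(a))` for every `s ∈ (0, q)`. -/
structure HasLogOrder (a b : ℝ → ℝ) (q : ℝ) (L : ℝ → ℝ) : Prop where
  nonneg : 0 ≤ q
  slowlyVarying : SlowlyVarying L
  isBigO : (fun t => b t / a t) =O[atTop] fun t => logScale L q (a t)
  optimal : ∀ s : ℝ, 0 < s → s < q →
    ¬ (fun t => b t / a t) =O[atTop] fun t => logScale L s (a t)

open Classical in
/-- The levels for the mean: `v_n = exp(n^{(1-κ)/(q_ϱ+1)})` if `μ = 1`, and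
`v_n = n^{μ_ϱ(1-κ)/(μ_ϱ-1)}` otherwise, where `q_ϱ = q + ϱ` and `μ_ϱ = μ + ϱ`. -/
def meanLevel (μ q κ ϱ : ℝ) (n : ℕ) : ℝ :=
  if μ = 1 then Real.exp ((n : ℝ) ^ ((1 - κ) / (q + ϱ + 1)))
  else (n : ℝ) ^ ((μ + ϱ) * (1 - κ) / (μ + ϱ - 1))

/-- `t_n = inf {t > 0 : b(t) > v_n}`. -/
def meanTime (b : ℝ → ℝ) (μ q κ ϱ : ℝ) (n : ℕ) : ℝ :=
  sInf {t | 0 < t ∧ meanLevel μ q κ ϱ n < b t}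

open Classical in
/-- The levels for the variance: `w_n = exp(n^{(1+γ)/(q+1)})` if `μ = 1`, and
`w_n = n^{(1+γ)/(μ-1)}` otherwise. -/
def varLevel (μ q γ : ℝ) (n : ℕ) : ℝ :=
  if μ = 1 then Real.exp ((n : ℝ) ^ ((1 + γ) / (q + 1)))
  else (n : ℝ) ^ ((1 + γ) / (μ - 1))

/-- `τ_n = inf {t > 0 : a(t) > w_n}`. -/
def varTime (a : ℝ → ℝ) (μ q γ : ℝ) (n : ℕ) : ℝ :=
  sInf {t | 0 < t ∧ varLevel μ q γ n < a t}

/-- For every `ϱ ∈ (0,1)` and every sufficiently small `κ > 0` there is a constant `C > 1` such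
that, for all large `n`, the interval `[t_n, t_{n+1}]` has a partition
`t_n = s_{n,0} < s_{n,1} < ⋯ < s_{n,j_n} = t_{n+1}` along which `b` has increments in `[1, C]`,
and `∑ₙ j_n exp(-ε √a(t_n)) < ∞` for all `ε > 0`. -/
def HasFinePartitions (a b : ℝ → ℝ) (μ q : ℝ) : Prop :=
  ∀ ϱ : ℝ, 0 < ϱ → ϱ < 1 → ∀ᶠ κ : ℝ in 𝓝[>] 0,
    ∃ C : ℝ, 1 < C ∧ ∃ (j : ℕ → ℕ) (s : ℕ → ℕ → ℝ),
      (∀ᶠ n in atTop, 1 ≤ j n ∧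
        s n 0 = meanTime b μ q κ ϱ n ∧ s n (j n) = meanTime b μ q κ ϱ (n + 1) ∧
        ∀ k < j n, s n k < s n (k + 1) ∧
          1 ≤ b (s n (k + 1)) - b (s n k) ∧ b (s n (k + 1)) - b (s n k) ≤ C) ∧
      ∀ ε : ℝ, 0 < ε →
        Summable fun n => (j n : ℝ) * Real.exp (-ε * √(a (meanTime b μ q κ ϱ n)))

/-- The sets `R(τ_n)`, `n ≥ n₀`, are pairwise disjoint for some `n₀`. -/
def EventuallyDisjoint (R : ℝ → Set ℕ) (τ : ℕ → ℝ) : Prop :=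
  ∃ n₀ : ℕ, ∀ m n : ℕ, n₀ ≤ m → n₀ ≤ n → m ≠ n → Disjoint (R (τ m)) (R (τ n))

/-- There are sets `R_ς(t)` of indices, for all small `ς > 0`, that are eventually disjoint along
`(τ_n(γ))` for each `γ > 0` close to `0` and that carry asymptotically the proportion `1 - ς` of
the variance. (Only the values `R_ς(t)` with `ς ∈ (0, ς₀)` and `t` large matter.) -/
def HasBlocksUpToSmallVariance {Ω : Type*} [MeasurableSpace Ω] (P : Measure Ω)
    (A : ℕ → ℝ → Set Ω) (μ q : ℝ) : Prop :=
  ∃ ς₀ : ℝ, 0 < ς₀ ∧ ∃ R : ℝ → ℝ → Set ℕ,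
    (∀ᶠ γ : ℝ in 𝓝[>] 0, ∀ ς : ℝ, 0 < ς → ς < ς₀ →
      EventuallyDisjoint (R ς) (varTime (var P A) μ q γ)) ∧
    ∀ ς : ℝ, 0 < ς → ς < ς₀ →
      Tendsto (fun t => variance (countOn A (R ς t) t) P / var P A t) atTop (𝓝 (1 - ς))

/-- There are sets `R₀(t)` of indices that are eventually disjoint along `(τ_n(γ))` for each
`γ > 0` close to `0` and that carry asymptotically all of the variance. -/
def HasBlocksOfFullVariance {Ω : Type*} [MeasurableSpace Ω] (P : Measure Ω)
    (A : ℕ → ℝ → Set Ω) (μ q : ℝ) : Prop :=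
  ∃ R : ℝ → Set ℕ,
    (∀ᶠ γ : ℝ in 𝓝[>] 0, EventuallyDisjoint R (varTime (var P A) μ q γ)) ∧
    Tendsto (fun t => variance (countOn A (R t) t) P / var P A t) atTop (𝓝 1)

end IndicatorLIL

end

open IndicatorLIL

open IndicatorLIL

/-! Write a = Var X, b = E X, and let ψ(x) be (q+1) log log x if μ = 1 and (μ-1) log x if μ > 1. The
norming is √(2aψ(a)), and both cases are one statement about a slowly varying rate ψ.

Upper half. X(t) is a sum of independent indicators, so Chernoff's bound (`upper_tail_le_sharp`)
makes the probability of X - b ≥ c√(2aψ(a)) at most exp(-dψ(a)) for every d < c² and large t.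
Borel-Cantelli is applied along the passage times of b through levels exp(n^s) with s slightly below
1/(q+1), or n^r with r slightly below μ/(μ-1). Two requirements compete. The levels must be sparse
enough for these probabilities to be summable, yet dense enough for the increase of b between
consecutive levels to be smaller than a by a power of n. The lower bounds on a in terms of b make
both possible, with q or μ as the threshold. Between levels, X - b changes by a centred sum of
independent indicators whose variance is at most the increase of b, so a crude exponential bound
(`increment_tail_le`) carries the estimate to finer levels (`boundedAlong_finer_levels`), down to
the integers. Between integer levels X is monotone and b grows by a bounded amount, because the fine
partitions force b to have bounded jumps (`hasBoundedJumps`); this reaches all t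
(`bounded_of_boundedAlong_nat`).

Lower half (`frequently_ge_of_blocks`). At the passage times τ_n of a one has ψ(a(τ_n)) = (1+γ) log
n + O(1). The index blocks R(τ_n) are eventually disjoint, so their contributions are independent.
Kolmogorov's converse inequality (`le_upper_tail`) gives each of them probability at least a
multiple of 1/n of exceeding c₁√(2aψ(a)), where c < c₁ < 1, and the second Borel-Cantelli lemma
applies. The complementary indices carry so little variance that almost surely they eventually pull
the sum down by less than (c₁-c)√(2aψ(a)). -/

namespace IndicatorLIL

/-! ### Sums of the indicators of independent events -/

section Events

variable {Ω : Type*}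

/-- The number of the events `B k` that occur. -/
noncomputable def hits (B : ℕ → Set Ω) (ω : Ω) : ℝ :=
  ∑' k, (B k).indicator (fun _ => (1 : ℝ)) ω

/-- The number of the first `m` events `B k` that occur. -/
noncomputable def partialHits (B : ℕ → Set Ω) (m : ℕ) (ω : Ω) : ℝ :=
  ∑ k ∈ Finset.range m, (B k).indicator (fun _ => (1 : ℝ)) ω

lemma indicator_one_nonneg (s : Set Ω) (ω : Ω) : 0 ≤ s.indicator (fun _ => (1 : ℝ)) ω :=
  Set.indicator_nonneg (fun _ _ => zero_le_one) ω

lemma hits_nonneg (B : ℕ → Set Ω) (ω : Ω) : 0 ≤ hits B ω :=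
  tsum_nonneg fun k => indicator_one_nonneg (B k) ω

lemma partialHits_nonneg (B : ℕ → Set Ω) (m : ℕ) (ω : Ω) : 0 ≤ partialHits B m ω :=
  Finset.sum_nonneg fun k _ => indicator_one_nonneg (B k) ω

variable [MeasurableSpace Ω] {P : Measure Ω}

/-- Independent events whose probabilities have a finite sum. -/
structure IndepEvents (P : Measure Ω) (B : ℕ → Set Ω) : Prop where
  measurableSet : ∀ k, MeasurableSet (B k)
  indep : iIndepSet B P
  finite : ∑' k, P (B k) ≠ ∞

/-- The expected number of events that occur. -/
noncomputable def meanHits (P : Measure Ω) (B : ℕ → Set Ω) : ℝ := ∑' k, P.real (B k)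

/-- The variance of the number of events that occur. -/
noncomputable def varHits (P : Measure Ω) (B : ℕ → Set Ω) : ℝ :=
  ∑' k, P.real (B k) * (1 - P.real (B k))

/-- The centred number of events that occur. -/
noncomputable def centered (P : Measure Ω) (B : ℕ → Set Ω) (ω : Ω) : ℝ := hits B ω - meanHits P B

lemma measurable_hits {B : ℕ → Set Ω} (hB : ∀ k, MeasurableSet (B k)) : Measurable (hits B) :=
  Measurable.tsum fun k => measurable_const.indicator (hB k)

lemma measurable_partialHits {B : ℕ → Set Ω} (hB : ∀ k, MeasurableSet (B k)) (m : ℕ) :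
    Measurable (partialHits B m) :=
  Finset.measurable_fun_sum _ fun k _ => measurable_const.indicator (hB k)

lemma mgf_indicator_one [IsProbabilityMeasure P] {s : Set Ω} (hs : MeasurableSet s) (θ : ℝ) :
    mgf (s.indicator fun _ => (1 : ℝ)) P θ = 1 + P.real s * (Real.exp θ - 1) := by
  have h : (fun ω => Real.exp (θ * s.indicator (fun _ => (1 : ℝ)) ω)) =
      fun ω => 1 + s.indicator (fun _ => Real.exp θ - 1) ω := by
    ext ω
    by_cases hω : ω ∈ s <;> simp [hω]
  rw [mgf, h, integral_add (integrable_const _) ((integrable_const _).indicator hs),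
    integral_indicator_const _ hs]
  simp

namespace IndepEvents

variable {B : ℕ → Set Ω}

lemma summable_real (hB : IndepEvents P B) : Summable fun k => P.real (B k) :=
  ENNReal.summable_toReal hB.finite

lemma ae_summable (hB : IndepEvents P B) :
    ∀ᵐ ω ∂P, Summable fun k => (B k).indicator (fun _ => (1 : ℝ)) ω := by
  filter_upwards [ae_eventually_notMem hB.finite] with ω hω
  obtain ⟨N, hN⟩ := eventually_atTop.1 hω
  refine summable_of_ne_finset_zero (s := Finset.range N) fun k hk => ?_
  exact Set.indicator_of_notMem (hN k (by simpa using hk)) _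

lemma ae_tendsto (hB : IndepEvents P B) :
    ∀ᵐ ω ∂P, Tendsto (fun m => partialHits B m ω) atTop (𝓝 (hits B ω)) := by
  filter_upwards [hB.ae_summable] with ω hω using hω.hasSum.tendsto_sum_nat

lemma ae_partialHits_le (hB : IndepEvents P B) :
    ∀ᵐ ω ∂P, ∀ m, partialHits B m ω ≤ hits B ω := by
  filter_upwards [hB.ae_summable] with ω hω m
  exact hω.sum_le_tsum _ fun k _ => indicator_one_nonneg (B k) ω

lemma prod_le_exp (hB : IndepEvents P B) (m : ℕ) {θ : ℝ} (hθ : 0 ≤ θ) :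
    ∏ k ∈ Finset.range m, (1 + P.real (B k) * (Real.exp θ - 1)) ≤
      Real.exp (meanHits P B * (Real.exp θ - 1)) := by
  have h0 : 0 ≤ Real.exp θ - 1 := by linarith [Real.one_le_exp hθ]
  calc ∏ k ∈ Finset.range m, (1 + P.real (B k) * (Real.exp θ - 1))
      ≤ ∏ k ∈ Finset.range m, Real.exp (P.real (B k) * (Real.exp θ - 1)) := by
        refine Finset.prod_le_prod (fun k _ => by positivity) fun k _ => ?_
        linarith [Real.add_one_le_exp (P.real (B k) * (Real.exp θ - 1))]
    _ = Real.exp ((∑ k ∈ Finset.range m, P.real (B k)) * (Real.exp θ - 1)) := by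
        rw [← Real.exp_sum, Finset.sum_mul]
    _ ≤ _ := by
        gcongr
        exact hB.summable_real.sum_le_tsum _ fun k _ => measureReal_nonneg

variable [IsProbabilityMeasure P]

lemma mgf_partialHits (hB : IndepEvents P B) (m : ℕ) (θ : ℝ) :
    mgf (partialHits B m) P θ =
      ∏ k ∈ Finset.range m, (1 + P.real (B k) * (Real.exp θ - 1)) := by
  have h1 : iIndepFun (fun k => (B k).indicator fun _ => (1 : ℝ)) P := hB.indep.iIndepFun_indicator
  have h2 := h1.mgf_sum (t := θ) (fun k => measurable_const.indicator (hB.measurableSet k))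
    (Finset.range m)
  have h3 : partialHits B m = ∑ k ∈ Finset.range m, (B k).indicator fun _ => (1 : ℝ) := by
    ext ω
    simp [partialHits]
  rw [h3, h2]
  exact Finset.prod_congr rfl fun k _ => mgf_indicator_one (hB.measurableSet k) θ

lemma integrable_exp_partialHits (hB : IndepEvents P B) (m : ℕ) (θ : ℝ) :
    Integrable (fun ω => Real.exp (θ * partialHits B m ω)) P := by
  refine integrable_exp_mul_of_mem_Icc (a := 0) (b := m)
    (measurable_partialHits hB.measurableSet m).aemeasurable (.of_forall fun ω => ⟨?_, ?_⟩)
  · exact partialHits_nonneg B m ω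
  · refine (Finset.sum_le_card_nsmul _ _ 1 fun k _ => ?_).trans (by simp)
    exact Set.indicator_le_self' (fun _ _ => zero_le_one) ω

/-- Fatou's lemma: the exponential moments of the partial sums are bounded uniformly in their
length, by `prod_le_exp`. Existence of all exponential moments then justifies every later passage
from finite sums to the series. -/
lemma integrable_exp_hits_of_nonneg (hB : IndepEvents P B) {θ : ℝ} (hθ : 0 ≤ θ) :
    Integrable (fun ω => Real.exp (θ * hits B ω)) P := by
  refine ⟨((measurable_hits hB.measurableSet).const_mul θ).exp.aestronglyMeasurable, ?_⟩
  rw [hasFiniteIntegral_iff_ofReal (.of_forall fun ω => (Real.exp_pos _).le)]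
  have h1 : ∫⁻ ω, ENNReal.ofReal (Real.exp (θ * hits B ω)) ∂P =
      ∫⁻ ω, liminf (fun m => ENNReal.ofReal (Real.exp (θ * partialHits B m ω))) atTop ∂P := by
    refine lintegral_congr_ae ?_
    filter_upwards [hB.ae_tendsto] with ω hω
    exact (ENNReal.tendsto_ofReal ((Real.continuous_exp.tendsto _).comp
      (hω.const_mul θ))).liminf_eq.symm
  rw [h1]
  refine (lintegral_liminf_le fun m => ?_).trans_lt ?_
  · exact ((measurable_partialHits hB.measurableSet m).const_mul θ).exp.ennreal_ofReal
  · refine lt_of_le_of_lt (b := ENNReal.ofReal (Real.exp (meanHits P B * (Real.exp θ - 1)))) ?_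
      ENNReal.ofReal_lt_top
    refine liminf_le_of_le (by isBoundedDefault) fun c hc => ?_
    obtain ⟨m, hm⟩ := hc.exists
    refine hm.trans ?_
    rw [← ofReal_integral_eq_lintegral_ofReal (hB.integrable_exp_partialHits m θ)
      (.of_forall fun ω => (Real.exp_pos _).le)]
    refine ENNReal.ofReal_le_ofReal ?_
    have := hB.mgf_partialHits m θ
    rw [mgf] at this
    rw [this]
    exact hB.prod_le_exp m hθ

lemma integrable_exp_hits (hB : IndepEvents P B) (θ : ℝ) :
    Integrable (fun ω => Real.exp (θ * hits B ω)) P := by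
  rcases le_total 0 θ with hθ | hθ
  · exact hB.integrable_exp_hits_of_nonneg hθ
  · refine Integrable.of_bound
      ((measurable_hits hB.measurableSet).const_mul θ).exp.aestronglyMeasurable 1
      (.of_forall fun ω => ?_)
    rw [Real.norm_eq_abs, Real.abs_exp, Real.exp_le_one_iff]
    exact mul_nonpos_of_nonpos_of_nonneg hθ (hits_nonneg B ω)

lemma integrable_exp_centered (hB : IndepEvents P B) (θ : ℝ) :
    Integrable (fun ω => Real.exp (θ * centered P B ω)) P := by
  have h : (fun ω => Real.exp (θ * centered P B ω)) =
      fun ω => Real.exp (θ * hits B ω) * Real.exp (-(θ * meanHits P B)) := by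
    ext ω
    rw [← Real.exp_add, centered]
    ring_nf
  rw [h]
  exact (hB.integrable_exp_hits θ).mul_const _

lemma memLp_hits (hB : IndepEvents P B) : MemLp (hits B) 2 P := by
  have h : integrableExpSet (hits B) P = Set.univ :=
    Set.eq_univ_of_forall fun θ => hB.integrable_exp_hits θ
  exact memLp_of_mem_interior_integrableExpSet (by simp [h]) 2

lemma integrable_hits (hB : IndepEvents P B) : Integrable (hits B) P :=
  hB.memLp_hits.integrable (by norm_num)

lemma tendsto_mgf (hB : IndepEvents P B) (θ : ℝ) :
    Tendsto (fun m => mgf (partialHits B m) P θ) atTop (𝓝 (mgf (hits B) P θ)) := by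
  refine tendsto_integral_of_dominated_convergence (fun ω => Real.exp (|θ| * hits B ω))
    (fun m => ((measurable_partialHits hB.measurableSet m).const_mul θ).exp.aestronglyMeasurable)
    (hB.integrable_exp_hits _) (fun m => ?_) ?_
  · filter_upwards [hB.ae_partialHits_le] with ω hω
    rw [Real.norm_eq_abs, Real.abs_exp]
    refine Real.exp_le_exp.2 ?_
    calc θ * partialHits B m ω ≤ |θ| * partialHits B m ω :=
          mul_le_mul_of_nonneg_right (le_abs_self θ) (partialHits_nonneg B m ω)
      _ ≤ |θ| * hits B ω := mul_le_mul_of_nonneg_left (hω m) (abs_nonneg θ)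
  · filter_upwards [hB.ae_tendsto] with ω hω
    exact (Real.continuous_exp.tendsto _).comp (hω.const_mul θ)

lemma memLp_indicator (hB : IndepEvents P B) (k : ℕ) :
    MemLp ((B k).indicator fun _ => (1 : ℝ)) 2 P :=
  (memLp_const (1 : ℝ)).indicator (hB.measurableSet k)

lemma integral_partialHits (hB : IndepEvents P B) (m : ℕ) :
    ∫ ω, partialHits B m ω ∂P = ∑ k ∈ Finset.range m, P.real (B k) := by
  unfold partialHits
  rw [integral_finsetSum _ fun k _ => (hB.memLp_indicator k).integrable (by norm_num)]
  refine Finset.sum_congr rfl fun k _ => ?_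
  rw [integral_indicator_const _ (hB.measurableSet k)]
  simp

lemma integral_hits (hB : IndepEvents P B) : ∫ ω, hits B ω ∂P = meanHits P B := by
  have h1 : Tendsto (fun m => ∫ ω, partialHits B m ω ∂P) atTop (𝓝 (∫ ω, hits B ω ∂P)) := by
    refine tendsto_integral_of_dominated_convergence (hits B)
      (fun m => (measurable_partialHits hB.measurableSet m).aestronglyMeasurable)
      hB.integrable_hits (fun m => ?_) hB.ae_tendsto
    filter_upwards [hB.ae_partialHits_le] with ω hω
    rw [Real.norm_eq_abs, abs_of_nonneg (partialHits_nonneg B m ω)]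
    exact hω m
  simp_rw [hB.integral_partialHits] at h1
  exact tendsto_nhds_unique h1 hB.summable_real.hasSum.tendsto_sum_nat

lemma variance_indicator (hB : IndepEvents P B) (k : ℕ) :
    variance ((B k).indicator fun _ => (1 : ℝ)) P = P.real (B k) * (1 - P.real (B k)) := by
  rw [variance_eq_sub (hB.memLp_indicator k)]
  have h : ((B k).indicator fun _ => (1 : ℝ)) ^ 2 = (B k).indicator fun _ => (1 : ℝ) := by
    ext ω
    by_cases hω : ω ∈ B k <;> simp [hω]
  rw [h, integral_indicator_const _ (hB.measurableSet k)]
  simp only [smul_eq_mul]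
  ring

lemma variance_partialHits (hB : IndepEvents P B) (m : ℕ) :
    variance (partialHits B m) P =
      ∑ k ∈ Finset.range m, P.real (B k) * (1 - P.real (B k)) := by
  have h1 : iIndepFun (fun k => (B k).indicator fun _ => (1 : ℝ)) P := hB.indep.iIndepFun_indicator
  have h3 : partialHits B m = ∑ k ∈ Finset.range m, (B k).indicator fun _ => (1 : ℝ) := by
    ext ω
    simp [partialHits]
  rw [h3, IndepFun.variance_sum (fun k _ => hB.memLp_indicator k)
    (fun i _ j _ hij => h1.indepFun hij)]
  exact Finset.sum_congr rfl fun k _ => hB.variance_indicator k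

lemma prob_mul_compl_nonneg (k : ℕ) : 0 ≤ P.real (B k) * (1 - P.real (B k)) :=
  mul_nonneg measureReal_nonneg (sub_nonneg.2 measureReal_le_one)

lemma summable_var (hB : IndepEvents P B) :
    Summable fun k => P.real (B k) * (1 - P.real (B k)) :=
  hB.summable_real.of_nonneg_of_le (fun k => prob_mul_compl_nonneg k)
    fun k => mul_le_of_le_one_right measureReal_nonneg (by linarith [measureReal_nonneg (μ := P) (s := B k)])

/-- First and second moments of the partial sums converge by domination, since `hits` is square
integrable. -/
lemma variance_hits (hB : IndepEvents P B) : variance (hits B) P = varHits P B := by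
  have h1 : Tendsto (fun m => ∫ ω, partialHits B m ω ^ 2 ∂P) atTop
      (𝓝 (∫ ω, hits B ω ^ 2 ∂P)) := by
    refine tendsto_integral_of_dominated_convergence (fun ω => hits B ω ^ 2)
      (fun m => ((measurable_partialHits hB.measurableSet m).pow_const 2).aestronglyMeasurable)
      hB.memLp_hits.integrable_sq (fun m => ?_) ?_
    · filter_upwards [hB.ae_partialHits_le] with ω hω
      rw [Real.norm_eq_abs, abs_of_nonneg (sq_nonneg _)]
      exact pow_le_pow_left₀ (partialHits_nonneg B m ω) (hω m) 2
    · filter_upwards [hB.ae_tendsto] with ω hω using hω.pow 2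
  have h2 : Tendsto (fun m => variance (partialHits B m) P) atTop (𝓝 (variance (hits B) P)) := by
    have h3 : ∀ m, variance (partialHits B m) P =
        ∫ ω, partialHits B m ω ^ 2 ∂P - (∑ k ∈ Finset.range m, P.real (B k)) ^ 2 := fun m => by
      have hm : MemLp (partialHits B m) 2 P :=
        memLp_finsetSum _ fun k _ => hB.memLp_indicator k
      rw [variance_eq_sub hm, ← hB.integral_partialHits m]
      rfl
    simp_rw [h3]
    rw [variance_eq_sub hB.memLp_hits, hB.integral_hits]
    exact h1.sub (hB.summable_real.hasSum.tendsto_sum_nat.pow 2)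
  simp_rw [hB.variance_partialHits] at h2
  exact tendsto_nhds_unique h2 hB.summable_var.hasSum.tendsto_sum_nat

lemma varHits_le_meanHits (hB : IndepEvents P B) : varHits P B ≤ meanHits P B :=
  hB.summable_var.tsum_le_tsum
    (fun k => mul_le_of_le_one_right measureReal_nonneg (by linarith [measureReal_nonneg (μ := P) (s := B k)]))
    hB.summable_real

/-- The centring is distributed over the factors, so that each factor is the moment generating
function of one centred indicator and can be estimated alone. -/
lemma tendsto_mgf_centered (hB : IndepEvents P B) (θ : ℝ) :
    Tendsto (fun m => ∏ k ∈ Finset.range m, Real.exp (-(θ * P.real (B k))) *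
      (1 + P.real (B k) * (Real.exp θ - 1))) atTop (𝓝 (mgf (centered P B) P θ)) := by
  have h1 : mgf (centered P B) P θ = Real.exp (-(θ * meanHits P B)) * mgf (hits B) P θ := by
    have : centered P B = fun ω => hits B ω + -meanHits P B := by
      ext ω
      rw [centered, sub_eq_add_neg]
    rw [this, mgf_add_const, mul_comm, mul_neg]
  rw [h1]
  simp_rw [Finset.prod_mul_distrib, ← hB.mgf_partialHits, ← Real.exp_sum, Finset.sum_neg_distrib,
    ← Finset.mul_sum]
  exact ((Real.continuous_exp.tendsto _).comp
    ((hB.summable_real.hasSum.tendsto_sum_nat.const_mul θ).neg)).mul (hB.tendsto_mgf θ)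

end IndepEvents

end Events

/-! ### Exponential inequalities for sums of indicators -/

section Scalar

lemma exp_le_cubic {x y : ℝ} (hy : y ≤ 1) (hxy : |x| ≤ y) :
    Real.exp x ≤ 1 + x + x ^ 2 / 2 * (1 + y) := by
  have h := abs_le.1 (Real.exp_bound (hxy.trans hy) (n := 3) (by norm_num))
  simp only [Finset.sum_range_succ, Finset.range_zero, Finset.sum_empty, Nat.factorial] at h
  norm_num at h
  have h3 : |x| ^ 3 ≤ x ^ 2 * y := by
    rw [pow_succ, sq_abs]
    exact mul_le_mul_of_nonneg_left hxy (sq_nonneg x)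
  nlinarith [h.2, mul_nonneg (sq_nonneg x) ((abs_nonneg x).trans hxy)]

lemma cubic_le_exp {x y : ℝ} (hy : y ≤ 1) (hxy : |x| ≤ y) :
    1 + x + x ^ 2 / 2 * (1 - y / 2) ≤ Real.exp x := by
  have h := abs_le.1 (Real.exp_bound (hxy.trans hy) (n := 3) (by norm_num))
  simp only [Finset.sum_range_succ, Finset.range_zero, Finset.sum_empty, Nat.factorial] at h
  norm_num at h
  have h3 : |x| ^ 3 ≤ x ^ 2 * y := by
    rw [pow_succ, sq_abs]
    exact mul_le_mul_of_nonneg_left hxy (sq_nonneg x)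
  nlinarith [h.1, mul_nonneg (sq_nonneg x) ((abs_nonneg x).trans hxy)]

lemma centered_bernoulli_factor (p θ : ℝ) :
    Real.exp (-(θ * p)) * (1 + p * (Real.exp θ - 1)) =
      p * Real.exp (θ * (1 - p)) + (1 - p) * Real.exp (-(θ * p)) := by
  have h : Real.exp (θ * (1 - p)) = Real.exp (-(θ * p)) * Real.exp θ := by
    rw [← Real.exp_add]
    ring_nf
  rw [h]
  ring

variable {p θ : ℝ}

lemma abs_mul_le_abs_of_mem_unit (h0 : 0 ≤ p) (h1 : p ≤ 1) : |θ * p| ≤ |θ| := by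
  rw [abs_mul, abs_of_nonneg h0]
  exact mul_le_of_le_one_right (abs_nonneg θ) h1

/-- Averaging the expansions of exp at θ(1-p) and -θp with weights p and 1-p cancels the linear
terms, and the quadratic ones add up to p(1-p)θ²/2. -/
lemma bernoulli_mgf_le (h0 : 0 ≤ p) (h1 : p ≤ 1) (hθ : |θ| ≤ 1) :
    Real.exp (-(θ * p)) * (1 + p * (Real.exp θ - 1)) ≤
      Real.exp (θ ^ 2 / 2 * (1 + |θ|) * (p * (1 - p))) := by
  rw [centered_bernoulli_factor]
  have e1 := exp_le_cubic hθ (abs_mul_le_abs_of_mem_unit (θ := θ) (sub_nonneg.2 h1)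
    (sub_le_self 1 h0))
  have e2 := exp_le_cubic (x := -(θ * p)) hθ
    (by rw [abs_neg]; exact abs_mul_le_abs_of_mem_unit h0 h1)
  refine le_trans ?_ (Real.add_one_le_exp _)
  have e3 := mul_le_mul_of_nonneg_left e1 h0
  have e4 := mul_le_mul_of_nonneg_left e2 (sub_nonneg.2 h1)
  nlinarith [e3, e4]

lemma exp_sub_sq_le {u : ℝ} (h0 : 0 ≤ u) (h1 : u ≤ 1) : Real.exp (u - u ^ 2) ≤ 1 + u := by
  have hw0 : 0 ≤ u - u ^ 2 := by nlinarith
  have hw1 : u - u ^ 2 ≤ u := by nlinarith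
  have h := abs_le.1 (Real.exp_bound (x := u - u ^ 2) (by rw [abs_of_nonneg hw0]; linarith)
    (n := 2) (by norm_num))
  simp only [Finset.sum_range_succ, Finset.range_zero, Finset.sum_empty, Nat.factorial, sq_abs] at h
  norm_num at h
  have : (u - u ^ 2) ^ 2 ≤ u ^ 2 := pow_le_pow_left₀ hw0 hw1 2
  nlinarith [h.2]

/-- The same cancellation bounds the average below by 1 + u. Returning to the exponential through 1
+ u ≥ exp(u - u²) costs u², which is absorbed by weakening the factor 1 - θ/2 in u to 1 - θ. -/
lemma le_bernoulli_mgf (h0 : 0 ≤ p) (h1 : p ≤ 1) (hθ0 : 0 ≤ θ) (hθ : θ ≤ 1) :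
    Real.exp (θ ^ 2 / 2 * (1 - θ) * (p * (1 - p))) ≤
      Real.exp (-(θ * p)) * (1 + p * (Real.exp θ - 1)) := by
  rw [centered_bernoulli_factor]
  have habs : |θ| = θ := abs_of_nonneg hθ0
  have e1 := cubic_le_exp hθ ((abs_mul_le_abs_of_mem_unit (θ := θ) (sub_nonneg.2 h1)
    (sub_le_self 1 h0)).trans_eq habs)
  have e2 := cubic_le_exp (x := -(θ * p)) hθ
    (by rw [abs_neg]; exact (abs_mul_le_abs_of_mem_unit h0 h1).trans_eq habs)
  have e3 := mul_le_mul_of_nonneg_left e1 h0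
  have e4 := mul_le_mul_of_nonneg_left e2 (sub_nonneg.2 h1)
  set v := p * (1 - p) with hv
  have hv0 : 0 ≤ v := mul_nonneg h0 (sub_nonneg.2 h1)
  have hv1 : v ≤ 1 / 4 := by nlinarith [sq_nonneg (p - 1 / 2)]
  set u := θ ^ 2 / 2 * (1 - θ / 2) * v with hu
  have hθ2 : θ ^ 2 ≤ θ := by nlinarith
  have hw : 0 ≤ θ ^ 2 / 2 * v := by positivity
  have hu0 : 0 ≤ u := mul_nonneg (mul_nonneg (by positivity) (by linarith)) hv0
  have hu1 : u ≤ θ ^ 2 / 2 * v := by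
    rw [hu, mul_right_comm]
    exact mul_le_of_le_one_right hw (by linarith)
  have hu2 : u ^ 2 ≤ θ ^ 2 / 2 * v * (θ / 2) := by
    calc u ^ 2 ≤ (θ ^ 2 / 2 * v) ^ 2 := pow_le_pow_left₀ hu0 hu1 2
      _ = θ ^ 2 / 2 * v * (θ ^ 2 / 2 * v) := sq _
      _ ≤ θ ^ 2 / 2 * v * (θ / 2) := by
        refine mul_le_mul_of_nonneg_left ?_ hw
        nlinarith
  have hu3 : u ≤ 1 := by nlinarith
  calc Real.exp (θ ^ 2 / 2 * (1 - θ) * v) ≤ Real.exp (u - u ^ 2) := by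
        refine Real.exp_le_exp.2 ?_
        rw [hu] at hu2 ⊢
        linarith
    _ ≤ 1 + u := exp_sub_sq_le hu0 hu3
    _ ≤ _ := by
        rw [hu, hv]
        nlinarith [e3, e4]

end Scalar

/-! ### Tail bounds obtained from the exponential moments. -/

section Tails

variable {Ω : Type*} [MeasurableSpace Ω] {P : Measure Ω} {B : ℕ → Set Ω}

lemma measurable_centered (hB : ∀ k, MeasurableSet (B k)) : Measurable (centered P B) :=
  (measurable_hits hB).sub_const _

variable [IsProbabilityMeasure P]

lemma varHits_nonneg : 0 ≤ varHits P B := tsum_nonneg fun k => IndepEvents.prob_mul_compl_nonneg k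

namespace IndepEvents

lemma mgf_centered_le (hB : IndepEvents P B) {θ : ℝ} (hθ : |θ| ≤ 1) :
    mgf (centered P B) P θ ≤ Real.exp (θ ^ 2 / 2 * (1 + |θ|) * varHits P B) := by
  refine le_of_tendsto (hB.tendsto_mgf_centered θ) (.of_forall fun m => ?_)
  calc _ ≤ ∏ k ∈ Finset.range m,
        Real.exp (θ ^ 2 / 2 * (1 + |θ|) * (P.real (B k) * (1 - P.real (B k)))) := by
        refine Finset.prod_le_prod (fun k _ => ?_) fun k _ =>
          bernoulli_mgf_le measureReal_nonneg measureReal_le_one hθ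
        rw [centered_bernoulli_factor]
        have h0 : 0 ≤ P.real (B k) := measureReal_nonneg
        have h1 : 0 ≤ 1 - P.real (B k) := sub_nonneg.2 measureReal_le_one
        positivity
    _ = Real.exp (θ ^ 2 / 2 * (1 + |θ|) *
          ∑ k ∈ Finset.range m, P.real (B k) * (1 - P.real (B k))) := by
        rw [← Real.exp_sum, Finset.mul_sum]
    _ ≤ _ := by
        gcongr
        exact hB.summable_var.sum_le_tsum _ fun k _ => prob_mul_compl_nonneg k

lemma le_mgf_centered (hB : IndepEvents P B) {θ : ℝ} (hθ0 : 0 ≤ θ) (hθ : θ ≤ 1) :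
    Real.exp (θ ^ 2 / 2 * (1 - θ) * varHits P B) ≤ mgf (centered P B) P θ := by
  have h1 : Tendsto (fun m => Real.exp (θ ^ 2 / 2 * (1 - θ) *
      ∑ k ∈ Finset.range m, P.real (B k) * (1 - P.real (B k)))) atTop
      (𝓝 (Real.exp (θ ^ 2 / 2 * (1 - θ) * varHits P B))) :=
    (Real.continuous_exp.tendsto _).comp (hB.summable_var.hasSum.tendsto_sum_nat.const_mul _)
  refine le_of_tendsto_of_tendsto' h1 (hB.tendsto_mgf_centered θ) fun m => ?_
  rw [Finset.mul_sum, Real.exp_sum]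
  exact Finset.prod_le_prod (fun k _ => (Real.exp_pos _).le) fun k _ =>
    le_bernoulli_mgf measureReal_nonneg measureReal_le_one hθ0 hθ

/-- A crude Chernoff bound for use when only an upper bound `W` for the variance is known. The
parameter x/(2W) is half the Gaussian optimum, which keeps it below 1/2; the lost constant is
harmless. -/
lemma upper_tail_le (hB : IndepEvents P B) {x W : ℝ} (hW : 0 < W) (hV : varHits P B ≤ W)
    (hx0 : 0 ≤ x) (hx : x ≤ W) :
    P.real {ω | x ≤ centered P B ω} ≤ Real.exp (-(x ^ 2 / (4 * W))) := by
  set θ := x / (2 * W) with hθ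
  have hθ0 : 0 ≤ θ := by positivity
  have hθ1 : θ ≤ 1 / 2 := by
    rw [hθ, div_le_iff₀ (by positivity)]
    linarith
  have habs : |θ| = θ := abs_of_nonneg hθ0
  refine (measure_ge_le_exp_mul_mgf x hθ0 (hB.integrable_exp_centered θ)).trans ?_
  have h1 := hB.mgf_centered_le (θ := θ) (by rw [habs]; linarith)
  refine (mul_le_mul_of_nonneg_left h1 (Real.exp_pos _).le).trans ?_
  rw [← Real.exp_add, Real.exp_le_exp, habs]
  have h2 : θ ^ 2 / 2 * (1 + θ) * varHits P B ≤ θ ^ 2 / 2 * (3 / 2) * W := by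
    have := varHits_nonneg (P := P) (B := B)
    gcongr
    linarith
  have h3 : -θ * x + θ ^ 2 / 2 * (3 / 2) * W = -(5 / 4) * (x ^ 2 / (4 * W)) := by
    rw [hθ]
    field_simp
    ring
  have h4 : 0 ≤ x ^ 2 / (4 * W) := by positivity
  linarith

lemma lower_tail_le (hB : IndepEvents P B) {x W : ℝ} (hW : 0 < W) (hV : varHits P B ≤ W)
    (hx0 : 0 ≤ x) (hx : x ≤ W) :
    P.real {ω | centered P B ω ≤ -x} ≤ Real.exp (-(x ^ 2 / (4 * W))) := by
  set θ := x / (2 * W) with hθ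
  have hθ0 : 0 ≤ θ := by positivity
  have hθ1 : θ ≤ 1 / 2 := by
    rw [hθ, div_le_iff₀ (by positivity)]
    linarith
  have habs : |(-θ)| = θ := by rw [abs_neg, abs_of_nonneg hθ0]
  refine (measure_le_le_exp_mul_mgf (-x) (neg_nonpos.2 hθ0)
    (hB.integrable_exp_centered (-θ))).trans ?_
  have h1 := hB.mgf_centered_le (θ := -θ) (by rw [habs]; linarith)
  refine (mul_le_mul_of_nonneg_left h1 (Real.exp_pos _).le).trans ?_
  rw [← Real.exp_add, Real.exp_le_exp, habs]
  have h2 : (-θ) ^ 2 / 2 * (1 + θ) * varHits P B ≤ (-θ) ^ 2 / 2 * (3 / 2) * W := by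
    have := varHits_nonneg (P := P) (B := B)
    gcongr
    linarith
  have h3 : -(-θ) * -x + (-θ) ^ 2 / 2 * (3 / 2) * W = -(5 / 4) * (x ^ 2 / (4 * W)) := by
    rw [hθ]
    field_simp
    ring
  have h4 : 0 ≤ x ^ 2 / (4 * W) := by positivity
  linarith

/-- The Gaussian optimum θ = x/V is used. Since θ ≤ η, the cubic error only multiplies the Gaussian
exponent by a factor at least 1 - η. -/
lemma upper_tail_le_sharp (hB : IndepEvents P B) {x η : ℝ} (hV : 0 < varHits P B)
    (hx0 : 0 ≤ x) (hη : η ≤ 1) (hx : x ≤ η * varHits P B) :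
    P.real {ω | x ≤ centered P B ω} ≤ Real.exp (-((1 - η) * (x ^ 2 / (2 * varHits P B)))) := by
  set V := varHits P B
  set θ := x / V with hθ
  have hθ0 : 0 ≤ θ := by positivity
  have hθ1 : θ ≤ η := by rwa [hθ, div_le_iff₀ hV]
  have habs : |θ| = θ := abs_of_nonneg hθ0
  refine (measure_ge_le_exp_mul_mgf x hθ0 (hB.integrable_exp_centered θ)).trans ?_
  have h1 := hB.mgf_centered_le (θ := θ) (by rw [habs]; linarith)
  refine (mul_le_mul_of_nonneg_left h1 (Real.exp_pos _).le).trans ?_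
  rw [← Real.exp_add, Real.exp_le_exp, habs]
  have h3 : -θ * x + θ ^ 2 / 2 * (1 + θ) * V = -((1 - θ) * (x ^ 2 / (2 * V))) := by
    rw [hθ]
    field_simp
    ring
  have h4 : 0 ≤ x ^ 2 / (2 * V) := by positivity
  change -θ * x + θ ^ 2 / 2 * (1 + θ) * V ≤ _
  rw [h3]
  nlinarith

/-- Truncating the exponential moment of order `θ` to `[x, y]` costs at most the exponential
moments of orders `θ ± s`. -/
lemma mgf_sub_le (hB : IndepEvents P B) {θ s x y : ℝ} (hθ : 0 ≤ θ) (hs : 0 ≤ s) :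
    mgf (centered P B) P θ - Real.exp (s * x) * mgf (centered P B) P (θ - s) -
      Real.exp (-(s * y)) * mgf (centered P B) P (θ + s) ≤
      Real.exp (θ * y) * P.real {ω | x ≤ centered P B ω} := by
  have hm : MeasurableSet {ω | x ≤ centered P B ω} :=
    measurableSet_le measurable_const (measurable_centered hB.measurableSet)
  have hi := hB.integrable_exp_centered
  have h1 : mgf (centered P B) P θ - Real.exp (s * x) * mgf (centered P B) P (θ - s) -
      Real.exp (-(s * y)) * mgf (centered P B) P (θ + s) =
      ∫ ω, (Real.exp (θ * centered P B ω) -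
        Real.exp (s * x) * Real.exp ((θ - s) * centered P B ω) -
        Real.exp (-(s * y)) * Real.exp ((θ + s) * centered P B ω)) ∂P := by
    have i1 : Integrable (fun ω => Real.exp (θ * centered P B ω) -
        Real.exp (s * x) * Real.exp ((θ - s) * centered P B ω)) P := (hi _).sub ((hi _).const_mul _)
    rw [integral_sub i1 ((hi _).const_mul _),
      integral_sub (hi _) ((hi _).const_mul _), integral_const_mul, integral_const_mul]
    rfl
  have h2 : Real.exp (θ * y) * P.real {ω | x ≤ centered P B ω} =
      ∫ ω, {ω | x ≤ centered P B ω}.indicator (fun _ => Real.exp (θ * y)) ω ∂P := by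
    rw [integral_indicator_const _ hm, smul_eq_mul, mul_comm]
  rw [h1, h2]
  refine integral_mono (((hi _).sub ((hi _).const_mul _)).sub ((hi _).const_mul _))
    ((integrable_const _).indicator hm) fun ω => ?_
  simp only [← Real.exp_add]
  set Y := centered P B ω with hY
  have p1 := Real.exp_pos (s * x + (θ - s) * Y)
  have p2 := Real.exp_pos (-(s * y) + (θ + s) * Y)
  by_cases hx : x ≤ Y
  · rw [Set.indicator_of_mem (by exact hx)]
    by_cases hy : Y ≤ y
    · have : Real.exp (θ * Y) ≤ Real.exp (θ * y) :=
        Real.exp_le_exp.2 (mul_le_mul_of_nonneg_left hy hθ)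
      linarith
    · have : Real.exp (θ * Y) ≤ Real.exp (-(s * y) + (θ + s) * Y) :=
        Real.exp_le_exp.2 (by nlinarith [mul_le_mul_of_nonneg_left (not_le.1 hy).le hs])
      linarith [Real.exp_pos (θ * y)]
  · rw [Set.indicator_of_notMem (by exact hx)]
    have : Real.exp (θ * Y) ≤ Real.exp (s * x + (θ - s) * Y) :=
      Real.exp_le_exp.2 (by nlinarith [mul_le_mul_of_nonneg_left (not_le.1 hx).le hs])
    linarith

/-- With z = x/V and N = x²/V, the exponential moment of order (1+ε)z lives mainly on [x, (1+ε)²x].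
The pieces outside are controlled by the moments of orders z and (1+2ε)z, and each is smaller by a
factor about exp(-ε²N/2). Hence half of the moment M comes from the event x ≤ Y, on which the part
inside the window is at most exp((1+ε)³N). -/
lemma le_upper_tail_aux (hB : IndepEvents P B) {x ε : ℝ} (hV : 0 < varHits P B)
    (hε : 0 < ε) (hε1 : ε ≤ 1 / 4) (hx0 : 0 < x) (hx : x ≤ ε ^ 2 / 20 * varHits P B)
    (hN : 8 / ε ^ 2 * varHits P B ≤ x ^ 2) :
    Real.exp (-((1 + 10 * ε) * (x ^ 2 / (2 * varHits P B)))) ≤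
      P.real {ω | x ≤ centered P B ω} := by
  set V := varHits P B with hVdef
  set z := x / V with hz
  set N := z ^ 2 * V with hNdef
  have hz0 : 0 < z := by positivity
  have hz1 : z ≤ ε ^ 2 / 20 := by rwa [hz, div_le_iff₀ hV]
  have hxz : x = z * V := by rw [hz]; field_simp
  have hNx : x ^ 2 / (2 * V) = N / 2 := by rw [hNdef, hz]; field_simp
  have hN8 : 8 / ε ^ 2 ≤ N := by
    rw [hNdef, hz, div_pow, sq V, ← div_div, div_mul_cancel₀ _ hV.ne', le_div_iff₀ hV]
    exact hN
  have hN0 : 0 < N := by positivity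
  have hεN : 8 ≤ ε ^ 2 * N := by
    have := mul_le_mul_of_nonneg_left hN8 (sq_nonneg ε)
    rwa [mul_div_cancel₀ _ (by positivity)] at this
  have hε2 : ε ^ 2 ≤ ε / 4 := by nlinarith
  have hε3 : ε ^ 3 ≤ ε / 16 := by
    rw [pow_succ]
    nlinarith
  have hup : ∀ c : ℝ, 0 ≤ c → c ≤ 3 / 2 →
      mgf (centered P B) P (c * z) ≤ Real.exp ((c ^ 2 / 2 + 7 / 4 * z) * N) := fun c hc hc1 => by
    have hcz : |c * z| = c * z := abs_of_nonneg (by positivity)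
    refine (hB.mgf_centered_le (by rw [hcz]; nlinarith)).trans (Real.exp_le_exp.2 ?_)
    rw [hcz]
    have : (c * z) ^ 2 / 2 * (1 + c * z) * V = (c ^ 2 / 2 + c ^ 3 / 2 * z) * N := by
      rw [hNdef]; ring
    have h3 : c ^ 3 ≤ (3 / 2) ^ 3 := pow_le_pow_left₀ hc hc1 3
    change (c * z) ^ 2 / 2 * (1 + c * z) * V ≤ _
    rw [this]
    norm_num at h3
    have h4 : c ^ 3 / 2 * z ≤ 7 / 4 * z := mul_le_mul_of_nonneg_right (by linarith) hz0.le
    exact mul_le_mul_of_nonneg_right (by linarith) hN0.le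
  have hlow : Real.exp (((1 + ε) ^ 2 / 2 - z) * N) ≤ mgf (centered P B) P ((1 + ε) * z) := by
    refine le_trans (Real.exp_le_exp.2 ?_)
      (hB.le_mgf_centered (θ := (1 + ε) * z) (by positivity) (by nlinarith))
    have : ((1 + ε) * z) ^ 2 / 2 * (1 - (1 + ε) * z) * V =
        ((1 + ε) ^ 2 / 2 - (1 + ε) ^ 3 / 2 * z) * N := by
      rw [hNdef]; ring
    have h3 : (1 + ε) ^ 3 ≤ (5 / 4) ^ 3 := pow_le_pow_left₀ (by positivity) (by linarith) 3
    change _ ≤ ((1 + ε) * z) ^ 2 / 2 * (1 - (1 + ε) * z) * V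
    rw [this]
    norm_num at h3
    have h4 : (1 + ε) ^ 3 / 2 * z ≤ 1 * z := mul_le_mul_of_nonneg_right (by linarith) hz0.le
    exact mul_le_mul_of_nonneg_right (by linarith) hN0.le
  -- The end point (1+ε)²x makes both truncation costs at most exp(-ε²N/2) relative to the main
  -- term, up to errors of order zN. As z ≤ ε²/20, a factor exp(-ε²N/4) remains, and this is at most
  -- exp(-2) because ε²N ≥ 8.
  have hmain := hB.mgf_sub_le (θ := (1 + ε) * z) (s := ε * z) (x := x) (y := (1 + ε) ^ 2 * x)
    (by positivity) (by positivity)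
  set M := Real.exp (((1 + ε) ^ 2 / 2 - z) * N) with hM
  have h4 : Real.exp (-2 : ℝ) ≤ 1 / 4 := by
    have h2 := Real.add_one_le_exp (1 : ℝ)
    have : Real.exp (2 : ℝ) = Real.exp 1 * Real.exp 1 := by rw [← Real.exp_add]; norm_num
    rw [Real.exp_neg, inv_eq_one_div]
    refine one_div_le_one_div_of_le (by norm_num) ?_
    nlinarith
  have hM0 : 0 < M := Real.exp_pos _
  clear_value z N M
  have e1 : Real.exp (ε * z * x) * mgf (centered P B) P ((1 + ε) * z - ε * z) ≤ M / 4 := by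
    have h5 := hup 1 (by norm_num) (by norm_num)
    rw [one_mul] at h5
    rw [show (1 + ε) * z - ε * z = z by ring]
    calc _ ≤ Real.exp (ε * z * x) * Real.exp ((1 ^ 2 / 2 + 7 / 4 * z) * N) := by gcongr
      _ = Real.exp (ε * N + (1 ^ 2 / 2 + 7 / 4 * z) * N) := by
        rw [← Real.exp_add, hxz, hNdef]; ring_nf
      _ ≤ Real.exp (((1 + ε) ^ 2 / 2 - z) * N + -2) := by
        refine Real.exp_le_exp.2 ?_
        have h6 : ε + (1 ^ 2 / 2 + 7 / 4 * z) ≤ (1 + ε) ^ 2 / 2 - z - ε ^ 2 / 4 := by linarith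
        linarith [mul_le_mul_of_nonneg_right h6 hN0.le]
      _ = M * Real.exp (-2) := by rw [Real.exp_add, hM]
      _ ≤ M / 4 := by linarith [mul_le_mul_of_nonneg_left h4 hM0.le]
  have e2 : Real.exp (-(ε * z * ((1 + ε) ^ 2 * x))) *
      mgf (centered P B) P ((1 + ε) * z + ε * z) ≤ M / 4 := by
    have h5 := hup (1 + 2 * ε) (by positivity) (by linarith)
    rw [show (1 + ε) * z + ε * z = (1 + 2 * ε) * z by ring]
    calc _ ≤ Real.exp (-(ε * z * ((1 + ε) ^ 2 * x))) *
          Real.exp (((1 + 2 * ε) ^ 2 / 2 + 7 / 4 * z) * N) := by gcongr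
      _ = Real.exp ((-(ε * (1 + ε) ^ 2) + ((1 + 2 * ε) ^ 2 / 2 + 7 / 4 * z)) * N) := by
        rw [← Real.exp_add, hxz, hNdef]; ring_nf
      _ ≤ Real.exp (((1 + ε) ^ 2 / 2 - z) * N + -2) := by
        refine Real.exp_le_exp.2 ?_
        have h6 : -(ε * (1 + ε) ^ 2) + ((1 + 2 * ε) ^ 2 / 2 + 7 / 4 * z) ≤
            (1 + ε) ^ 2 / 2 - z - ε ^ 2 / 4 := by linarith [pow_pos hε 3]
        linarith [mul_le_mul_of_nonneg_right h6 hN0.le]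
      _ = M * Real.exp (-2) := by rw [Real.exp_add, hM]
      _ ≤ M / 4 := by linarith [mul_le_mul_of_nonneg_left h4 hM0.le]
  have e3 : M / 2 ≤ Real.exp ((1 + ε) * z * ((1 + ε) ^ 2 * x)) *
      P.real {ω | x ≤ centered P B ω} := by linarith
  have e4 : Real.exp (-1 : ℝ) ≤ 1 / 2 := by
    have h2 := Real.add_one_le_exp (1 : ℝ)
    rw [Real.exp_neg, inv_eq_one_div]
    exact one_div_le_one_div_of_le (by norm_num) (by linarith)
  have e5 : Real.exp ((1 + ε) * z * ((1 + ε) ^ 2 * x)) *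
      Real.exp (-((1 + 10 * ε) * (x ^ 2 / (2 * V)))) ≤ M / 2 := by
    calc _ = Real.exp (((1 + ε) ^ 3 - (1 + 10 * ε) / 2) * N) := by
          rw [← Real.exp_add, hNx, hxz, hNdef]; ring_nf
      _ ≤ Real.exp (((1 + ε) ^ 2 / 2 - z) * N + -1) := by
        refine Real.exp_le_exp.2 ?_
        have : (1 + ε) ^ 3 - (1 + 10 * ε) / 2 ≤ (1 + ε) ^ 2 / 2 - z - ε ^ 2 / 8 := by
          linarith
        linarith [mul_le_mul_of_nonneg_right this hN0.le]
      _ = M * Real.exp (-1) := by rw [Real.exp_add, hM]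
      _ ≤ M / 2 := by linarith [mul_le_mul_of_nonneg_left e4 hM0.le]
  exact le_of_mul_le_mul_left (e5.trans e3) (Real.exp_pos _)

/-- A lower bound for moderate deviations (Kolmogorov's converse exponential inequality). -/
lemma le_upper_tail {η : ℝ} (hη : 0 < η) :
    ∃ K : ℝ, 0 < K ∧ ∀ B : ℕ → Set Ω, IndepEvents P B → ∀ x : ℝ, 0 < x →
      K * x ≤ varHits P B → K * varHits P B ≤ x ^ 2 →
      Real.exp (-((1 + η) * (x ^ 2 / (2 * varHits P B)))) ≤ P.real {ω | x ≤ centered P B ω} := by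
  obtain ⟨ε, hε, hε1, hεη⟩ : ∃ ε : ℝ, 0 < ε ∧ ε ≤ 1 / 4 ∧ 10 * ε ≤ η :=
    ⟨min (1 / 4) (η / 10), by positivity, min_le_left _ _, by
      linarith [min_le_right (1 / 4) (η / 10)]⟩
  refine ⟨20 / ε ^ 2, by positivity, fun B hB x hx0 hx hN => ?_⟩
  have hV : 0 < varHits P B := lt_of_lt_of_le (by positivity) hx
  refine le_trans (Real.exp_le_exp.2 ?_)
    (hB.le_upper_tail_aux hV hε hε1 hx0 ?_ ?_)
  · have : 0 ≤ x ^ 2 / (2 * varHits P B) := by positivity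
    nlinarith
  · have := mul_le_mul_of_nonneg_left hx (show 0 ≤ ε ^ 2 / 20 by positivity)
    rwa [← mul_assoc, div_mul_div_cancel₀ (by norm_num), div_self (by positivity), one_mul] at this
  · refine le_trans ?_ hN
    gcongr
    norm_num

end IndepEvents

end Tails

/-! ### Increasing families of independent indicators -/

section Families

variable {Ω : Type*} {A : ℕ → ℝ → Set Ω}

/-- The `σ`-algebra generated by the events `A k t`, `t ≥ 0`. -/
abbrev eventAlgebra (A : ℕ → ℝ → Set Ω) (k : ℕ) : MeasurableSpace Ω :=
  MeasurableSpace.generateFrom {E : Set Ω | ∃ t : ℝ, 0 ≤ t ∧ E = A k t}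

/-- The events `A k t` with `k ∈ R`. -/
def block (A : ℕ → ℝ → Set Ω) (R : Set ℕ) (t : ℝ) (k : ℕ) : Set Ω := {ω | k ∈ R ∧ ω ∈ A k t}

/-- The events that occur between the times `s` and `u`. -/
def increment (A : ℕ → ℝ → Set Ω) (s u : ℝ) (k : ℕ) : Set Ω := A k u \ A k s

lemma count_eq_hits (t : ℝ) : count A t = hits fun k => A k t := rfl

lemma countOn_eq_hits (R : Set ℕ) (t : ℝ) : countOn A R t = hits (block A R t) := by
  ext ω
  rw [countOn, tsum_subtype R fun k => (A k t).indicator (fun _ => (1 : ℝ)) ω, hits]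
  refine tsum_congr fun k => ?_
  by_cases hk : k ∈ R <;> by_cases hω : ω ∈ A k t <;> simp [block, hk, hω]

lemma block_subset (R : Set ℕ) (t : ℝ) (k : ℕ) : block A R t k ⊆ A k t := fun _ h => h.2

lemma measurableSet_eventAlgebra {t : ℝ} (ht : 0 ≤ t) (k : ℕ) :
    MeasurableSet[eventAlgebra A k] (A k t) :=
  MeasurableSpace.measurableSet_generateFrom ⟨t, ht, rfl⟩

lemma measurableSet_block {t : ℝ} (ht : 0 ≤ t) (R : Set ℕ) (k : ℕ) :
    MeasurableSet[eventAlgebra A k] (block A R t k) := by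
  by_cases hk : k ∈ R
  · simpa [block, hk] using measurableSet_eventAlgebra (A := A) ht k
  · simp [block, hk]

variable [MeasurableSpace Ω] {P : Measure Ω}

/-- Independent families of events, increasing in time, of which almost surely only finitely many
occur at each time. -/
structure IndicatorProcess (P : Measure Ω) (A : ℕ → ℝ → Set Ω) : Prop where
  measurableSet : ∀ k t, 0 ≤ t → MeasurableSet (A k t)
  indep : iIndep (eventAlgebra A) P
  finite : ∀ t : ℝ, 0 ≤ t → ∑' k, P (A k t) ≠ ∞
  mono : ∀ (k : ℕ) (s t : ℝ), 0 < s → s < t → A k s ⊆ A k t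

/-- The centred process `X(t) - E X(t)`. -/
noncomputable def deviation (P : Measure Ω) (A : ℕ → ℝ → Set Ω) (t : ℝ) (ω : Ω) : ℝ :=
  count A t ω - mean P A t

namespace IndicatorProcess

lemma eventAlgebra_le (hA : IndicatorProcess P A) (k : ℕ) :
    eventAlgebra A k ≤ (inferInstance : MeasurableSpace Ω) := by
  refine MeasurableSpace.generateFrom_le ?_
  rintro _ ⟨t, ht, rfl⟩
  exact hA.measurableSet k t ht

lemma indepEvents_of_subset (hA : IndicatorProcess P A) {t : ℝ} (ht : 0 ≤ t) {B : ℕ → Set Ω}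
    (hB : ∀ k, MeasurableSet[eventAlgebra A k] (B k)) (hsub : ∀ k, B k ⊆ A k t) :
    IndepEvents P B where
  measurableSet k := hA.eventAlgebra_le k _ (hB k)
  indep := by
    rw [iIndepSet_iff_meas_biInter fun k => hA.eventAlgebra_le k _ (hB k)]
    exact fun s => hA.indep.meas_biInter fun k _ => hB k
  finite := ne_top_of_le_ne_top (hA.finite t ht) (ENNReal.tsum_le_tsum fun k => measure_mono (hsub k))

lemma events (hA : IndicatorProcess P A) {t : ℝ} (ht : 0 ≤ t) :
    IndepEvents P fun k => A k t :=
  hA.indepEvents_of_subset ht (measurableSet_eventAlgebra ht) fun _ => subset_rfl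

lemma block_events (hA : IndicatorProcess P A) {t : ℝ} (ht : 0 ≤ t) (R : Set ℕ) :
    IndepEvents P (block A R t) :=
  hA.indepEvents_of_subset ht (measurableSet_block ht R) (block_subset R t)

lemma increment_events (hA : IndicatorProcess P A) {s u : ℝ} (hs : 0 ≤ s) (hu : 0 ≤ u) :
    IndepEvents P (increment A s u) :=
  hA.indepEvents_of_subset hu
    (fun k => (measurableSet_eventAlgebra hu k).diff (measurableSet_eventAlgebra hs k))
    fun _ => Set.sdiff_subset

lemma subset_of_le (hA : IndicatorProcess P A) {s t : ℝ} (hs : 0 < s) (hst : s ≤ t) (k : ℕ) :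
    A k s ⊆ A k t := by
  rcases hst.eq_or_lt with rfl | h
  · exact subset_rfl
  · exact hA.mono k s t hs h

/-- A single null set serves all times: summability holds at the integers, and monotonicity in time
passes it down. -/
lemma ae_summable (hA : IndicatorProcess P A) :
    ∀ᵐ ω ∂P, ∀ t : ℝ, 0 < t → Summable fun k => (A k t).indicator (fun _ => (1 : ℝ)) ω := by
  have h : ∀ᵐ ω ∂P, ∀ n : ℕ, Summable fun k => (A k n).indicator (fun _ => (1 : ℝ)) ω :=
    ae_all_iff.2 fun n => (hA.events n.cast_nonneg).ae_summable
  filter_upwards [h] with ω hω t ht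
  obtain ⟨n, hn⟩ := exists_nat_ge t
  refine (hω n).of_nonneg_of_le (fun k => indicator_one_nonneg _ _) fun k => ?_
  exact Set.indicator_le_indicator_of_subset (hA.subset_of_le ht hn k) (fun _ => zero_le_one) ω

lemma ae_count_mono (hA : IndicatorProcess P A) :
    ∀ᵐ ω ∂P, ∀ s t : ℝ, 0 < s → s ≤ t → count A s ω ≤ count A t ω := by
  filter_upwards [hA.ae_summable] with ω hω s t hs hst
  exact (hω s hs).tsum_le_tsum (fun k => Set.indicator_le_indicator_of_subset
    (hA.subset_of_le hs hst k) (fun _ => zero_le_one) ω) (hω t (hs.trans_le hst))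

variable [IsProbabilityMeasure P]

lemma mean_eq (hA : IndicatorProcess P A) {t : ℝ} (ht : 0 ≤ t) :
    mean P A t = ∑' k, P.real (A k t) := (hA.events ht).integral_hits

lemma var_eq (hA : IndicatorProcess P A) {t : ℝ} (ht : 0 ≤ t) :
    var P A t = varHits P fun k => A k t := (hA.events ht).variance_hits

lemma deviation_eq (hA : IndicatorProcess P A) {t : ℝ} (ht : 0 ≤ t) :
    deviation P A t = centered P fun k => A k t := by
  ext ω
  rw [deviation, hA.mean_eq ht, centered, count_eq_hits, meanHits]

lemma var_le_mean (hA : IndicatorProcess P A) {t : ℝ} (ht : 0 ≤ t) :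
    var P A t ≤ mean P A t := by
  rw [hA.var_eq ht, hA.mean_eq ht]
  exact (hA.events ht).varHits_le_meanHits

lemma real_increment (hA : IndicatorProcess P A) {s u : ℝ} (hs : 0 < s) (hsu : s ≤ u) (k : ℕ) :
    P.real (increment A s u k) = P.real (A k u) - P.real (A k s) :=
  measureReal_sdiff (hA.subset_of_le hs hsu k) (hA.measurableSet k s hs.le)

lemma meanHits_increment (hA : IndicatorProcess P A) {s u : ℝ} (hs : 0 < s) (hsu : s ≤ u) :
    meanHits P (increment A s u) = mean P A u - mean P A s := by
  have hu := hs.le.trans hsu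
  rw [meanHits, hA.mean_eq hu, hA.mean_eq hs.le,
    ← (hA.events hu).summable_real.tsum_sub (hA.events hs.le).summable_real]
  exact tsum_congr (hA.real_increment hs hsu)

lemma mean_mono (hA : IndicatorProcess P A) {s u : ℝ} (hs : 0 < s) (hsu : s ≤ u) :
    mean P A s ≤ mean P A u := by
  have h : 0 ≤ meanHits P (increment A s u) := tsum_nonneg fun k => measureReal_nonneg
  rw [hA.meanHits_increment hs hsu] at h
  linarith

/-- The function p(1-p) is 1-Lipschitz on [0,1], and the probabilities only increase. -/
lemma abs_var_sub_le (hA : IndicatorProcess P A) {s u : ℝ} (hs : 0 < s) (hsu : s ≤ u) :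
    |var P A u - var P A s| ≤ mean P A u - mean P A s := by
  have hu := hs.le.trans hsu
  have h1 := (hA.events hu).summable_var
  have h2 := (hA.events hs.le).summable_var
  rw [← hA.meanHits_increment hs hsu, hA.var_eq hu, hA.var_eq hs.le, varHits, varHits,
    ← h1.tsum_sub h2, meanHits]
  have h3 : ∀ k, |P.real (A k u) * (1 - P.real (A k u)) - P.real (A k s) * (1 - P.real (A k s))| ≤
      P.real (increment A s u k) := fun k => by
    have e0 : 0 ≤ P.real (increment A s u k) := measureReal_nonneg
    rw [hA.real_increment hs hsu] at e0 ⊢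
    have e1 : 0 ≤ P.real (A k s) := measureReal_nonneg
    have e2 : P.real (A k u) ≤ 1 := measureReal_le_one
    rw [abs_le]
    constructor <;> nlinarith
  have h4 := (hA.increment_events hs.le hu).summable_real
  have h5 : Summable fun k =>
      |P.real (A k u) * (1 - P.real (A k u)) - P.real (A k s) * (1 - P.real (A k s))| :=
    h4.of_nonneg_of_le (fun k => abs_nonneg _) h3
  refine le_trans ?_ (h5.tsum_le_tsum h3 h4)
  exact norm_tsum_le_tsum_norm (f := fun k =>
    P.real (A k u) * (1 - P.real (A k u)) - P.real (A k s) * (1 - P.real (A k s))) h5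

lemma ae_deviation_sub_eq (hA : IndicatorProcess P A) {s u : ℝ} (hs : 0 < s) (hsu : s ≤ u) :
    ∀ᵐ ω ∂P, deviation P A u ω - deviation P A s ω = centered P (increment A s u) ω := by
  filter_upwards [hA.ae_summable] with ω hω
  have h1 : hits (increment A s u) ω = count A u ω - count A s ω := by
    rw [count, count, ← (hω u (hs.trans_le hsu)).tsum_sub (hω s hs), hits]
    refine tsum_congr fun k => ?_
    have hsub := hA.subset_of_le hs hsu k
    by_cases h1 : ω ∈ A k s
    · have h2 := hsub h1
      simp [increment, h1, h2]
    · by_cases h2 : ω ∈ A k u <;> simp [increment, h1, h2]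
  rw [deviation, deviation, centered, h1, hA.meanHits_increment hs hsu]
  ring

lemma ae_deviation_eq_add (hA : IndicatorProcess P A) {t : ℝ} (ht : 0 < t) (R : Set ℕ) :
    ∀ᵐ ω ∂P, deviation P A t ω = centered P (block A R t) ω + centered P (block A Rᶜ t) ω := by
  filter_upwards [hA.ae_summable] with ω hω
  have h1 : count A t ω = hits (block A R t) ω + hits (block A Rᶜ t) ω := by
    have hle : ∀ (S : Set ℕ) (k : ℕ), (block A S t k).indicator (fun _ => (1 : ℝ)) ω ≤
        (A k t).indicator (fun _ => (1 : ℝ)) ω := fun S k =>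
      Set.indicator_le_indicator_of_subset (block_subset S t k) (fun _ => zero_le_one) ω
    rw [hits, hits, ← ((hω t ht).of_nonneg_of_le (fun k => indicator_one_nonneg _ _)
      (hle R)).tsum_add ((hω t ht).of_nonneg_of_le (fun k => indicator_one_nonneg _ _) (hle Rᶜ)),
      count]
    refine tsum_congr fun k => ?_
    by_cases hk : k ∈ R <;> by_cases hω : ω ∈ A k t <;> simp [block, hk, hω]
  have h2 : mean P A t = meanHits P (block A R t) + meanHits P (block A Rᶜ t) := by
    rw [hA.mean_eq ht.le, meanHits, meanHits, ← (hA.block_events ht.le R).summable_real.tsum_add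
      (hA.block_events ht.le Rᶜ).summable_real]
    refine tsum_congr fun k => ?_
    by_cases hk : k ∈ R <;> simp [block, hk]
  rw [deviation, centered, centered, h1, h2]
  ring

lemma varHits_block_add (hA : IndicatorProcess P A) {t : ℝ} (ht : 0 ≤ t) (R : Set ℕ) :
    varHits P (block A R t) + varHits P (block A Rᶜ t) = var P A t := by
  rw [hA.var_eq ht, varHits, varHits, ← (hA.block_events ht R).summable_var.tsum_add
    (hA.block_events ht Rᶜ).summable_var]
  refine tsum_congr fun k => ?_
  by_cases hk : k ∈ R <;> simp [block, hk]

lemma variance_countOn (hA : IndicatorProcess P A) {t : ℝ} (ht : 0 ≤ t) (R : Set ℕ) :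
    variance (countOn A R t) P = varHits P (block A R t) := by
  rw [countOn_eq_hits, (hA.block_events ht R).variance_hits]

end IndicatorProcess

end Families

/-! ### Passage times -/

section LevelTime

/-- The first passage time `inf {t > 0 : f(t) > v}`. -/
noncomputable def levelTime (f : ℝ → ℝ) (v : ℝ) : ℝ := sInf {t | 0 < t ∧ v < f t}

variable {f : ℝ → ℝ} {v t : ℝ}

lemma bddBelow_levelSet (f : ℝ → ℝ) (v : ℝ) : BddBelow {t | 0 < t ∧ v < f t} :=
  ⟨0, fun _ h => h.1.le⟩

lemma levelSet_nonempty (hf : Tendsto f atTop atTop) (v : ℝ) : {t | 0 < t ∧ v < f t}.Nonempty :=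
  ((eventually_gt_atTop 0).and (hf.eventually_gt_atTop v)).exists

lemma le_of_lt_levelTime (ht : 0 < t) (h : t < levelTime f v) : f t ≤ v := by
  by_contra hv
  exact (csInf_le (bddBelow_levelSet f v) ⟨ht, not_le.1 hv⟩).not_gt h

lemma exists_lt_of_levelTime_lt (hf : Tendsto f atTop atTop) (h : levelTime f v < t) :
    ∃ s, 0 < s ∧ levelTime f v ≤ s ∧ s < t ∧ v < f s := by
  obtain ⟨s, hs, hst⟩ := exists_lt_of_csInf_lt (levelSet_nonempty hf v) h
  exact ⟨s, hs.1, csInf_le (bddBelow_levelSet f v) hs, hst, hs.2⟩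

lemma le_levelTime (hf : Tendsto f atTop atTop) (h : ∀ s, 0 < s → s < t → f s ≤ v) :
    t ≤ levelTime f v := by
  refine le_csInf (levelSet_nonempty hf v) fun s hs => ?_
  by_contra hst
  exact (h s hs.1 (not_le.1 hst)).not_gt hs.2

lemma levelTime_mono (hf : Tendsto f atTop atTop) : Monotone (levelTime f) := fun _ _ hvw =>
  csInf_le_csInf (bddBelow_levelSet f _) (levelSet_nonempty hf _)
    fun _ hs => ⟨hs.1, hvw.trans_lt hs.2⟩

lemma tendsto_levelTime (hf : Tendsto f atTop atTop)
    (hbdd : ∀ K : ℝ, ∃ M : ℝ, ∀ t, 0 < t → t ≤ K → f t ≤ M) :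
    Tendsto (levelTime f) atTop atTop := by
  refine tendsto_atTop.2 fun K => ?_
  obtain ⟨M, hM⟩ := hbdd K
  filter_upwards [eventually_ge_atTop M] with v hv
  exact le_levelTime hf fun s hs hsK => (hM s hs hsK.le).trans hv

lemma exists_mem_and_succ_notMem {p : ℕ → Prop} (h0 : p 0) :
    ∀ j : ℕ, ¬ p j → ∃ k < j, p k ∧ ¬ p (k + 1)
  | 0, h => absurd h0 h
  | j + 1, h => by
    by_cases hj : p j
    · exact ⟨j, j.lt_succ_self, hj, h⟩
    · obtain ⟨k, hk, h1⟩ := exists_mem_and_succ_notMem h0 j hj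
      exact ⟨k, hk.trans j.lt_succ_self, h1⟩

/-- The passage times of `b` approximate the levels up to a bounded error. -/
def HasBoundedJumps (b : ℝ → ℝ) : Prop :=
  ∃ C : ℝ, 0 ≤ C ∧ ∀ᶠ v in atTop, |b (levelTime b v) - v| ≤ C

variable {a b : ℝ → ℝ} {μ q : ℝ}

lemma tendsto_meanLevel (hμ : 1 ≤ μ) (hq : μ = 1 → 0 ≤ q) {κ ϱ : ℝ} (hκ : κ < 1) (hϱ : 0 < ϱ) :
    Tendsto (meanLevel μ q κ ϱ) atTop atTop := by
  by_cases h : μ = 1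
  · have h1 : 0 < (1 - κ) / (q + ϱ + 1) := div_pos (by linarith) (by linarith [hq h])
    have h2 : meanLevel μ q κ ϱ = fun n : ℕ => Real.exp ((n : ℝ) ^ ((1 - κ) / (q + ϱ + 1))) := by
      ext n
      simp [meanLevel, h]
    rw [h2]
    exact Real.tendsto_exp_atTop.comp ((tendsto_rpow_atTop h1).comp tendsto_natCast_atTop_atTop)
  · have h1 : 0 < (μ + ϱ) * (1 - κ) / (μ + ϱ - 1) :=
      div_pos (mul_pos (by linarith) (by linarith)) (by linarith)
    have h2 : meanLevel μ q κ ϱ =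
        fun n : ℕ => (n : ℝ) ^ ((μ + ϱ) * (1 - κ) / (μ + ϱ - 1)) := by
      ext n
      simp [meanLevel, h]
    rw [h2]
    exact (tendsto_rpow_atTop h1).comp tendsto_natCast_atTop_atTop

lemma bddAbove_of_mono (hb : ∀ s t, 0 < s → s ≤ t → b s ≤ b t) (K : ℝ) :
    ∃ M : ℝ, ∀ t, 0 < t → t ≤ K → b t ≤ M :=
  ⟨b K, fun t ht htK => hb t K ht htK⟩

/-- Concatenating the partitions covers a half-line, so every large time has a later and an earlier
time at which b differs by at most C. Just before the passage time b is at most v, and arbitrarily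
soon after it, or at it, b exceeds v. -/
lemma hasBoundedJumps (hμ : 1 ≤ μ) (hq : μ = 1 → 0 ≤ q) (hb : Tendsto b atTop atTop)
    (hmono : ∀ s t, 0 < s → s ≤ t → b s ≤ b t) (h : HasFinePartitions a b μ q) :
    HasBoundedJumps b := by
  obtain ⟨κ, hκ, hκ1⟩ := ((h (1 / 2) (by norm_num) (by norm_num)).and
    (nhdsWithin_le_nhds (eventually_lt_nhds (zero_lt_one' ℝ)))).exists
  obtain ⟨C, hC, j, s, hpart, -⟩ := hκ
  have hT := tendsto_levelTime hb (bddAbove_of_mono hmono)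
  set T : ℕ → ℝ := fun n => meanTime b μ q κ (1 / 2) n with hTdef
  -- `meanTime` is by definition `levelTime` evaluated at `meanLevel`; κ < 1 makes these levels
  -- diverge.
  have hTn : Tendsto T atTop atTop := hT.comp (tendsto_meanLevel hμ hq hκ1 (by norm_num))
  obtain ⟨N, hN⟩ := eventually_atTop.1 (hpart.and (hTn.eventually_gt_atTop 0))
  have hspos : ∀ n, N ≤ n → ∀ k ≤ j n, 0 < s n k := fun n hn k => by
    induction k with
    | zero =>
      intro _
      rw [(hN n hn).1.2.1]
      exact (hN n hn).2
    | succ k ih =>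
      intro hk
      exact (ih (by omega)).trans ((hN n hn).1.2.2.2 k (by omega)).1
  have hright : ∀ t, T N ≤ t → ∃ t', t < t' ∧ b t' ≤ b t + C := fun t ht => by
    obtain ⟨m, hm⟩ := (hTn.eventually_gt_atTop t).exists_forall_of_atTop
    obtain ⟨n, -, hn1, hn2⟩ := exists_mem_and_succ_notMem (p := fun n => T (N + n) ≤ t) ht m
      (not_le.2 (hm (N + m) (by omega)))
    obtain ⟨⟨-, h0, h1, hk⟩, -⟩ := hN (N + n) (by omega)
    obtain ⟨k, hkj, hk1, hk2⟩ := exists_mem_and_succ_notMem (p := fun k => s (N + n) k ≤ t)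
      (by rw [h0]; exact hn1) (j (N + n)) (by rw [h1]; exact hn2)
    refine ⟨s (N + n) (k + 1), not_le.1 hk2, ?_⟩
    have h2 := hmono _ t (hspos (N + n) (by omega) k hkj.le) hk1
    linarith [(hk k hkj).2.2]
  have hleft : ∀ t, T N < t → ∃ t', 0 < t' ∧ t' < t ∧ b t ≤ b t' + C := fun t ht => by
    obtain ⟨m, hm⟩ := (hTn.eventually_ge_atTop t).exists_forall_of_atTop
    obtain ⟨n, -, hn1, hn2⟩ := exists_mem_and_succ_notMem (p := fun n => T (N + n) < t) ht m
      (not_lt.2 (hm (N + m) (by omega)))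
    obtain ⟨⟨-, h0, h1, hk⟩, -⟩ := hN (N + n) (by omega)
    obtain ⟨k, hkj, hk1, hk2⟩ := exists_mem_and_succ_notMem (p := fun k => s (N + n) k < t)
      (by rw [h0]; exact hn1) (j (N + n)) (by rw [h1]; exact hn2)
    have hpos := hspos (N + n) (by omega) k hkj.le
    refine ⟨s (N + n) k, hpos, hk1, ?_⟩
    have h2 := hmono t _ (hpos.trans hk1) (not_lt.1 hk2)
    linarith [(hk k hkj).2.2]
  refine ⟨C, by linarith, ?_⟩
  filter_upwards [hT.eventually_gt_atTop (T N), hT.eventually_gt_atTop 0] with v hv hv0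
  rw [abs_le]
  constructor
  · obtain ⟨t', ht', hbt'⟩ := hright _ hv.le
    obtain ⟨r, hr0, -, hr1, hr2⟩ := exists_lt_of_levelTime_lt hb ht'
    linarith [hmono r t' hr0 hr1.le]
  · obtain ⟨t', ht0, ht', hbt'⟩ := hleft _ hv
    linarith [le_of_lt_levelTime ht0 ht']

end LevelTime

/-! ### Slowly varying functions -/

section SlowVariation

/-- The uniform convergence theorem for slowly varying functions, in additive form. -/
lemma uniform_of_tendsto_sub {h : ℝ → ℝ} (hm : Measurable h)
    (hlim : ∀ s : ℝ, 0 ≤ s → Tendsto (fun u => h (u + s) - h u) atTop (𝓝 0)) {ε : ℝ} (hε : 0 < ε) :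
    ∀ᶠ u in atTop, ∀ s, 0 ≤ s → s ≤ 1 → |h (u + s) - h u| ≤ ε := by
  by_contra hcon
  have hfreq : ∃ᶠ u in atTop, ∃ s, 0 ≤ s ∧ s ≤ 1 ∧ ε < |h (u + s) - h u| := by
    refine (not_eventually.1 hcon).mono fun u hu => ?_
    push Not at hu
    exact hu
  have hex : ∀ n : ℕ, ∃ u : ℝ, (n : ℝ) ≤ u ∧ ∃ s, 0 ≤ s ∧ s ≤ 1 ∧ ε < |h (u + s) - h u| :=
    fun n => by
      obtain ⟨u, hu, hs⟩ := (hfreq.and_eventually (eventually_ge_atTop (n : ℝ))).exists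
      exact ⟨u, hs, hu⟩
  choose u hu s hs0 hs1 hs using hex
  have hutop : Tendsto u atTop atTop := tendsto_atTop_mono hu tendsto_natCast_atTop_atTop
  have hustop : Tendsto (fun n => u n + s n) atTop atTop :=
    tendsto_atTop_mono (fun n => by linarith [hs0 n]) hutop
  -- Pointwise convergence implies convergence in measure on a bounded interval. Applied to the base
  -- points u_n and u_n + s_n, it yields two exceptional sets of measure below 1/2. If the increment
  -- from u_n to u_n + s_n exceeded ε, these sets, one of them translated, would cover an interval
  -- of length 1.
  have key : ∀ w : ℕ → ℝ, Tendsto w atTop atTop →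
      ∀ᶠ n in atTop, volume {r ∈ Set.Icc (0 : ℝ) 3 | ε / 2 ≤ |h (w n + r) - h (w n)|} <
        ENNReal.ofReal (1 / 2) := fun w hw => by
    have h1 : TendstoInMeasure (volume.restrict (Set.Icc (0 : ℝ) 3))
        (fun n r => h (w n + r) - h (w n)) atTop (fun _ => (0 : ℝ)) := by
      refine tendstoInMeasure_of_tendsto_ae (fun n => ?_) ?_
      · exact ((hm.comp (measurable_const_add (w n))).sub_const _).aestronglyMeasurable
      · filter_upwards [ae_restrict_mem measurableSet_Icc] with r hr
        exact (hlim r hr.1).comp hw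
    have h2 := (tendstoInMeasure_iff_norm.1 h1 (ε / 2) (by positivity)).eventually
      (gt_mem_nhds (show (0 : ℝ≥0∞) < ENNReal.ofReal (1 / 2) by simp))
    filter_upwards [h2] with n hn
    rw [Measure.restrict_apply' measurableSet_Icc] at hn
    refine lt_of_le_of_lt (measure_mono fun r hr => ?_) hn
    exact ⟨by simpa using hr.2, hr.1⟩
  obtain ⟨n, hn1, hn2⟩ := ((key u hutop).and (key _ hustop)).exists
  set E := {r ∈ Set.Icc (0 : ℝ) 3 | ε / 2 ≤ |h (u n + r) - h (u n)|} with hE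
  set F := {r ∈ Set.Icc (0 : ℝ) 3 | ε / 2 ≤ |h (u n + s n + r) - h (u n + s n)|} with hF
  have hcover : Set.Icc (s n) (s n + 1) ⊆ E ∪ (fun r => s n + r) '' F := fun r hr => by
    by_cases h1 : ε / 2 ≤ |h (u n + r) - h (u n)|
    · exact Or.inl ⟨⟨(hs0 n).trans hr.1, by linarith [hr.2, hs1 n]⟩, h1⟩
    · refine Or.inr ⟨r - s n, ⟨⟨by linarith [hr.1], by linarith [hr.2]⟩, ?_⟩, by ring⟩
      rw [show u n + s n + (r - s n) = u n + r by ring]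
      have h2 := abs_sub_le (h (u n + s n)) (h (u n + r)) (h (u n))
      rw [abs_sub_comm (h (u n + s n)) (h (u n + r))] at h2
      linarith [hs n, not_le.1 h1]
  have h3 : volume (Set.Icc (s n) (s n + 1)) ≤ volume E + volume F := by
    refine (measure_mono hcover).trans ((measure_union_le _ _).trans ?_)
    rw [Set.image_add_left, measure_preimage_add]
  rw [Real.volume_Icc, add_sub_cancel_left] at h3
  have h4 : volume E + volume F < ENNReal.ofReal (1 / 2) + ENNReal.ofReal (1 / 2) :=
    ENNReal.add_lt_add hn1 hn2
  rw [← ENNReal.ofReal_add (by norm_num) (by norm_num)] at h4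
  norm_num at h3 h4
  exact (h3.trans_lt h4).false

/-- A slowly varying function is eventually smaller than any positive power. -/
lemma SlowlyVarying.eventually_le_rpow {L : ℝ → ℝ} (hL : SlowlyVarying L) {η : ℝ} (hη : 0 < η) :
    ∀ᶠ x in atTop, L x ≤ x ^ η := by
  -- In logarithmic coordinates slow variation says that increments of h over a fixed distance
  -- vanish. By uniformity h grows by at most η/2 per unit step, which leaves room for the additive
  -- constant below slope η.
  set h : ℝ → ℝ := fun u => Real.log (L (Real.exp u)) with hh
  have hm : Measurable h := Real.measurable_log.comp (hL.measurable.comp Real.measurable_exp)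
  have hpos : ∀ᶠ u in atTop, 0 < L (Real.exp u) :=
    Real.tendsto_exp_atTop.eventually hL.eventually_pos
  have hlim : ∀ s : ℝ, 0 ≤ s → Tendsto (fun u => h (u + s) - h u) atTop (𝓝 0) := fun s hs => by
    have h1 := ((hL.tendsto (Real.exp s) (Real.exp_pos s)).comp Real.tendsto_exp_atTop).log
      one_ne_zero
    rw [Real.log_one] at h1
    refine h1.congr' ?_
    filter_upwards [hpos, (tendsto_atTop_add_const_right atTop s tendsto_id).eventually hpos]
      with u hu hus
    simp only [Function.comp_apply, id] at hus ⊢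
    rw [← Real.exp_add, add_comm s u, Real.log_div hus.ne' hu.ne']
  obtain ⟨u₀, hu₀⟩ := eventually_atTop.1 (uniform_of_tendsto_sub hm hlim (half_pos hη))
  have hstep : ∀ n : ℕ, ∀ s, 0 ≤ s → s ≤ 1 → h (u₀ + n + s) ≤ h u₀ + (n + 1) * (η / 2) :=
    fun n => by
      induction n with
      | zero =>
        intro s hs0 hs1
        have := (abs_le.1 (hu₀ u₀ le_rfl s hs0 hs1)).2
        norm_num
        linarith
      | succ n ih =>
        intro s hs0 hs1
        have h1 := (abs_le.1 (hu₀ (u₀ + n + 1) (by linarith [n.cast_nonneg (α := ℝ)]) s hs0 hs1)).2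
        have h2 := ih 1 zero_le_one le_rfl
        push_cast
        rw [← add_assoc u₀]
        linarith
  have hbound : ∀ᶠ u in atTop, h u ≤ η * u := by
    filter_upwards [eventually_ge_atTop u₀,
      eventually_ge_atTop ((h u₀ + (1 - u₀) * (η / 2)) / (η / 2))] with u hu hu1
    have h1 := hstep ⌊u - u₀⌋₊ (u - u₀ - ⌊u - u₀⌋₊)
      (sub_nonneg.2 (Nat.floor_le (by linarith))) (by linarith [Nat.lt_floor_add_one (u - u₀)])
    rw [show u₀ + (⌊u - u₀⌋₊ : ℝ) + (u - u₀ - ⌊u - u₀⌋₊) = u by ring] at h1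
    have h2 := Nat.floor_le (show 0 ≤ u - u₀ by linarith)
    rw [div_le_iff₀ (by positivity)] at hu1
    have h3 := mul_le_mul_of_nonneg_right (add_le_add_left h2 1) (half_pos hη).le
    linarith
  filter_upwards [Real.tendsto_log_atTop.eventually hbound, eventually_gt_atTop 0,
    hL.eventually_pos] with x hx hx0 hxL
  simp only [hh, Real.exp_log hx0] at hx
  rw [← Real.exp_log hxL, Real.rpow_def_of_pos hx0]
  exact Real.exp_le_exp.2 (hx.trans_eq (mul_comm _ _))

end SlowVariation

/-! ### The norming function -/

section Norming

/-- Rate functions: eventually increasing to infinity, sublinear and varying slowly. -/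
structure RateFunction (ψ : ℝ → ℝ) : Prop where
  tendsto : Tendsto ψ atTop atTop
  mono : ∃ x₀ : ℝ, MonotoneOn ψ (Set.Ici x₀)
  sublinear : Tendsto (fun x => ψ x / x) atTop (𝓝 0)
  slow : ∀ ε : ℝ, 0 < ε → ∀ᶠ x in atTop, ψ ((1 + ε) * x) ≤ (1 + ε) * ψ x

/-- `√(2 x ψ(x))`. -/
noncomputable def norming (ψ : ℝ → ℝ) (x : ℝ) : ℝ := √(2 * x * ψ x)

variable {ψ : ℝ → ℝ}

namespace RateFunction

lemma norming_sq (hψ : RateFunction ψ) : ∀ᶠ x in atTop, norming ψ x ^ 2 = 2 * x * ψ x := by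
  filter_upwards [hψ.tendsto.eventually_ge_atTop 0, eventually_ge_atTop 0] with x h1 h2
  exact Real.sq_sqrt (by positivity)

lemma le_norming_sq (hψ : RateFunction ψ) : ∀ᶠ x in atTop, x ≤ norming ψ x ^ 2 := by
  filter_upwards [hψ.norming_sq, hψ.tendsto.eventually_ge_atTop 1, eventually_ge_atTop 0]
    with x h1 h2 h3
  rw [h1]
  nlinarith

lemma sqrt_le_norming (hψ : RateFunction ψ) : ∀ᶠ x in atTop, √x ≤ norming ψ x := by
  filter_upwards [hψ.le_norming_sq] with x h1
  exact (Real.sqrt_le_left (Real.sqrt_nonneg _)).2 h1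

lemma tendsto_norming (hψ : RateFunction ψ) : Tendsto (norming ψ) atTop atTop :=
  tendsto_atTop_mono' _ hψ.sqrt_le_norming Real.tendsto_sqrt_atTop

lemma norming_le_mul (hψ : RateFunction ψ) {ε : ℝ} (hε : 0 < ε) :
    ∀ᶠ x in atTop, norming ψ x ≤ ε * x := by
  filter_upwards [hψ.norming_sq, hψ.sublinear.eventually_lt_const (show 0 < ε ^ 2 / 2 by positivity),
    eventually_gt_atTop 0] with x h1 h2 h3
  refine (le_abs_self _).trans (abs_le_of_sq_le_sq ?_ (by positivity))
  rw [h1]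
  rw [div_lt_iff₀ h3] at h2
  nlinarith

lemma exists_norming_le (hψ : RateFunction ψ) {ε : ℝ} (hε : 0 < ε) :
    ∃ X : ℝ, ∀ x y, X ≤ x → X ≤ y → y ≤ (1 + ε) * x → norming ψ y ≤ (1 + ε) * norming ψ x := by
  obtain ⟨x₀, hx₀⟩ := hψ.mono
  obtain ⟨X, hX⟩ := eventually_atTop.1 (((hψ.slow ε hε).and hψ.norming_sq).and
    ((hψ.tendsto.eventually_ge_atTop 0).and (eventually_ge_atTop (max x₀ 0))))
  refine ⟨X, fun x y hx hy hxy => ?_⟩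
  obtain ⟨⟨e1, e2⟩, e3, e4⟩ := hX x hx
  obtain ⟨⟨-, f2⟩, f3, f4⟩ := hX y hy
  refine (le_abs_self _).trans (abs_le_of_sq_le_sq ?_ (mul_nonneg (by positivity) (Real.sqrt_nonneg _)))
  rw [mul_pow, e2, f2]
  have hy0 : 0 ≤ y := (le_max_right _ _).trans f4
  have h1 : ψ y ≤ (1 + ε) * ψ x := (hx₀ ((le_max_left _ _).trans f4)
    ((le_max_left _ _).trans (f4.trans hxy)) hxy).trans e1
  have h2 := mul_le_mul hxy h1 f3 (hy0.trans hxy)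
  nlinarith

end RateFunction

end Norming

/-! ### Borel-Cantelli arguments -/

section BorelCantelli

variable {Ω : Type*} [MeasurableSpace Ω] {P : Measure Ω} [IsProbabilityMeasure P]

lemma ae_eventually_notMem_of_summable {E : ℕ → Set Ω} {r : ℕ → ℝ} (hr : Summable r)
    (h : ∀ᶠ n in atTop, P.real (E n) ≤ r n) : ∀ᵐ ω ∂P, ∀ᶠ n in atTop, ω ∉ E n := by
  have h1 : Summable fun n => P.real (E n) :=
    summable_of_isBigO_nat hr <| IsBigO.of_bound 1 <| by
      filter_upwards [h] with n hn
      rw [one_mul, Real.norm_eq_abs, Real.norm_eq_abs, abs_of_nonneg measureReal_nonneg]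
      exact hn.trans (le_abs_self _)
  refine ae_eventually_notMem ?_
  have h2 : ∀ n, P (E n) = ENNReal.ofReal (P.real (E n)) := fun n =>
    (ofReal_measureReal (measure_ne_top _ _)).symm
  simp_rw [h2]
  exact h1.tsum_ofReal_ne_top

-- Induction on the finite index set: the intersection of the earlier events is measurable for the
-- σ-algebra of the union of their blocks, which is disjoint from the new block.
omit [IsProbabilityMeasure P] in
lemma iIndepSet_of_disjoint {m : ℕ → MeasurableSpace Ω}
    (hle : ∀ k, m k ≤ (inferInstance : MeasurableSpace Ω)) (hm : iIndep m P) {S : ℕ → Set ℕ}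
    (hS : ∀ i j, i ≠ j → Disjoint (S i) (S j)) {E : ℕ → Set Ω}
    (hE : ∀ n, MeasurableSet[⨆ k ∈ S n, m k] (E n)) : iIndepSet E P := by
  have hP : IsProbabilityMeasure P := hm.isProbabilityMeasure
  have hsup : ∀ T : Set ℕ, (⨆ k ∈ T, m k) ≤ (inferInstance : MeasurableSpace Ω) := fun T =>
    iSup₂_le fun k _ => hle k
  rw [iIndepSet_iff_meas_biInter fun n => hsup _ _ (hE n)]
  intro s
  induction s using Finset.induction_on with
  | empty => simp
  | insert i s hi ih =>
    rw [Finset.set_biInter_insert, Finset.prod_insert hi, ← ih]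
    have hd : Disjoint (S i) (⋃ j ∈ s, S j) := by
      rw [Set.disjoint_iUnion₂_right]
      exact fun j hj => hS i j fun h => hi (h ▸ hj)
    have h1 : MeasurableSet[⨆ k ∈ ⋃ j ∈ s, S j, m k] (⋂ j ∈ s, E j) := by
      refine MeasurableSet.biInter s.countable_toSet fun j hj => ?_
      have : (⨆ k ∈ S j, m k) ≤ ⨆ k ∈ ⋃ j ∈ s, S j, m k :=
        biSup_mono fun k hk => Set.mem_biUnion hj hk
      exact this _ (hE j)
    exact (Indep_iff _ _ _).1 (indep_iSup_of_disjoint hle hm hd) _ _ (hE i) h1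

end BorelCantelli

/-! ### The upper half: tail bounds, refinement of the times, and passage to all times. -/

section Families

variable {Ω : Type*} [MeasurableSpace Ω] {P : Measure Ω} [IsProbabilityMeasure P]
  {A : ℕ → ℝ → Set Ω} {ψ : ℝ → ℝ}

/-- Asymptotic monotonicity. -/
def AlmostMonotone (a : ℝ → ℝ) : Prop :=
  ∀ ε : ℝ, 0 < ε → ∀ᶠ s in atTop, ∀ t, s ≤ t → a s ≤ (1 + ε) * a t

lemma almostMonotone_of_tendsto {a a₀ : ℝ → ℝ} (ha : Tendsto a atTop atTop)
    (h0 : MonotoneOn a₀ (Set.Ici 0)) (h : Tendsto (fun t => a t / a₀ t) atTop (𝓝 1)) :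
    AlmostMonotone a := fun ε hε => by
  -- The last condition is equivalent to δ ≤ ε/(2+ε).
  obtain ⟨δ, hδ, hδ1, hδε⟩ : ∃ δ : ℝ, 0 < δ ∧ δ < 1 ∧ (1 + δ) ≤ (1 + ε) * (1 - δ) := by
    refine ⟨min (1 / 2) (ε / (2 + ε)), by positivity,
      (min_le_left _ _).trans_lt (by norm_num), ?_⟩
    have h1 := min_le_right (1 / 2) (ε / (2 + ε))
    rw [le_div_iff₀ (by positivity)] at h1
    linarith
  obtain ⟨T, hT⟩ := eventually_atTop.1 (((h.eventually_lt_const (show (1 : ℝ) < 1 + δ by linarith)).and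
    (h.eventually_const_lt (show 1 - δ < (1 : ℝ) by linarith))).and
      ((ha.eventually_gt_atTop 0).and (eventually_ge_atTop 0)))
  filter_upwards [eventually_ge_atTop T] with s hs t hst
  obtain ⟨⟨e1, e2⟩, e3, e4⟩ := hT s hs
  obtain ⟨⟨f1, f2⟩, f3, f4⟩ := hT t (hs.trans hst)
  have pos : ∀ r, 0 < a r → 1 - δ < a r / a₀ r → 0 < a₀ r := fun r h1 h2 => by
    by_contra hr
    have : a r / a₀ r ≤ 0 := div_nonpos_of_nonneg_of_nonpos h1.le (not_lt.1 hr)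
    linarith
  have ps := pos s e3 e2
  have pt := pos t f3 f2
  rw [div_lt_iff₀ ps] at e1
  rw [lt_div_iff₀ pt] at f2
  have hm := h0 e4 f4 hst
  calc a s ≤ (1 + δ) * a₀ s := e1.le
    _ ≤ (1 + ε) * (1 - δ) * a₀ t := by gcongr
    _ ≤ (1 + ε) * a t := by nlinarith

lemma norming_almostMonotone {a : ℝ → ℝ} (hψ : RateFunction ψ) (ha : Tendsto a atTop atTop)
    (hmono : AlmostMonotone a) : AlmostMonotone fun t => norming ψ (a t) := fun ε hε => by
  obtain ⟨X, hX⟩ := hψ.exists_norming_le hε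
  obtain ⟨T, hT⟩ := eventually_atTop.1 (ha.eventually_ge_atTop X)
  filter_upwards [hmono ε hε, eventually_ge_atTop T] with s h1 hs t hst
  exact hX _ _ (hT t (hs.trans hst)) (hT s hs) (h1 t hst)

/-- Almost surely, `X - E X` is eventually at most `c` times its norming along the times `g`. -/
def BoundedAlong (P : Measure Ω) (A : ℕ → ℝ → Set Ω) (ψ : ℝ → ℝ) (g : ℕ → ℝ) (c : ℝ) : Prop :=
  ∀ᵐ ω ∂P, ∀ᶠ n in atTop, deviation P A (g n) ω ≤ c * norming ψ (var P A (g n))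

namespace IndicatorProcess

lemma deviation_tail_le (hA : IndicatorProcess P A) (hψ : RateFunction ψ)
    (ha : Tendsto (var P A) atTop atTop) {c d : ℝ} (hc : 0 < c) (hd : d < c ^ 2) :
    ∀ᶠ t in atTop, P.real {ω | c * norming ψ (var P A t) ≤ deviation P A t ω} ≤
      Real.exp (-(d * ψ (var P A t))) := by
  obtain ⟨η, hη, hη1, hηd⟩ : ∃ η : ℝ, 0 < η ∧ η ≤ 1 ∧ d ≤ (1 - η) * c ^ 2 := by
    refine ⟨min 1 ((c ^ 2 - d) / c ^ 2), lt_min one_pos (div_pos (by linarith) (by positivity)),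
      min_le_left _ _, ?_⟩
    have h1 := min_le_right 1 ((c ^ 2 - d) / c ^ 2)
    rw [le_div_iff₀ (by positivity)] at h1
    linarith
  filter_upwards [ha.eventually (hψ.norming_le_mul (div_pos hη hc)), ha.eventually hψ.norming_sq,
    ha.eventually_gt_atTop 0, eventually_ge_atTop 0,
    ha.eventually (hψ.tendsto.eventually_ge_atTop 0)] with t h1 h2 h3 ht h4
  rw [hA.deviation_eq ht]
  have hv := hA.var_eq ht
  have hE := (hA.events ht).upper_tail_le_sharp (x := c * norming ψ (var P A t)) (η := η)
    (by rwa [← hv]) (mul_nonneg hc.le (Real.sqrt_nonneg _)) hη1 (by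
      rw [← hv]
      have := mul_le_mul_of_nonneg_left h1 hc.le
      rwa [← mul_assoc, mul_div_cancel₀ _ hc.ne'] at this)
  refine hE.trans (Real.exp_le_exp.2 ?_)
  rw [← hv, mul_pow, h2]
  have : (1 - η) * (c ^ 2 * (2 * var P A t * ψ (var P A t)) / (2 * var P A t)) =
      (1 - η) * c ^ 2 * ψ (var P A t) := by
    field_simp
  rw [this]
  have := mul_le_mul_of_nonneg_right hηd h4
  linarith

lemma boundedAlong_of_summable (hA : IndicatorProcess P A) (hψ : RateFunction ψ)
    (ha : Tendsto (var P A) atTop atTop) {g : ℕ → ℝ} (hg : Tendsto g atTop atTop) {c d : ℝ}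
    (hc : 0 < c) (hd : d < c ^ 2)
    (hsum : Summable fun n => Real.exp (-(d * ψ (var P A (g n))))) : BoundedAlong P A ψ g c := by
  filter_upwards [ae_eventually_notMem_of_summable hsum
    (hg.eventually (hA.deviation_tail_le hψ ha hc hd))] with ω hω
  filter_upwards [hω] with n hn
  exact (not_le.1 hn).le

/-- The increment is again a centred sum of independent indicators, with variance at most Δ. For x ≤
Δ the bound is Gaussian; for larger x the variance is replaced by x itself, which gives the
exponential term. -/
lemma increment_tail_le (hA : IndicatorProcess P A) {s u x Δ : ℝ} (hs : 0 < s) (hsu : s ≤ u)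
    (hx : 0 < x) (hΔ : mean P A u - mean P A s ≤ Δ) (hΔ0 : 0 < Δ) :
    P.real {ω | x ≤ deviation P A u ω - deviation P A s ω} ≤
      Real.exp (-(x ^ 2 / (4 * Δ))) + Real.exp (-(x / 4)) := by
  have hE := hA.increment_events hs.le (hs.le.trans hsu)
  have hV : varHits P (increment A s u) ≤ Δ :=
    hE.varHits_le_meanHits.trans ((hA.meanHits_increment hs hsu).trans_le hΔ)
  have h1 : P.real {ω | x ≤ deviation P A u ω - deviation P A s ω} =
      P.real {ω | x ≤ centered P (increment A s u) ω} := by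
    refine measureReal_congr ?_
    filter_upwards [hA.ae_deviation_sub_eq hs hsu] with ω hω
    refine propext ?_
    change x ≤ _ ↔ x ≤ _
    rw [hω]
  rw [h1]
  rcases le_total x Δ with h | h
  · exact (hE.upper_tail_le hΔ0 hV hx.le h).trans (le_add_of_nonneg_right (Real.exp_pos _).le)
  · refine (hE.upper_tail_le hx (hV.trans h) hx.le le_rfl).trans ?_
    rw [show x ^ 2 / (4 * x) = x / 4 by field_simp]
    exact le_add_of_nonneg_left (Real.exp_pos _).le

/-- The time h m is compared with an earlier time g (ν m) where the bound is known. An increment of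
δ times the norming has summable probability: the squared norming dominates a, which yields the two
series in `hs1` and `hs2`. Almost monotonicity then replaces the norming at the earlier time by that
at h m. -/
lemma boundedAlong_refine (hA : IndicatorProcess P A) (hψ : RateFunction ψ)
    (ha : Tendsto (var P A) atTop atTop) (hmono : AlmostMonotone (var P A))
    {g h : ℕ → ℝ} {ν : ℕ → ℕ} {Δ : ℕ → ℝ} {c c' : ℝ} (hc : 0 < c) (hcc : c < c')
    (hb : BoundedAlong P A ψ g c) (hg : Tendsto g atTop atTop) (hν : Tendsto ν atTop atTop)
    (hle : ∀ᶠ m in atTop, g (ν m) ≤ h m)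
    (hΔ : ∀ᶠ m in atTop, mean P A (h m) - mean P A (g (ν m)) ≤ Δ m) (hΔ0 : ∀ m, 0 < Δ m)
    (hs1 : ∀ ε : ℝ, 0 < ε → Summable fun m => Real.exp (-(ε * (var P A (g (ν m)) / Δ m))))
    (hs2 : ∀ ε : ℝ, 0 < ε → Summable fun m => Real.exp (-(ε * √(var P A (g (ν m)))))) :
    BoundedAlong P A ψ h c' := by
  obtain ⟨δ, hδ, hδc⟩ : ∃ δ : ℝ, 0 < δ ∧ (c + δ) * (1 + δ) ≤ c' := by
    have h1 : Tendsto (fun δ : ℝ => (c + δ) * (1 + δ)) (𝓝[>] 0) (𝓝 ((c + 0) * (1 + 0))) :=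
      ((tendsto_id.const_add c).mul (tendsto_id.const_add 1)).mono_left nhdsWithin_le_nhds
    obtain ⟨δ, h2, h3⟩ := ((h1.eventually_lt_const (by simpa using hcc)).and
      self_mem_nhdsWithin).exists
    exact ⟨δ, h3, h2.le⟩
  have hgν := hg.comp hν
  have hsum := (hs1 (δ ^ 2 / 4) (by positivity)).add (hs2 (δ / 4) (by positivity))
  have hbc := ae_eventually_notMem_of_summable (P := P) hsum
    (E := fun m => {ω | δ * norming ψ (var P A (g (ν m))) ≤
      deviation P A (h m) ω - deviation P A (g (ν m)) ω}) (by
    filter_upwards [hle, hΔ, hgν.eventually_gt_atTop 0,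
      (ha.comp hgν).eventually hψ.le_norming_sq, (ha.comp hgν).eventually hψ.sqrt_le_norming,
      (ha.comp hgν).eventually (hψ.tendsto_norming.eventually_gt_atTop 0)]
      with m h1 h2 h3 h4 h5 h6
    simp only [Function.comp_apply] at h3 h4 h5 h6
    refine (hA.increment_tail_le h3 h1 (mul_pos hδ h6) h2 (hΔ0 m)).trans (add_le_add ?_ ?_)
    · refine Real.exp_le_exp.2 (neg_le_neg ?_)
      rw [mul_pow, div_mul_div_comm]
      have := hΔ0 m
      gcongr
    · refine Real.exp_le_exp.2 (neg_le_neg ?_)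
      rw [div_mul_eq_mul_div]
      gcongr)
  filter_upwards [hb, hbc] with ω h1 h2
  filter_upwards [hν.eventually h1, h2, hle,
    hgν.eventually (norming_almostMonotone hψ ha hmono δ hδ)] with m e1 e2 e3 e4
  have e5 := e4 _ e3
  have e6 := not_le.1 e2
  simp only [Function.comp_apply] at e5
  have e7 : 0 ≤ norming ψ (var P A (h m)) := Real.sqrt_nonneg _
  calc deviation P A (h m) ω ≤ (c + δ) * norming ψ (var P A (g (ν m))) := by linarith
    _ ≤ (c + δ) * ((1 + δ) * norming ψ (var P A (h m))) := by gcongr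
    _ = (c + δ) * (1 + δ) * norming ψ (var P A (h m)) := by ring
    _ ≤ c' * norming ψ (var P A (h m)) := by gcongr

/-- Every t is followed by the passage time u of the next integer above b(t). Since X(t) ≤ X(u) and
b(u) - b(t) ≤ 1 + C, the deviation at t exceeds that at u by at most a constant; a, and with it the
norming, is almost the same at both times. -/
lemma bounded_of_boundedAlong_nat (hA : IndicatorProcess P A) (hψ : RateFunction ψ)
    (ha : Tendsto (var P A) atTop atTop) (hb : Tendsto (mean P A) atTop atTop)
    (hjump : HasBoundedJumps (mean P A)) {c c' : ℝ} (hc : 0 < c) (hcc : c < c')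
    (h : BoundedAlong P A ψ (fun l : ℕ => levelTime (mean P A) l) c) :
    ∀ᵐ ω ∂P, ∀ᶠ t in atTop, deviation P A t ω ≤ c' * norming ψ (var P A t) := by
  obtain ⟨C, hC0, hC⟩ := hjump
  obtain ⟨ε, hε, hεc⟩ : ∃ ε : ℝ, 0 < ε ∧ c * (1 + ε) + ε ≤ c' :=
    ⟨(c' - c) / (c + 1), by have := sub_pos.2 hcc; positivity, by field_simp; linarith⟩
  obtain ⟨X, hX⟩ := hψ.exists_norming_le hε
  have hl : Tendsto (fun t => ⌊mean P A t⌋₊ + 1) atTop atTop :=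
    (tendsto_add_atTop_nat 1).comp (tendsto_nat_floor_atTop.comp hb)
  have hT := tendsto_levelTime hb (bddAbove_of_mono fun s t hs hst => hA.mean_mono hs hst)
  have hl' := tendsto_natCast_atTop_atTop (R := ℝ) |>.comp hl
  filter_upwards [h, hA.ae_count_mono] with ω hω hmono
  filter_upwards [hl.eventually hω, hl'.eventually hC, eventually_gt_atTop 0,
    hb.eventually_ge_atTop 0, ha.eventually_ge_atTop X, ha.eventually_ge_atTop ((1 + C) / ε),
    (ha.comp (hT.comp hl')).eventually_ge_atTop X,
    ha.eventually (hψ.tendsto_norming.eventually_ge_atTop ((1 + C) / ε))]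
    with t h1 h2 ht hb0 h3 h4 h5 h6
  simp only [Function.comp_apply] at h2 h5
  set l := ⌊mean P A t⌋₊ + 1 with hldef
  set u := levelTime (mean P A) l with hu
  have hlt : mean P A t < l := by
    rw [hldef]
    push_cast
    exact Nat.lt_floor_add_one _
  have hlt' : (l : ℝ) ≤ mean P A t + 1 := by
    rw [hldef]
    push_cast
    linarith [Nat.floor_le hb0]
  have htu : t ≤ u := le_levelTime hb fun s hs hst => (hA.mean_mono hs hst.le).trans hlt.le
  have hbu : mean P A u - mean P A t ≤ 1 + C := by linarith [(abs_le.1 h2).2]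
  rw [div_le_iff₀ hε] at h4 h6
  have hau : var P A u ≤ (1 + ε) * var P A t := by
    linarith [(abs_le.1 (hA.abs_var_sub_le ht htu)).2]
  have hn := hX _ _ h3 h5 hau
  have hcount := hmono t u ht htu
  have hdev : deviation P A t ω ≤ deviation P A u ω + (1 + C) := by
    unfold deviation
    linarith
  calc deviation P A t ω ≤ c * norming ψ (var P A u) + (1 + C) := by linarith
    _ ≤ c * ((1 + ε) * norming ψ (var P A t)) + norming ψ (var P A t) * ε := by gcongr
    _ = (c * (1 + ε) + ε) * norming ψ (var P A t) := by ring
    _ ≤ c' * norming ψ (var P A t) := by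
      have : 0 ≤ norming ψ (var P A t) := Real.sqrt_nonneg _
      gcongr

end IndicatorProcess

end Families

/-! ### Comparison of two sequences of levels. -/

section Levels

lemma summable_exp_neg_of_le {f g : ℕ → ℝ} (hf : Summable fun n => Real.exp (-f n))
    (h : ∀ᶠ n in atTop, f n ≤ g n) : Summable fun n => Real.exp (-g n) :=
  summable_of_isBigO_nat hf <| IsBigO.of_bound 1 <| by
    filter_upwards [h] with n hn
    rw [one_mul, Real.norm_eq_abs, Real.norm_eq_abs, Real.abs_exp, Real.abs_exp]
    exact Real.exp_le_exp.2 (neg_le_neg hn)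

lemma exists_index {V V' : ℕ → ℝ} (hV : Tendsto V atTop atTop) (hmono : Monotone V)
    (hV' : Tendsto V' atTop atTop) :
    ∃ ν : ℕ → ℕ, Tendsto ν atTop atTop ∧
      ∀ᶠ m in atTop, V (ν m) ≤ V' m ∧ V' m < V (ν m + 1) := by
  have h : ∀ m, ∃ n, V 0 ≤ V' m → V n ≤ V' m ∧ V' m < V (n + 1) := fun m => by
    by_cases h0 : V 0 ≤ V' m
    · obtain ⟨j, hj⟩ := (hV.eventually_gt_atTop (V' m)).exists
      obtain ⟨n, -, h1, h2⟩ := exists_mem_and_succ_notMem (p := fun n => V n ≤ V' m) h0 j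
        (not_le.2 hj)
      exact ⟨n, fun _ => ⟨h1, not_le.1 h2⟩⟩
    -- An arbitrary value for the finitely many m whose level lies below V 0.
    · exact ⟨0, fun h => absurd h h0⟩
  choose ν hν using h
  have hν' : ∀ᶠ m in atTop, V (ν m) ≤ V' m ∧ V' m < V (ν m + 1) := by
    filter_upwards [hV'.eventually_ge_atTop (V 0)] with m hm using hν m hm
  refine ⟨ν, tendsto_atTop.2 fun K => ?_, hν'⟩
  filter_upwards [hν', hV'.eventually_ge_atTop (V K)] with m h1 h2
  by_contra hK
  exact (h1.2.trans_le (hmono (by omega : ν m + 1 ≤ K))).not_ge h2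

end Levels

/-! ### Change of levels, and the lower half along disjoint blocks. -/

section Families

variable {Ω : Type*} [MeasurableSpace Ω] {P : Measure Ω} [IsProbabilityMeasure P]
  {A : ℕ → ℝ → Set Ω} {ψ : ℝ → ℝ}

namespace IndicatorProcess

/-- Passing from the passage times of the levels `V` to those of the finer levels `V'`. -/
lemma boundedAlong_finer_levels (hA : IndicatorProcess P A) (hψ : RateFunction ψ)
    (ha : Tendsto (var P A) atTop atTop) (hmono : AlmostMonotone (var P A))
    (hb : Tendsto (mean P A) atTop atTop) (hjump : HasBoundedJumps (mean P A))
    {V V' : ℕ → ℝ} (hV : Tendsto V atTop atTop) (hVm : Monotone V)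
    (hV' : Tendsto V' atTop atTop) {κ δ : ℝ} (hδ : 0 < δ)
    (h1 : ∀ᶠ n : ℕ in atTop, δ * (n : ℝ) ^ κ * (V (n + 1) - V n + 1) ≤
      var P A (levelTime (mean P A) (V n)))
    (h2 : ∀ᶠ n : ℕ in atTop, δ * (n : ℝ) ^ κ ≤ √(var P A (levelTime (mean P A) (V n))))
    (h3 : ∀ ν : ℕ → ℕ, Tendsto ν atTop atTop → (∀ᶠ m in atTop, V' m < V (ν m + 1)) →
      ∀ ε : ℝ, 0 < ε → Summable fun m => Real.exp (-(ε * (ν m : ℝ) ^ κ)))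
    {c c' : ℝ} (hc : 0 < c) (hcc : c < c')
    (hbd : BoundedAlong P A ψ (fun n => levelTime (mean P A) (V n)) c) :
    BoundedAlong P A ψ (fun n => levelTime (mean P A) (V' n)) c' := by
  obtain ⟨C, hC0, hC⟩ := hjump
  have hT := tendsto_levelTime hb (bddAbove_of_mono fun s t hs hst => hA.mean_mono hs hst)
  obtain ⟨ν, hν, hνV⟩ := exists_index hV hVm hV'
  have hD : ∀ n, 0 ≤ V (n + 1) - V n := fun n => sub_nonneg.2 (hVm n.le_succ)
  have hsum := h3 ν hν (hνV.mono fun m h => h.2)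
  refine hA.boundedAlong_refine hψ ha hmono (ν := ν)
    (Δ := fun m => (1 + 2 * C) * (V (ν m + 1) - V (ν m) + 1)) hc hcc hbd (hT.comp hV) hν ?_ ?_
    (fun m => ?_) (fun ε hε => ?_) (fun ε hε => ?_)
  · filter_upwards [hνV] with m hm using levelTime_mono hb hm.1
  · filter_upwards [hνV, hV'.eventually hC, (hV.comp hν).eventually hC] with m h4 h5 h6
    simp only [Function.comp_apply] at h6
    have := (abs_le.1 h5).2
    have := (abs_le.1 h6).1
    nlinarith [hD (ν m), h4.2]
  · have := hD (ν m)
    positivity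
  · refine summable_exp_neg_of_le (hsum (ε * δ / (1 + 2 * C)) (by positivity)) ?_
    filter_upwards [hν.eventually h1] with m hm
    have h4 := hD (ν m)
    rw [mul_div_assoc, mul_assoc]
    refine mul_le_mul_of_nonneg_left ?_ hε.le
    rw [le_div_iff₀ (by positivity)]
    refine le_trans (le_of_eq ?_) hm
    field_simp
  · refine summable_exp_neg_of_le (hsum (ε * δ) (by positivity)) ?_
    filter_upwards [hν.eventually h2] with m hm
    rw [mul_assoc]
    exact mul_le_mul_of_nonneg_left hm hε.le

-- Measurability is needed with respect to the σ-algebra of the block, because independence of the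
-- blocks is what the second Borel-Cantelli lemma uses. `measurable_hits` is therefore applied with
-- this smaller σ-algebra as the ambient one.
omit [IsProbabilityMeasure P] in
lemma measurableSet_le_centered_block {t : ℝ} (ht : 0 ≤ t) (R : Set ℕ) (x : ℝ) :
    MeasurableSet[⨆ k ∈ R, eventAlgebra A k] {ω | x ≤ centered P (block A R t) ω} := by
  have hB : ∀ k, MeasurableSet[⨆ k ∈ R, eventAlgebra A k] (block A R t k) := fun k => by
    by_cases hk : k ∈ R
    · exact le_iSup₂ (f := fun k (_ : k ∈ R) => eventAlgebra A k) k hk _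
        (measurableSet_block ht R k)
    · simp [block, hk]
  have h := @measurable_hits Ω (⨆ k ∈ R, eventAlgebra A k) _ hB
  have h2 : {ω | x ≤ centered P (block A R t) ω} =
      hits (block A R t) ⁻¹' Set.Ici (x + meanHits P (block A R t)) := by
    ext ω
    simp [centered, le_sub_iff_add_le]
  rw [h2]
  exact h measurableSet_Ici

/-- The lower half of the law of the iterated logarithm along a sequence of times at which
asymptotically independent blocks carry almost all of the variance. -/
lemma frequently_ge_of_blocks (hA : IndicatorProcess P A) (hψ : RateFunction ψ)
    (ha : Tendsto (var P A) atTop atTop) {τ : ℕ → ℝ} (hτ : Tendsto τ atTop atTop)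
    {c γ K ς : ℝ} (hc : 0 < c) (hc1 : c < 1) (hγ : 0 < γ) (hγc : (1 + γ) * ((1 + c) / 2) ≤ 1)
    (hψτ : ∀ᶠ n : ℕ in atTop, |ψ (var P A (τ n)) - (1 + γ) * Real.log n| ≤ K)
    {R : ℝ → Set ℕ} (hdisj : EventuallyDisjoint R τ) (hς : ς < (1 - c) ^ 2 / 16)
    (hvar : Tendsto (fun t => variance (countOn A (R t) t) P / var P A t) atTop (𝓝 (1 - ς))) :
    ∀ᵐ ω ∂P, ∃ᶠ t in atTop, c * norming ψ (var P A t) ≤ deviation P A t ω := by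
  -- With c₁ = 1 - δ one has c = c₁ - δ: the block has to reach c₁ times the norming and the
  -- remaining indices may lose δ times it. The bound on ς says exactly that they carry eventually
  -- less than the proportion δ²/4 of the variance.
  set δ := (1 - c) / 2 with hδdef
  have hδ : 0 < δ := by rw [hδdef]; linarith
  have hδ1 : δ < 1 / 2 := by rw [hδdef]; linarith
  set c₁ := (1 + c) / 2 with hc₁def
  have hc₁ : 0 < c₁ := by rw [hc₁def]; linarith
  obtain ⟨K', hK', hlow⟩ := IndepEvents.le_upper_tail (P := P) hδ
  have hratio : ∀ᶠ t in atTop, 0 ≤ t ∧ 0 < var P A t ∧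
      (1 - δ ^ 2 / 4) * var P A t ≤ varHits P (block A (R t) t) := by
    filter_upwards [hvar.eventually_const_lt (show 1 - δ ^ 2 / 4 < 1 - ς by rw [hδdef]; linarith),
      ha.eventually_gt_atTop 0, eventually_ge_atTop 0] with t h1 h2 h3
    rw [hA.variance_countOn h3, lt_div_iff₀ h2] at h1
    exact ⟨h3, h2, h1.le⟩
  set E : ℕ → Set Ω := fun n =>
    {ω | c₁ * norming ψ (var P A (τ n)) ≤ centered P (block A (R (τ n)) (τ n)) ω} with hE
  set F : ℕ → Set Ω := fun n =>
    {ω | centered P (block A (R (τ n))ᶜ (τ n)) ω ≤ -(δ * norming ψ (var P A (τ n)))} with hF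
  have hlog : ∀ᶠ n : ℕ in atTop, 0 < (n : ℝ) ∧ 0 ≤ Real.log n := by
    filter_upwards [eventually_ge_atTop 1] with n hn
    have : (1 : ℝ) ≤ n := by exact_mod_cast hn
    exact ⟨by linarith, Real.log_nonneg this⟩
  have hPF : ∀ᶠ n : ℕ in atTop, P.real (F n) ≤ Real.exp (2 * K) * ((n : ℝ) ^ 2)⁻¹ := by
    filter_upwards [hτ.eventually hratio, hψτ, hlog,
      (ha.comp hτ).eventually (hψ.norming_le_mul (show 0 < δ / 4 by positivity)),
      (ha.comp hτ).eventually hψ.norming_sq]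
      with n ⟨h1, h2, h3⟩ h4 ⟨h5, h6⟩ h7 h8
    simp only [Function.comp_apply] at h7 h8
    have hadd := hA.varHits_block_add h1 (R (τ n))
    refine ((hA.block_events h1 (R (τ n))ᶜ).lower_tail_le (W := δ ^ 2 / 4 * var P A (τ n))
      (x := δ * norming ψ (var P A (τ n))) (by positivity) (by linarith)
      (mul_nonneg hδ.le (Real.sqrt_nonneg _)) (by nlinarith)).trans ?_
    rw [mul_pow, h8]
    -- The proportion δ²/4 is chosen so that the exponent becomes 2ψ, which is at least 2 log n -
    -- 2K.
    have e1 : δ ^ 2 * (2 * var P A (τ n) * ψ (var P A (τ n))) /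
        (4 * (δ ^ 2 / 4 * var P A (τ n))) = 2 * ψ (var P A (τ n)) := by
      field_simp
    have e2 : ((n : ℝ) ^ 2)⁻¹ = Real.exp (-(2 * Real.log n)) := by
      rw [Real.exp_neg, ← Real.exp_log (pow_pos h5 2), Real.log_pow]
      norm_num
    rw [e1, e2, ← Real.exp_add]
    refine Real.exp_le_exp.2 ?_
    nlinarith [(abs_le.1 h4).1]
  have hPE : ∀ᶠ n : ℕ in atTop, Real.exp (-(c₁ * K)) * (n : ℝ)⁻¹ ≤ P.real (E n) := by
    filter_upwards [hτ.eventually hratio, hψτ, hlog,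
      (ha.comp hτ).eventually (hψ.norming_le_mul (show 0 < 1 / (2 * (K' * c₁)) by positivity)),
      (ha.comp hτ).eventually hψ.norming_sq,
      (ha.comp hτ).eventually (hψ.tendsto_norming.eventually_gt_atTop 0),
      (ha.comp hτ).eventually (hψ.tendsto.eventually_ge_atTop (K' / (2 * c₁ ^ 2))),
      (ha.comp hτ).eventually (hψ.tendsto.eventually_ge_atTop 0)]
      with n ⟨h1, h2, h3⟩ h4 ⟨h5, h6⟩ h7 h8 h9 h10 h11
    simp only [Function.comp_apply] at h7 h8 h9 h10 h11
    have hadd := hA.varHits_block_add h1 (R (τ n))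
    have hnn := varHits_nonneg (P := P) (B := block A (R (τ n))ᶜ (τ n))
    set V := varHits P (block A (R (τ n)) (τ n)) with hV
    set α := var P A (τ n) with hα
    have hVα : α / 2 ≤ V := by
      have : δ ^ 2 ≤ 1 := by nlinarith
      nlinarith
    have hV0 : 0 < V := by linarith
    rw [div_le_iff₀ (by positivity)] at h10
    refine le_trans ?_ (hlow _ (hA.block_events h1 (R (τ n))) (c₁ * norming ψ α)
      (by positivity) ?_ ?_)
    · rw [← hV, mul_pow, h8]
      have e2 : (n : ℝ)⁻¹ = Real.exp (-Real.log n) := by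
        rw [Real.exp_neg, Real.exp_log h5]
      rw [e2, ← Real.exp_add]
      refine Real.exp_le_exp.2 ?_
      -- Here (1+δ)c₁ = 1 - δ² ≤ 1 - δ²/4 pays for both the loss in the converse inequality and the
      -- missing variance. One factor c₁ survives, and (1+γ)c₁ ≤ 1 makes the probability at least a
      -- multiple of 1/n.
      have e3 : (1 + δ) * (c₁ ^ 2 * (2 * α * ψ α) / (2 * V)) ≤ c₁ * ψ α := by
        have e4 : (1 + δ) * c₁ * α ≤ V := by
          refine le_trans (mul_le_mul_of_nonneg_right ?_ h2.le) h3
          rw [hδdef, hc₁def]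
          nlinarith
        have e5 : (1 + δ) * (c₁ ^ 2 * (2 * α * ψ α) / (2 * V)) =
            (1 + δ) * c₁ * α * (c₁ * ψ α) / V := by
          field_simp
        rw [e5, div_le_iff₀ hV0, mul_comm (c₁ * ψ α)]
        gcongr
      have e6 := mul_le_mul_of_nonneg_left (abs_le.1 h4).2 hc₁.le
      have e7 := mul_le_mul_of_nonneg_right hγc h6
      linarith
    · have e1 := mul_le_mul_of_nonneg_left h7 (show 0 ≤ K' * c₁ by positivity)
      have e2 : K' * c₁ * (1 / (2 * (K' * c₁)) * α) = α / 2 := by field_simp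
      rw [e2] at e1
      linarith
    · rw [mul_pow, h8, ← hV]
      calc K' * V ≤ K' * α := by gcongr; linarith
        _ ≤ ψ α * (2 * c₁ ^ 2) * α := by gcongr
        _ = c₁ ^ 2 * (2 * α * ψ α) := by ring
  obtain ⟨n₀, hn₀⟩ := hdisj
  obtain ⟨n₁, hn₁⟩ := eventually_atTop.1 ((hτ.eventually hratio).and hPE)
  set n₂ := max n₀ n₁ with hn₂
  have hindep : iIndepSet (fun n => E (n + n₂)) P := by
    refine iIndepSet_of_disjoint hA.eventAlgebra_le hA.indep (S := fun n => R (τ (n + n₂)))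
      (fun i j hij => hn₀ _ _ (by omega) (by omega) (by omega)) fun n => ?_
    exact measurableSet_le_centered_block (hn₁ (n + n₂) (by omega)).1.1 _ _
  have hEm : ∀ n, MeasurableSet (E (n + n₂)) := fun n =>
    measurableSet_le measurable_const (measurable_centered
      (hA.block_events (hn₁ (n + n₂) (by omega)).1.1 _).measurableSet)
  have hdiv : ∑' n, P (E (n + n₂)) = ∞ := by
    by_contra hfin
    have h1 := ENNReal.summable_toReal hfin
    have h2 : Summable fun n : ℕ => Real.exp (-(c₁ * K)) * ((n + n₂ : ℕ) : ℝ)⁻¹ :=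
      h1.of_nonneg_of_le (fun n => by positivity) fun n => (hn₁ (n + n₂) (by omega)).2
    have h3 := (summable_nat_add_iff (f := fun n : ℕ => Real.exp (-(c₁ * K)) * (n : ℝ)⁻¹) n₂).1 h2
    rw [summable_mul_left_iff (Real.exp_pos _).ne'] at h3
    exact Real.not_summable_natCast_inv h3
  have hlim := measure_limsup_eq_one hEm hindep hdiv
  have hEfreq : ∀ᵐ ω ∂P, ∃ᶠ n in atTop, ω ∈ E (n + n₂) := by
    have h1 : MeasurableSet (limsup (fun n => E (n + n₂)) atTop) :=
      MeasurableSet.measurableSet_limsup hEm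
    filter_upwards [(mem_ae_iff_prob_eq_one h1).2 hlim] with ω hω
    exact mem_limsup_iff_frequently_mem.1 hω
  have hFev := ae_eventually_notMem_of_summable
    ((Real.summable_nat_pow_inv.2 one_lt_two).mul_left (Real.exp (2 * K))) hPF
  have hadd : ∀ᵐ ω ∂P, ∀ n, 0 < τ n → deviation P A (τ n) ω =
      centered P (block A (R (τ n)) (τ n)) ω + centered P (block A (R (τ n))ᶜ (τ n)) ω := by
    refine ae_all_iff.2 fun n => ?_
    by_cases h : 0 < τ n
    · filter_upwards [hA.ae_deviation_eq_add h (R (τ n))] with ω hω _ using hω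
    · exact .of_forall fun ω h' => absurd h' h
  filter_upwards [hEfreq, hFev, hadd] with ω h1 h2 h3
  have hshift := tendsto_add_atTop_nat n₂
  refine (hτ.comp hshift).frequently ((h1.and_eventually ((hshift.eventually h2).and
    ((hτ.comp hshift).eventually_gt_atTop 0))).mono ?_)
  rintro n ⟨e1, e2, e3⟩
  have e4 := h3 _ e3
  have e5 : -(δ * norming ψ (var P A (τ (n + n₂)))) <
      centered P (block A (R (τ (n + n₂)))ᶜ (τ (n + n₂))) ω := not_le.1 e2
  have e6 : c₁ * norming ψ (var P A (τ (n + n₂))) ≤ _ := e1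
  have e7 : c = c₁ - δ := by rw [hc₁def, hδdef]; ring
  simp only [Function.comp_apply]
  rw [e4, e7]
  linarith

end IndicatorProcess

end Families

/-! ### Logarithmic and doubly logarithmic rates -/

section Rates

lemma log_slow {ε : ℝ} (hε : 0 < ε) :
    ∀ᶠ x in atTop, Real.log ((1 + ε) * x) ≤ (1 + ε) * Real.log x := by
  filter_upwards [Real.tendsto_log_atTop.eventually_ge_atTop 1, eventually_gt_atTop 0] with x h1 h2
  rw [Real.log_mul (by positivity) h2.ne']
  have := Real.log_le_sub_one_of_pos (show 0 < 1 + ε by positivity)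
  nlinarith

lemma tendsto_log_div_self : Tendsto (fun x => Real.log x / x) atTop (𝓝 0) :=
  Real.isLittleO_log_id_atTop.tendsto_div_nhds_zero

lemma rateFunction_log {σ : ℝ} (hσ : 0 < σ) : RateFunction fun x => σ * Real.log x where
  tendsto := Real.tendsto_log_atTop.const_mul_atTop hσ
  mono := ⟨1, fun x hx y _ hxy => mul_le_mul_of_nonneg_left
    (Real.log_le_log (zero_lt_one.trans_le hx) hxy) hσ.le⟩
  sublinear := by
    simpa [mul_div_assoc] using tendsto_log_div_self.const_mul σ
  slow ε hε := by
    filter_upwards [log_slow hε] with x hx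
    nlinarith

lemma rateFunction_log_log {σ : ℝ} (hσ : 0 < σ) :
    RateFunction fun x => σ * Real.log (Real.log x) where
  tendsto := (Real.tendsto_log_atTop.comp Real.tendsto_log_atTop).const_mul_atTop hσ
  mono := ⟨Real.exp 1, fun x hx y _ hxy => by
    have hx0 : 0 < x := (Real.exp_pos 1).trans_le hx
    have h1 : 1 ≤ Real.log x := (Real.le_log_iff_exp_le hx0).2 hx
    exact mul_le_mul_of_nonneg_left (Real.log_le_log (by linarith) (Real.log_le_log hx0 hxy)) hσ.le⟩
  sublinear := by
    have h1 : Tendsto (fun x => σ * (Real.log x / x)) atTop (𝓝 0) := by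
      simpa using tendsto_log_div_self.const_mul σ
    refine tendsto_of_tendsto_of_tendsto_of_le_of_le' tendsto_const_nhds h1 ?_ ?_
    · filter_upwards [Real.tendsto_log_atTop.eventually_ge_atTop 1, eventually_gt_atTop 0]
        with x hx hx0
      have := Real.log_nonneg hx
      positivity
    · filter_upwards [Real.tendsto_log_atTop.eventually_ge_atTop 1, eventually_gt_atTop 0]
        with x hx hx0
      rw [mul_div_assoc]
      have := Real.log_le_sub_one_of_pos (zero_lt_one.trans_le hx)
      exact mul_le_mul_of_nonneg_left
        (div_le_div_of_nonneg_right (by linarith) hx0.le) hσ.le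
  slow ε hε := by
    filter_upwards [log_slow hε, Real.tendsto_log_atTop.eventually (log_slow hε),
      Real.tendsto_log_atTop.eventually_ge_atTop 1, eventually_gt_atTop 0] with x h1 h2 h3 h4
    have h5 : 0 < Real.log ((1 + ε) * x) := by
      refine Real.log_pos ?_
      have : 1 < x := by
        by_contra h
        linarith [Real.log_nonpos h4.le (not_lt.1 h)]
      nlinarith
    have := (Real.log_le_log h5 h1).trans h2
    nlinarith

end Rates

/-! ### The size of the variance at passage times -/

section VarTimes

variable {a : ℝ → ℝ}

lemma EventuallyContinuous.eventually_levelTime_eq (hc : EventuallyContinuous a)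
    (ha : Tendsto a atTop atTop) (hbdd : ∀ K : ℝ, ∃ M : ℝ, ∀ t, 0 < t → t ≤ K → a t ≤ M) :
    ∀ᶠ v in atTop, a (levelTime a v) = v := by
  obtain ⟨T, hT⟩ := hc
  have hτ := tendsto_levelTime ha hbdd
  filter_upwards [hτ.eventually_gt_atTop T, hτ.eventually_gt_atTop 0] with v h1 h2
  have hcont : ContinuousAt a (levelTime a v) := hT.continuousAt (Ioi_mem_nhds h1)
  refine le_antisymm ?_ ?_
  · refine le_of_tendsto (hcont.tendsto.mono_left nhdsWithin_le_nhds :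
      Tendsto a (𝓝[<] (levelTime a v)) _) ?_
    filter_upwards [Ioo_mem_nhdsLT h2] with t ht using le_of_lt_levelTime ht.1 ht.2
  · by_contra hlt
    obtain ⟨ε, hε, hball⟩ := Metric.eventually_nhds_iff.1 (hcont.eventually_lt_const (not_le.1 hlt))
    obtain ⟨s, -, h3, h4, h5⟩ := exists_lt_of_levelTime_lt ha (lt_add_of_pos_right _ hε)
    refine (hball ?_).not_gt h5
    rw [Real.dist_eq, abs_of_nonneg (sub_nonneg.2 h3)]
    linarith

/-- If a is continuous near its passage time τ, then a(τ) = v. Otherwise a changes by a factor below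
2 over unit time: a(τ) < 2a(τ-1) ≤ 2v, while some s in [τ, τ+1) has v < a(s) < 2a(s-1) ≤ 4a(τ), the
last step by almost monotonicity. -/
lemma log_levelTime (ha : Tendsto a atTop atTop)
    (hbdd : ∀ K : ℝ, ∃ M : ℝ, ∀ t, 0 < t → t ≤ K → a t ≤ M) (hmono : AlmostMonotone a)
    (h : EventuallyContinuous a ∨ Tendsto (fun t => a (t - 1) / a t) atTop (𝓝 1)) :
    ∀ᶠ v in atTop, |Real.log (a (levelTime a v)) - Real.log v| ≤ Real.log 4 := by
  rcases h with h | h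
  · filter_upwards [h.eventually_levelTime_eq ha hbdd] with v hv
    rw [hv, sub_self, abs_zero]
    exact Real.log_nonneg (by norm_num)
  · have hτ := tendsto_levelTime ha hbdd
    obtain ⟨T, hT⟩ := eventually_atTop.1 (((h.eventually_const_lt (show (1 / 2 : ℝ) < 1 by norm_num)).and
      (ha.eventually_gt_atTop 0)).and (hmono 1 one_pos))
    filter_upwards [hτ.eventually_gt_atTop (T + 1), hτ.eventually_gt_atTop 1,
      eventually_gt_atTop 0] with v h1 h2 hv
    set τ := levelTime a v
    obtain ⟨s, -, h3, h4, h5⟩ := exists_lt_of_levelTime_lt ha (lt_add_one τ)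
    obtain ⟨⟨e1, e2⟩, -⟩ := hT τ (by linarith)
    obtain ⟨⟨f1, f2⟩, -⟩ := hT s (by linarith)
    have g3 := (hT (s - 1) (by linarith)).2 τ (by linarith)
    have g4 := le_of_lt_levelTime (f := a) (v := v) (show 0 < τ - 1 by linarith)
      (show τ - 1 < τ by linarith)
    rw [lt_div_iff₀ e2] at e1
    rw [lt_div_iff₀ f2] at f1
    rw [← Real.log_div e2.ne' hv.ne', abs_le, ← Real.log_inv]
    constructor
    · exact Real.log_le_log (by norm_num) (by rw [le_div_iff₀ hv]; linarith)
    · exact Real.log_le_log (by positivity) (by rw [div_le_iff₀ hv]; linarith)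

/-- The argument of `log_levelTime`, carried out for log a. Almost monotonicity now costs an
additive log 2, absorbed once log a ≥ 2 log 2. -/
lemma log_log_levelTime (ha : Tendsto a atTop atTop)
    (hbdd : ∀ K : ℝ, ∃ M : ℝ, ∀ t, 0 < t → t ≤ K → a t ≤ M) (hmono : AlmostMonotone a)
    (h : EventuallyContinuous a ∨
      Tendsto (fun t => Real.log (a (t - 1)) / Real.log (a t)) atTop (𝓝 1)) :
    ∀ᶠ v in atTop,
      |Real.log (Real.log (a (levelTime a v))) - Real.log (Real.log v)| ≤ Real.log 4 := by
  rcases h with h | h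
  · filter_upwards [h.eventually_levelTime_eq ha hbdd] with v hv
    rw [hv, sub_self, abs_zero]
    exact Real.log_nonneg (by norm_num)
  · have hτ := tendsto_levelTime ha hbdd
    have hla := Real.tendsto_log_atTop.comp ha
    obtain ⟨T, hT⟩ := eventually_atTop.1 (((h.eventually_const_lt (show (1 / 2 : ℝ) < 1 by norm_num)).and
      ((ha.eventually_gt_atTop 0).and (hla.eventually_ge_atTop (2 * Real.log 2)))).and
      (hmono 1 one_pos))
    have hl2 : 0 < Real.log 2 := Real.log_pos (by norm_num)
    filter_upwards [hτ.eventually_gt_atTop (T + 1), hτ.eventually_gt_atTop 1,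
      eventually_gt_atTop 1] with v h1 h2 hv
    set τ := levelTime a v
    have hlv : 0 < Real.log v := Real.log_pos hv
    obtain ⟨s, -, h3, h4, h5⟩ := exists_lt_of_levelTime_lt ha (lt_add_one τ)
    obtain ⟨⟨e1, e2, e3⟩, -⟩ := hT τ (by linarith)
    obtain ⟨⟨f1, f2, f3⟩, -⟩ := hT s (by linarith)
    obtain ⟨⟨-, g1, g2⟩, g3⟩ := hT (s - 1) (by linarith)
    have g4 := le_of_lt_levelTime (f := a) (v := v) (show 0 < τ - 1 by linarith)
      (show τ - 1 < τ by linarith)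
    have g5 := (hT (τ - 1) (by linarith)).1.2.1
    simp only [Function.comp_apply] at e3 f3 g2
    have e0 : 0 < Real.log (a τ) := by linarith
    have f0 : 0 < Real.log (a s) := by linarith
    rw [lt_div_iff₀ e0] at e1
    rw [lt_div_iff₀ f0] at f1
    have k1 : Real.log (a (τ - 1)) ≤ Real.log v := Real.log_le_log g5 g4
    have k2 : Real.log v ≤ Real.log (a s) := Real.log_le_log (by linarith) h5.le
    have k3 : Real.log (a (s - 1)) ≤ Real.log 2 + Real.log (a τ) := by
      rw [← Real.log_mul (by norm_num) e2.ne']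
      refine Real.log_le_log g1 ?_
      have := g3 τ (by linarith)
      norm_num at this
      exact this
    rw [← Real.log_div e0.ne' hlv.ne', abs_le, ← Real.log_inv]
    constructor
    · exact Real.log_le_log (by norm_num) (by rw [le_div_iff₀ hlv]; linarith)
    · exact Real.log_le_log (by positivity) (by rw [div_le_iff₀ hlv]; linarith)

lemma varLevel_of_eq (q γ : ℝ) (n : ℕ) :
    varLevel 1 q γ n = Real.exp ((n : ℝ) ^ ((1 + γ) / (q + 1))) := by
  simp [varLevel]

lemma varLevel_of_lt {μ : ℝ} (hμ : 1 < μ) (q γ : ℝ) (n : ℕ) :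
    varLevel μ q γ n = (n : ℝ) ^ ((1 + γ) / (μ - 1)) := by
  simp [varLevel, hμ.ne']

lemma tendsto_varLevel_one {q γ : ℝ} (hq : 0 ≤ q) (hγ : 0 < γ) :
    Tendsto (varLevel 1 q γ) atTop atTop := by
  have h1 : 0 < (1 + γ) / (q + 1) := by positivity
  refine Tendsto.congr (fun n => (varLevel_of_eq q γ n).symm) ?_
  exact Real.tendsto_exp_atTop.comp ((tendsto_rpow_atTop h1).comp tendsto_natCast_atTop_atTop)

lemma tendsto_varLevel {μ : ℝ} (hμ : 1 < μ) (q : ℝ) {γ : ℝ} (hγ : 0 < γ) :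
    Tendsto (varLevel μ q γ) atTop atTop := by
  have h1 : 0 < (1 + γ) / (μ - 1) := div_pos (by linarith) (by linarith)
  refine Tendsto.congr (fun n => (varLevel_of_lt hμ q γ n).symm) ?_
  exact (tendsto_rpow_atTop h1).comp tendsto_natCast_atTop_atTop

lemma rate_varTime_one {q γ : ℝ} (hq : 0 ≤ q) (hγ : 0 < γ)
    (h : ∀ᶠ v in atTop,
      |Real.log (Real.log (a (levelTime a v))) - Real.log (Real.log v)| ≤ Real.log 4) :
    ∀ᶠ n : ℕ in atTop,
      |(q + 1) * Real.log (Real.log (a (varTime a 1 q γ n))) - (1 + γ) * Real.log n| ≤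
        (q + 1) * Real.log 4 := by
  filter_upwards [(tendsto_varLevel_one hq hγ).eventually h, eventually_gt_atTop 0] with n h1 hn
  have hn' : 0 < (n : ℝ) := by exact_mod_cast hn
  have h2 : (1 + γ) * Real.log n = (q + 1) * Real.log (Real.log (varLevel 1 q γ n)) := by
    rw [varLevel_of_eq, Real.log_exp, Real.log_rpow hn']
    field_simp
  rw [h2, ← mul_sub, abs_mul, abs_of_nonneg (by positivity : 0 ≤ q + 1)]
  exact mul_le_mul_of_nonneg_left h1 (by positivity)

lemma rate_varTime {μ q γ : ℝ} (hμ : 1 < μ) (hγ : 0 < γ)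
    (h : ∀ᶠ v in atTop, |Real.log (a (levelTime a v)) - Real.log v| ≤ Real.log 4) :
    ∀ᶠ n : ℕ in atTop,
      |(μ - 1) * Real.log (a (varTime a μ q γ n)) - (1 + γ) * Real.log n| ≤
        (μ - 1) * Real.log 4 := by
  have hμ' : 0 < μ - 1 := by linarith
  filter_upwards [(tendsto_varLevel hμ q hγ).eventually h, eventually_gt_atTop 0] with n h1 hn
  have hn' : 0 < (n : ℝ) := by exact_mod_cast hn
  have h2 : (1 + γ) * Real.log n = (μ - 1) * Real.log (varLevel μ q γ n) := by
    rw [varLevel_of_lt hμ, Real.log_rpow hn']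
    field_simp
  rw [h2, ← mul_sub, abs_mul, abs_of_nonneg hμ'.le]
  exact mul_le_mul_of_nonneg_left h1 hμ'.le

end VarTimes

/-! ### Lower bounds for the variance at passage times of the mean. -/

section MeanTimes

variable {a b : ℝ → ℝ}

lemma levelTime_le_two_mul (hjump : HasBoundedJumps b) :
    ∀ᶠ x in atTop, x / 2 ≤ b (levelTime b x) ∧ b (levelTime b x) ≤ 2 * x := by
  obtain ⟨C, hC0, hC⟩ := hjump
  filter_upwards [hC, eventually_ge_atTop (2 * C)] with x h1 h2
  have := abs_le.1 h1
  constructor <;> linarith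

/-- If `b / a` has logarithmic order `q`, then `a` is at least `b (log b)^{-q-η}`. -/
lemma HasLogOrder.le_at_levelTime {q : ℝ} {L : ℝ → ℝ} (h : HasLogOrder a b q L)
    (ha : Tendsto a atTop atTop) (hab : ∀ᶠ t in atTop, a t ≤ b t)
    (hT : Tendsto (levelTime b) atTop atTop) (hjump : HasBoundedJumps b) {η : ℝ} (hη : 0 < η) :
    ∀ᶠ x in atTop, x ≤ a (levelTime b x) * Real.log x ^ (q + η) := by
  obtain ⟨K, hK, hO⟩ := h.isBigO.exists_pos
  have hq := h.nonneg
  have hlT := (Real.tendsto_log_atTop.comp (ha.comp hT))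
  have hpow : Tendsto (fun x => Real.log x ^ (η / 2)) atTop atTop :=
    (tendsto_rpow_atTop (half_pos hη)).comp Real.tendsto_log_atTop
  filter_upwards [hT.eventually hO.bound, hT.eventually hab, levelTime_le_two_mul hjump,
    hlT.eventually (h.slowlyVarying.eventually_le_rpow (half_pos hη)),
    hlT.eventually h.slowlyVarying.eventually_pos, hlT.eventually_gt_atTop 0,
    (ha.comp hT).eventually_gt_atTop 0, log_slow one_pos,
    hpow.eventually_ge_atTop (2 * K * 2 ^ (q + η / 2)), eventually_gt_atTop 0,
    Real.tendsto_log_atTop.eventually_gt_atTop 0]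
    with x h1 h2 ⟨h3, h3'⟩ h4 h5 h6 h7 h8 h9 h10 h11
  simp only [Function.comp_apply] at h1 h4 h5 h6 h7
  set α := a (levelTime b x)
  set β := b (levelTime b x)
  norm_num at h8
  -- Since α ≤ β ≤ 2x, log α may be replaced by a multiple of log x. Half of η absorbs the slowly
  -- varying factor, the other half the constants.
  have e1 : Real.log α ≤ 2 * Real.log x :=
    (Real.log_le_log h7 (h2.trans h3')).trans h8
  have e2 : logScale L q α ≤ (2 * Real.log x) ^ (q + η / 2) := by
    rw [logScale]
    calc Real.log α ^ q * L (Real.log α) ≤ Real.log α ^ q * Real.log α ^ (η / 2) := by gcongr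
      _ = Real.log α ^ (q + η / 2) := (Real.rpow_add h6 _ _).symm
      _ ≤ _ := Real.rpow_le_rpow h6.le e1 (by positivity)
  have e3 : 0 ≤ logScale L q α := mul_nonneg (Real.rpow_nonneg h6.le _) h5.le
  rw [Real.norm_eq_abs, Real.norm_eq_abs, abs_of_nonneg e3] at h1
  have e4 := (le_abs_self _).trans h1
  rw [div_le_iff₀ h7] at e4
  calc x ≤ 2 * β := by linarith
    _ ≤ 2 * (K * logScale L q α * α) := by gcongr
    _ ≤ 2 * (K * (2 * Real.log x) ^ (q + η / 2) * α) := by gcongr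
    _ = α * (2 * K * 2 ^ (q + η / 2) * Real.log x ^ (q + η / 2)) := by
      rw [Real.mul_rpow (by norm_num) h11.le]
      ring
    _ ≤ α * (Real.log x ^ (η / 2) * Real.log x ^ (q + η / 2)) := by gcongr
    _ = α * Real.log x ^ (q + η) := by
      rw [← Real.rpow_add h11]
      ring_nf

/-- For exponents `m` above the growth exponent, `a` is at least `b^{1/m}`. -/
lemma le_at_levelTime_of_growthExponent_lt (hne : (growthExponents a b).Nonempty)
    (ha : Tendsto a atTop atTop)
    (hT : Tendsto (levelTime b) atTop atTop) (hjump : HasBoundedJumps b) {m : ℝ}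
    (hm : growthExponent a b < m) :
    ∀ᶠ x in atTop, x ^ (1 / m) ≤ a (levelTime b x) := by
  obtain ⟨m₀, ⟨hm₀1, hm₀⟩, hlt⟩ := exists_lt_of_csInf_lt hne hm
  obtain ⟨K, hK, hO⟩ := hm₀.exists_pos
  have hpow := (tendsto_rpow_atTop (sub_pos.2 hlt)).comp (ha.comp hT)
  filter_upwards [hT.eventually hO.bound, levelTime_le_two_mul hjump,
    (ha.comp hT).eventually_gt_atTop 0, hpow.eventually_ge_atTop (2 * K), eventually_gt_atTop 0]
    with x h1 h2 h3 h4 h5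
  simp only [Function.comp_apply] at h1 h3 h4
  set α := a (levelTime b x)
  rw [Real.norm_eq_abs, Real.norm_eq_abs, abs_of_nonneg (Real.rpow_nonneg h3.le m₀)] at h1
  have e1 := (le_abs_self _).trans h1
  have e2 : x ≤ α ^ m := by
    calc x ≤ 2 * b (levelTime b x) := by linarith
      _ ≤ 2 * (K * α ^ m₀) := by gcongr
      _ = 2 * K * α ^ m₀ := by ring
      _ ≤ α ^ (m - m₀) * α ^ m₀ := by gcongr
      _ = α ^ m := by
        rw [← Real.rpow_add h3]
        ring_nf
  have hm0 : 0 < m := by linarith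
  calc x ^ (1 / m) ≤ (α ^ m) ^ (1 / m) := Real.rpow_le_rpow h5.le e2 (by positivity)
    _ = α := by rw [← Real.rpow_mul h3.le, mul_one_div_cancel hm0.ne', Real.rpow_one]

end MeanTimes

/-! ### Levels -/

section LevelSequences

lemma summable_exp_neg_mul_log {p K : ℝ} (hp : 1 < p) :
    Summable fun n : ℕ => Real.exp (-(p * Real.log n - K)) := by
  refine summable_of_isBigO_nat (Real.summable_nat_rpow_inv.2 hp) (IsBigO.of_bound (Real.exp K) ?_)
  filter_upwards [eventually_gt_atTop 0] with n hn
  have hn' : 0 < (n : ℝ) := by exact_mod_cast hn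
  have h : ((n : ℝ) ^ p)⁻¹ = Real.exp (-(p * Real.log n)) := by
    rw [Real.exp_neg, Real.rpow_def_of_pos hn', mul_comm]
  rw [h, Real.norm_eq_abs, Real.norm_eq_abs, Real.abs_exp, Real.abs_exp, ← Real.exp_add]
  exact Real.exp_le_exp.2 (by linarith)

lemma tendsto_log_natCast : Tendsto (fun n : ℕ => Real.log n) atTop atTop :=
  Real.tendsto_log_atTop.comp tendsto_natCast_atTop_atTop

lemma summable_exp_neg_mul_rpow {ε p : ℝ} (hε : 0 < ε) (hp : 0 < p) :
    Summable fun n : ℕ => Real.exp (-(ε * (n : ℝ) ^ p)) := by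
  refine summable_exp_neg_of_le (summable_exp_neg_mul_log (K := 0) one_lt_two) ?_
  have h := (isLittleO_log_rpow_atTop hp).bound (show 0 < ε / 2 by positivity)
  filter_upwards [tendsto_natCast_atTop_atTop.eventually h] with n hn
  rw [Real.norm_eq_abs, Real.norm_eq_abs, abs_of_nonneg (Real.rpow_nonneg n.cast_nonneg p)] at hn
  have := (le_abs_self _).trans hn
  linarith

lemma summable_exp_neg_mul_log_sq {ε : ℝ} (hε : 0 < ε) :
    Summable fun n : ℕ => Real.exp (-(ε * Real.log n ^ (2 : ℝ))) := by
  refine summable_exp_neg_of_le (summable_exp_neg_mul_log (K := 0) one_lt_two) ?_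
  filter_upwards [tendsto_log_natCast.eventually_ge_atTop (2 / ε)] with n hn
  rw [div_le_iff₀ hε] at hn
  have h0 : 0 ≤ Real.log n := Real.log_natCast_nonneg n
  rw [Real.rpow_two, sub_zero]
  nlinarith

/-- Inverts the level map: as ν m + 1 ≤ 2 ν m, the index of the coarse level just below f m is at
least half of f m to the power 1/s. -/
lemma eventually_le_rpow_of_lt_succ {ν : ℕ → ℕ} (hν : Tendsto ν atTop atTop) {f : ℕ → ℝ} {s κ : ℝ}
    (hs : 0 < s) (hκ : 0 < κ) (hf : ∀ᶠ m in atTop, 0 ≤ f m)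
    (h : ∀ᶠ m in atTop, f m < ((ν m + 1 : ℕ) : ℝ) ^ s) :
    ∀ᶠ m in atTop, (1 / 2) ^ κ * f m ^ (κ / s) ≤ (ν m : ℝ) ^ κ := by
  filter_upwards [h, hf, hν.eventually_ge_atTop 1] with m h1 h2 h3
  have h4 : (1 : ℝ) ≤ ν m := by exact_mod_cast h3
  have h5 : f m ≤ (2 * (ν m : ℝ)) ^ s := by
    refine h1.le.trans (Real.rpow_le_rpow (by positivity) ?_ hs.le)
    push_cast
    linarith
  have h6 := Real.rpow_le_rpow h2 h5 (show 0 ≤ κ / s by positivity)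
  rw [← Real.rpow_mul (by positivity), mul_div_cancel₀ _ hs.ne',
    Real.mul_rpow (by norm_num) (by positivity)] at h6
  calc (1 / 2 : ℝ) ^ κ * f m ^ (κ / s) ≤ (1 / 2) ^ κ * (2 ^ κ * (ν m : ℝ) ^ κ) := by gcongr
    _ = (ν m : ℝ) ^ κ := by
      rw [← mul_assoc, ← Real.mul_rpow (by norm_num) (by norm_num)]
      norm_num

/-- The levels `exp(n^s)`. -/
noncomputable def expLevel (s : ℝ) (n : ℕ) : ℝ := Real.exp ((n : ℝ) ^ s)

lemma tendsto_expLevel {s : ℝ} (hs : 0 < s) : Tendsto (expLevel s) atTop atTop :=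
  Real.tendsto_exp_atTop.comp ((tendsto_rpow_atTop hs).comp tendsto_natCast_atTop_atTop)

lemma monotone_expLevel {s : ℝ} (hs : 0 < s) : Monotone (expLevel s) := fun m n hmn =>
  Real.exp_le_exp.2 (Real.rpow_le_rpow m.cast_nonneg (by exact_mod_cast hmn) hs.le)

/-- Concavity gives (n+1)^s ≤ n^s + n^(s-1), and exp y ≤ 1 + 2y on [0,1]. -/
lemma expLevel_succ_sub_le {s : ℝ} (hs : 0 < s) (hs1 : s < 1) {n : ℕ} (hn : 1 ≤ n) :
    expLevel s (n + 1) - expLevel s n ≤ 2 * (n : ℝ) ^ (s - 1) * expLevel s n := by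
  have hn' : (1 : ℝ) ≤ n := by exact_mod_cast hn
  have hn0 : (0 : ℝ) < n := by linarith
  have h1 : ((n + 1 : ℕ) : ℝ) ^ s ≤ (n : ℝ) ^ s + (n : ℝ) ^ (s - 1) := by
    have e1 : ((n + 1 : ℕ) : ℝ) = n * (1 + 1 / n) := by
      push_cast
      field_simp
    have e2 := rpow_one_add_le_one_add_mul_self (s := 1 / (n : ℝ))
      (by have : 0 ≤ 1 / (n : ℝ) := by positivity
          linarith) hs.le hs1.le
    rw [e1, Real.mul_rpow hn0.le (by positivity)]
    calc (n : ℝ) ^ s * (1 + 1 / n) ^ s ≤ (n : ℝ) ^ s * (1 + s * (1 / n)) := by gcongr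
      _ ≤ (n : ℝ) ^ s * (1 + 1 * (1 / n)) := by gcongr
      _ = _ := by
        rw [Real.rpow_sub_one hn0.ne']
        ring
  have h2 : (n : ℝ) ^ (s - 1) ≤ 1 := Real.rpow_le_one_of_one_le_of_nonpos hn' (by linarith)
  have h3 : 0 ≤ (n : ℝ) ^ (s - 1) := by positivity
  have h4 := exp_le_cubic (x := (n : ℝ) ^ (s - 1)) (y := 1) le_rfl (by rwa [abs_of_nonneg h3])
  have h5 : expLevel s (n + 1) ≤ expLevel s n * Real.exp ((n : ℝ) ^ (s - 1)) := by
    rw [expLevel, expLevel, ← Real.exp_add]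
    exact Real.exp_le_exp.2 h1
  have h6 : Real.exp ((n : ℝ) ^ (s - 1)) ≤ 1 + 2 * (n : ℝ) ^ (s - 1) := by nlinarith
  have h7 : 0 < expLevel s n := Real.exp_pos _
  nlinarith

lemma eventually_rpow_le_expLevel_rpow {s : ℝ} (hs : 0 < s) (p : ℝ) {β : ℝ} (hβ : 0 < β) :
    ∀ᶠ n : ℕ in atTop, (n : ℝ) ^ p ≤ expLevel s n ^ β := by
  have h := (isLittleO_rpow_exp_pos_mul_atTop (p / s) hβ).bound one_pos
  filter_upwards [((tendsto_rpow_atTop hs).comp tendsto_natCast_atTop_atTop).eventually h] with n hn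
  simp only [Function.comp_apply] at hn
  rw [one_mul, Real.norm_eq_abs, Real.norm_eq_abs, Real.abs_exp,
    ← Real.rpow_mul n.cast_nonneg, mul_div_cancel₀ _ hs.ne'] at hn
  rw [expLevel, ← Real.exp_mul, mul_comm]
  exact (le_abs_self _).trans hn

/-- Bernoulli's inequality applied to (1 - 1/(n+1))^r. -/
lemma powerLevel_succ_sub_le {r : ℝ} (hr : 1 < r) {n : ℕ} (hn : 1 ≤ n) :
    ((n + 1 : ℕ) : ℝ) ^ r - (n : ℝ) ^ r ≤ r * 2 ^ (r - 1) * (n : ℝ) ^ (r - 1) := by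
  have hn' : (1 : ℝ) ≤ n := by exact_mod_cast hn
  set N : ℝ := ((n + 1 : ℕ) : ℝ) with hN
  have hNn : N = n + 1 := by rw [hN]; push_cast; ring
  have hN0 : 0 < N := by linarith
  have h1 := one_add_mul_self_le_rpow_one_add (s := -(1 / N))
    (by rw [neg_le_neg_iff, div_le_one hN0]; linarith) hr.le
  have e1 : (n : ℝ) = N * (1 + -(1 / N)) := by
    field_simp
    linarith
  have h2 : N ^ r * (1 + r * -(1 / N)) ≤ (n : ℝ) ^ r := by
    have h0 : (0 : ℝ) ≤ 1 + -(1 / N) := by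
      have : 1 / N ≤ 1 := by rw [div_le_one hN0]; linarith
      linarith
    rw [e1, Real.mul_rpow hN0.le h0]
    gcongr
  have h3 : N ^ r * (1 + r * -(1 / N)) = N ^ r - r * N ^ (r - 1) := by
    rw [Real.rpow_sub_one hN0.ne']
    ring
  have h4 : N ^ (r - 1) ≤ 2 ^ (r - 1) * (n : ℝ) ^ (r - 1) := by
    rw [← Real.mul_rpow (by norm_num) (by positivity)]
    exact Real.rpow_le_rpow hN0.le (by linarith) (by linarith)
  have h5 := mul_le_mul_of_nonneg_left h4 (show 0 ≤ r by linarith)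
  linarith

end LevelSequences

/-! ### The upper half for the two concrete families of levels. -/

section Families

variable {Ω : Type*} [MeasurableSpace Ω] {P : Measure Ω} [IsProbabilityMeasure P]
  {A : ℕ → ℝ → Set Ω}

lemma eventually_rpow_half_le {f : ℝ → ℝ} {q : ℝ}
    (h : ∀ᶠ x in atTop, x ≤ f x * Real.log x ^ q) : ∀ᶠ x in atTop, x ^ (1 / 2 : ℝ) ≤ f x := by
  have h1 := (isLittleO_log_rpow_rpow_atTop q (show (0 : ℝ) < 1 / 2 by norm_num)).bound one_pos
  filter_upwards [h, h1, eventually_gt_atTop 0, Real.tendsto_log_atTop.eventually_gt_atTop 0]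
    with x h2 h3 h4 h5
  have h6 : 0 < Real.log x ^ q := Real.rpow_pos_of_pos h5 q
  have h7 : 0 < x ^ (1 / 2 : ℝ) := Real.rpow_pos_of_pos h4 _
  rw [one_mul, Real.norm_eq_abs, Real.norm_eq_abs, abs_of_pos h6, abs_of_pos h7] at h3
  have h8 : x = x ^ (1 / 2 : ℝ) * x ^ (1 / 2 : ℝ) := by
    rw [← Real.rpow_add h4]
    norm_num
  have h9 : 0 ≤ f x := by
    by_contra hf
    nlinarith
  refine le_of_mul_le_mul_right ?_ h7
  rw [← h8]
  exact h2.trans (mul_le_mul_of_nonneg_left h3 h9)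

/-- The growth of `a` along the levels `exp(n^s)` compared to the gaps between these levels. -/
lemma gap_expLevel_le {f : ℝ → ℝ} {q η s κ : ℝ} (hs : 0 < s) (hs1 : s < 1)
    (hκ : κ = 1 - s * (1 + q + η)) (h : ∀ᶠ x in atTop, x ≤ f x * Real.log x ^ (q + η)) :
    (∀ᶠ n : ℕ in atTop, 1 / 3 * (n : ℝ) ^ κ * (expLevel s (n + 1) - expLevel s n + 1) ≤
      f (expLevel s n)) ∧ ∀ᶠ n : ℕ in atTop, 1 / 3 * (n : ℝ) ^ κ ≤ √(f (expLevel s n)) := by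
  have hV := tendsto_expLevel hs
  constructor
  · filter_upwards [hV.eventually h, eventually_ge_atTop 1,
      eventually_rpow_le_expLevel_rpow hs (1 - s) one_pos] with n h1 hn h2
    have hn' : (0 : ℝ) < n := by exact_mod_cast hn
    have h3 := expLevel_succ_sub_le hs hs1 hn
    have hlog : Real.log (expLevel s n) = (n : ℝ) ^ s := Real.log_exp _
    rw [hlog, ← Real.rpow_mul hn'.le] at h1
    rw [Real.rpow_one] at h2
    have h4 : 1 ≤ (n : ℝ) ^ (s - 1) * expLevel s n := by
      have := mul_le_mul_of_nonneg_left h2 (show 0 ≤ (n : ℝ) ^ (s - 1) by positivity)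
      rwa [← Real.rpow_add hn', sub_add_sub_cancel', sub_self, Real.rpow_zero] at this
    -- The gap has order n^(s-1)V, whereas the variance is at least V n^(-s(q+η)); κ is the
    -- difference of the exponents.
    have h5 : (n : ℝ) ^ κ * (n : ℝ) ^ (s - 1) = (n : ℝ) ^ (-(s * (q + η))) := by
      rw [← Real.rpow_add hn', hκ]
      ring_nf
    have h6 : (n : ℝ) ^ (-(s * (q + η))) * (n : ℝ) ^ (s * (q + η)) = 1 := by
      rw [← Real.rpow_add hn', neg_add_cancel, Real.rpow_zero]
    calc 1 / 3 * (n : ℝ) ^ κ * (expLevel s (n + 1) - expLevel s n + 1)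
        ≤ 1 / 3 * (n : ℝ) ^ κ * (3 * ((n : ℝ) ^ (s - 1) * expLevel s n)) := by
          gcongr
          linarith
      _ = (n : ℝ) ^ κ * (n : ℝ) ^ (s - 1) * expLevel s n := by ring
      _ = (n : ℝ) ^ (-(s * (q + η))) * expLevel s n := by rw [h5]
      _ ≤ (n : ℝ) ^ (-(s * (q + η))) * (f (expLevel s n) * (n : ℝ) ^ (s * (q + η))) := by gcongr
      _ = f (expLevel s n) * ((n : ℝ) ^ (-(s * (q + η))) * (n : ℝ) ^ (s * (q + η))) := by ring
      _ = f (expLevel s n) := by rw [h6, mul_one]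
  · filter_upwards [hV.eventually (eventually_rpow_half_le h), eventually_ge_atTop 1,
      eventually_rpow_le_expLevel_rpow hs (2 * κ) (β := 1 / 2) (by norm_num)] with n h1 hn h2
    have hn' : (0 : ℝ) < n := by exact_mod_cast hn
    refine le_trans (?_ : _ ≤ (n : ℝ) ^ κ) (Real.le_sqrt_of_sq_le ?_)
    · have : 0 ≤ (n : ℝ) ^ κ := by positivity
      linarith
    · rw [← Real.rpow_mul_natCast hn'.le, Nat.cast_ofNat, mul_comm κ]
      exact h2.trans h1

namespace IndicatorProcess

/-- Two refinements are needed. For s near 1/(q+1) the variance beats the gap only by the small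
power n^(sρ/2). At the integer l the coarse index is about (log l)^(1/s), so a direct passage would
yield only exp(-ε(log l)^(ρ/2)), which need not be summable. The intermediate exponent s' = 1/(q+4)
is reached with a stretched exponential bound in m, and its own margin 2s' then gives exp(-ε(log
l)²). -/
lemma upper_of_logOrder (hA : IndicatorProcess P A)
    (ha : Tendsto (var P A) atTop atTop) (hmono : AlmostMonotone (var P A))
    (hb : Tendsto (mean P A) atTop atTop) (hjump : HasBoundedJumps (mean P A)) {q : ℝ}
    (hq : 0 ≤ q)
    (hlow : ∀ η : ℝ, 0 < η → ∀ᶠ x in atTop,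
      x ≤ var P A (levelTime (mean P A) x) * Real.log x ^ (q + η)) {c : ℝ} (hc : 1 < c) :
    ∀ᵐ ω ∂P, ∀ᶠ t in atTop, deviation P A t ω ≤
      c * norming (fun x => (q + 1) * Real.log (Real.log x)) (var P A t) := by
  have hψ := rateFunction_log_log (show 0 < q + 1 by linarith)
  have hT := tendsto_levelTime hb (bddAbove_of_mono fun s t hs hst => hA.mean_mono hs hst)
  obtain ⟨e, he, hce⟩ : ∃ e : ℝ, 0 < e ∧ c = 1 + 4 * e := ⟨(c - 1) / 4, by linarith, by ring⟩
  -- This makes (1+e)(q+1)s = (1+e)/(1+e/2) > 1, the exponent of summability.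
  set ρ := e / 2 * (q + 1) with hρdef
  have hρ : 0 < ρ := by positivity
  set s := 1 / (q + 1 + ρ) with hsdef
  have hs : 0 < s := by positivity
  have hs1 : s < 1 := by
    rw [hsdef, div_lt_one (by positivity)]
    linarith
  set s' := 1 / (q + 4) with hs'def
  have hs' : 0 < s' := by positivity
  have hs1' : s' < 1 := by
    rw [hs'def, div_lt_one (by positivity)]
    linarith
  have start : BoundedAlong P A (fun x => (q + 1) * Real.log (Real.log x))
      (fun n => levelTime (mean P A) (expLevel s n)) (1 + e) := by
    refine hA.boundedAlong_of_summable hψ ha (hT.comp (tendsto_expLevel hs)) (d := 1 + e)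
      (by positivity) (by nlinarith) ?_
    have hp : 1 < (1 + e) * (q + 1) * s := by
      rw [hsdef, mul_one_div, lt_div_iff₀ (by positivity), hρdef]
      nlinarith
    refine summable_exp_neg_of_le
      (summable_exp_neg_mul_log (K := (1 + e) * (q + 1) * Real.log 2) hp) ?_
    -- The crude bound a ≥ √V suffices: the iterated logarithm turns the exponent 1/2 into the
    -- additive constant -log 2.
    filter_upwards [(tendsto_expLevel hs).eventually (eventually_rpow_half_le (hlow 1 one_pos)),
      eventually_gt_atTop 0] with n h1 hn
    have hn' : (0 : ℝ) < n := by exact_mod_cast hn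
    have hV : 0 < expLevel s n := Real.exp_pos _
    have h2 := Real.log_le_log (Real.rpow_pos_of_pos hV _) h1
    rw [Real.log_rpow hV, expLevel, Real.log_exp, ← expLevel] at h2
    have h3 := Real.log_le_log (by positivity) h2
    rw [Real.log_mul (by norm_num) (by positivity), Real.log_rpow hn', one_div, Real.log_inv] at h3
    have h4 := mul_le_mul_of_nonneg_left h3 (show 0 ≤ (1 + e) * (q + 1) by positivity)
    simp only [Function.comp_apply]
    linarith
  have mid : BoundedAlong P A (fun x => (q + 1) * Real.log (Real.log x))
      (fun n => levelTime (mean P A) (expLevel s' n)) (1 + 2 * e) := by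
    have hκ : s * (ρ / 2) = 1 - s * (1 + q + ρ / 2) := by
      rw [hsdef]
      field_simp
      ring
    obtain ⟨h1, h2⟩ := gap_expLevel_le hs hs1 hκ (hlow (ρ / 2) (by positivity))
    refine hA.boundedAlong_finer_levels hψ ha hmono hb hjump (tendsto_expLevel hs)
      (monotone_expLevel hs) (tendsto_expLevel hs') (δ := 1 / 3) (by norm_num) h1 h2
      (fun ν hν hlt ε hε => ?_) (by positivity) (by linarith) start
    refine summable_exp_neg_of_le (summable_exp_neg_mul_rpow
      (ε := ε * (1 / 2) ^ (s * (ρ / 2))) (p := s' * (s * (ρ / 2) / s)) (by positivity)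
      (by positivity)) ?_
    filter_upwards [eventually_le_rpow_of_lt_succ hν (f := fun m : ℕ => (m : ℝ) ^ s') hs
      (show 0 < s * (ρ / 2) by positivity) (.of_forall fun m => by positivity)
      (hlt.mono fun m hm => Real.exp_lt_exp.1 hm)] with m hm
    rw [← Real.rpow_mul m.cast_nonneg] at hm
    rw [mul_assoc]
    gcongr
  have fin : BoundedAlong P A (fun x => (q + 1) * Real.log (Real.log x))
      (fun l : ℕ => levelTime (mean P A) l) (1 + 3 * e) := by
    have hκ : 2 * s' = 1 - s' * (1 + q + 1) := by
      rw [hs'def]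
      field_simp
      ring
    obtain ⟨h1, h2⟩ := gap_expLevel_le hs' hs1' hκ (hlow 1 one_pos)
    refine hA.boundedAlong_finer_levels hψ ha hmono hb hjump (tendsto_expLevel hs')
      (monotone_expLevel hs') tendsto_natCast_atTop_atTop (δ := 1 / 3) (by norm_num) h1 h2
      (fun ν hν hlt ε hε => ?_) (by positivity) (by linarith) mid
    refine summable_exp_neg_of_le (summable_exp_neg_mul_log_sq
      (ε := ε * (1 / 2) ^ (2 * s')) (by positivity)) ?_
    filter_upwards [eventually_le_rpow_of_lt_succ hν (f := fun m : ℕ => Real.log m) hs'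
      (show 0 < 2 * s' by positivity) (.of_forall fun m => Real.log_natCast_nonneg m)
      (by
        filter_upwards [hlt, eventually_gt_atTop 0] with m hm hm0
        exact (Real.log_lt_iff_lt_exp (by exact_mod_cast hm0)).2 hm)] with m hm
    rw [mul_div_cancel_right₀ _ hs'.ne'] at hm
    rw [mul_assoc]
    gcongr
  exact hA.bounded_of_boundedAlong_nat hψ ha hb hjump (by positivity) (by linarith) fin

/-- One refinement suffices: the coarse index of the integer l is about l^(1/r), so a margin of any
positive power of the index is summable. -/
lemma upper_of_power (hA : IndicatorProcess P A)
    (ha : Tendsto (var P A) atTop atTop) (hmono : AlmostMonotone (var P A))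
    (hb : Tendsto (mean P A) atTop atTop) (hjump : HasBoundedJumps (mean P A)) {μ : ℝ}
    (hμ : 1 < μ)
    (hlow : ∀ m : ℝ, μ < m → ∀ᶠ x in atTop, x ^ (1 / m) ≤ var P A (levelTime (mean P A) x))
    {c : ℝ} (hc : 1 < c) :
    ∀ᵐ ω ∂P, ∀ᶠ t in atTop, deviation P A t ω ≤
      c * norming (fun x => (μ - 1) * Real.log x) (var P A t) := by
  have hμ0 : 0 < μ - 1 := by linarith
  have hψ := rateFunction_log hμ0
  have hT := tendsto_levelTime hb (bddAbove_of_mono fun s t hs hst => hA.mean_mono hs hst)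
  obtain ⟨e, he, hce⟩ : ∃ e : ℝ, 0 < e ∧ c = 1 + 3 * e := ⟨(c - 1) / 3, by linarith, by ring⟩
  -- With r = m'/(m'-1) the level gaps have order n^(r/m'), while μ < m < m' gives variance at least
  -- n^(r/m). Also (1+e)(μ-1)r/m ≥ (1+e)/(1+e/2) > 1, so the series along the levels converges.
  set m' := 1 + (1 + e / 2) * (μ - 1) with hm'def
  have hm' : μ < m' := by
    rw [hm'def]
    nlinarith
  obtain ⟨m, hm, hmm'⟩ := exists_between hm'
  have hm0 : 0 < m := by linarith
  have hm1' : 0 < m' - 1 := by linarith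
  have hm0' : 0 < m' := by linarith
  set r := m' / (m' - 1) with hrdef
  have hr : 1 < r := by
    rw [hrdef, lt_div_iff₀ hm1']
    linarith
  have hr1 : r - 1 = r / m' := by
    rw [hrdef]
    field_simp
    ring
  have hV : Tendsto (fun n : ℕ => (n : ℝ) ^ r) atTop atTop :=
    (tendsto_rpow_atTop (by linarith)).comp tendsto_natCast_atTop_atTop
  have hlowV : ∀ᶠ n : ℕ in atTop,
      (n : ℝ) ^ (r / m) ≤ var P A (levelTime (mean P A) ((n : ℝ) ^ r)) := by
    filter_upwards [hV.eventually (hlow m hm)] with n hn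
    rwa [← Real.rpow_mul n.cast_nonneg, mul_one_div] at hn
  have start : BoundedAlong P A (fun x => (μ - 1) * Real.log x)
      (fun n : ℕ => levelTime (mean P A) ((n : ℝ) ^ r)) (1 + e) := by
    refine hA.boundedAlong_of_summable hψ ha (hT.comp hV) (d := 1 + e)
      (by positivity) (by nlinarith) ?_
    have hp : 1 < (1 + e) * (μ - 1) * (r / m) := by
      have h1 : 1 / (m' - 1) ≤ r / m := by
        rw [hrdef, div_div, div_le_div_iff₀ hm1' (by positivity)]
        nlinarith
      have h2 : 1 < (1 + e) * (μ - 1) * (1 / (m' - 1)) := by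
        rw [mul_one_div, lt_div_iff₀ hm1', hm'def]
        nlinarith
      exact h2.trans_le (mul_le_mul_of_nonneg_left h1 (by positivity))
    refine summable_exp_neg_of_le (summable_exp_neg_mul_log (K := 0) hp) ?_
    filter_upwards [hlowV, eventually_gt_atTop 0] with n h1 hn
    have hn' : (0 : ℝ) < n := by exact_mod_cast hn
    have h2 := Real.log_le_log (by positivity) h1
    rw [Real.log_rpow hn'] at h2
    have h4 := mul_le_mul_of_nonneg_left h2 (show 0 ≤ (1 + e) * (μ - 1) by positivity)
    simp only [Function.comp_apply]
    linarith
  have fin : BoundedAlong P A (fun x => (μ - 1) * Real.log x)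
      (fun l : ℕ => levelTime (mean P A) l) (1 + 2 * e) := by
    have hgap : 0 < r / m - (r - 1) := by
      rw [hr1, sub_pos]
      exact div_lt_div_of_pos_left (by linarith) hm0 hmm'
    -- The first entry compares the variance with the gap, the second is the growth of its square
    -- root.
    set κ := min (r / m - (r - 1)) (r / m / 2) with hκdef
    have hκ : 0 < κ := lt_min hgap (by positivity)
    set M := r * 2 ^ (r - 1) + 1 with hM
    have hM1 : 1 ≤ M := by
      rw [hM]
      have : 0 ≤ r * 2 ^ (r - 1) := by positivity
      linarith
    refine hA.boundedAlong_finer_levels hψ ha hmono hb hjump hV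
      (fun i j hij => Real.rpow_le_rpow i.cast_nonneg (by exact_mod_cast hij) (by linarith))
      tendsto_natCast_atTop_atTop (κ := κ) (δ := 1 / M) (by positivity) ?_ ?_
      (fun ν hν hlt ε hε => ?_) (by positivity) (by linarith) start
    · filter_upwards [hlowV, eventually_ge_atTop 1] with n h1 hn
      have hn' : (1 : ℝ) ≤ n := by exact_mod_cast hn
      have hn0 : (0 : ℝ) < n := by linarith
      have h2 := powerLevel_succ_sub_le hr hn
      have h3 : (1 : ℝ) ≤ (n : ℝ) ^ (r - 1) := Real.one_le_rpow hn' (by linarith)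
      calc 1 / M * (n : ℝ) ^ κ * (((n + 1 : ℕ) : ℝ) ^ r - (n : ℝ) ^ r + 1)
          ≤ 1 / M * (n : ℝ) ^ (r / m - (r - 1)) * (M * (n : ℝ) ^ (r - 1)) := by
            have h4 : ((n + 1 : ℕ) : ℝ) ^ r - (n : ℝ) ^ r + 1 ≤ M * (n : ℝ) ^ (r - 1) := by
              rw [hM]
              linarith
            have h5 : (n : ℝ) ^ κ ≤ (n : ℝ) ^ (r / m - (r - 1)) :=
              Real.rpow_le_rpow_of_exponent_le hn' (min_le_left _ _)
            have h6 : (n : ℝ) ^ r ≤ ((n + 1 : ℕ) : ℝ) ^ r :=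
              Real.rpow_le_rpow hn0.le (by push_cast; linarith) (by linarith)
            have h7 : 0 ≤ ((n + 1 : ℕ) : ℝ) ^ r - (n : ℝ) ^ r + 1 := by linarith
            gcongr
        _ = (n : ℝ) ^ (r / m - (r - 1)) * (n : ℝ) ^ (r - 1) := by field_simp
        _ = (n : ℝ) ^ (r / m) := by rw [← Real.rpow_add hn0, sub_add_cancel]
        _ ≤ _ := h1
    · filter_upwards [hlowV, eventually_ge_atTop 1] with n h1 hn
      have hn' : (1 : ℝ) ≤ n := by exact_mod_cast hn
      refine le_trans (?_ : _ ≤ (n : ℝ) ^ (r / m / 2)) (Real.le_sqrt_of_sq_le ?_)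
      · have h5 : (n : ℝ) ^ κ ≤ (n : ℝ) ^ (r / m / 2) :=
          Real.rpow_le_rpow_of_exponent_le hn' (min_le_right _ _)
        refine le_trans ?_ h5
        refine mul_le_of_le_one_left (by positivity) ?_
        rw [div_le_one (by positivity)]
        exact hM1
      · rw [← Real.rpow_mul_natCast (by positivity), Nat.cast_ofNat, div_mul_cancel₀ _ two_ne_zero]
        exact h1
    · refine summable_exp_neg_of_le (summable_exp_neg_mul_rpow
        (ε := ε * (1 / 2) ^ κ) (p := κ / r) (by positivity) (by positivity)) ?_
      filter_upwards [eventually_le_rpow_of_lt_succ hν (f := fun m : ℕ => (m : ℝ))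
        (show 0 < r by linarith) hκ (.of_forall fun m => by positivity) hlt] with m hm
      rw [mul_assoc]
      gcongr
  exact hA.bounded_of_boundedAlong_nat hψ ha hb hjump (by positivity) (by linarith) fin

end IndicatorProcess

end Families

/-! ### The law of the iterated logarithm -/

section Limsup

lemma limsup_div_eq_one {Y N : ℝ → ℝ} (hN : ∀ᶠ t in atTop, 0 < N t)
    (hU : ∀ n : ℕ, ∀ᶠ t in atTop, Y t ≤ (1 + 1 / ((n : ℝ) + 1)) * N t)
    (hL : ∀ n : ℕ, ∃ᶠ t in atTop, (1 - 1 / ((n : ℝ) + 2)) * N t ≤ Y t) :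
    limsup (fun t => ((Y t / N t : ℝ) : EReal)) atTop = 1 := by
  refine le_antisymm (not_lt.1 fun h => ?_) (not_lt.1 fun h => ?_)
  · obtain ⟨c, h1, h2⟩ := EReal.lt_iff_exists_real_btwn.1 h
    have hc : 1 < c := by exact_mod_cast h1
    obtain ⟨n, hn⟩ := exists_nat_one_div_lt (sub_pos.2 hc)
    refine h2.not_ge (limsup_le_of_le (by isBoundedDefault) ?_)
    filter_upwards [hU n, hN] with t e1 e2
    refine EReal.coe_le_coe_iff.2 ?_
    rw [div_le_iff₀ e2]
    nlinarith
  · obtain ⟨c, h1, h2⟩ := EReal.lt_iff_exists_real_btwn.1 h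
    have hc : c < 1 := by exact_mod_cast h2
    obtain ⟨n, hn⟩ := exists_nat_one_div_lt (sub_pos.2 hc)
    refine h1.not_ge (le_limsup_of_frequently_le ?_ (by isBoundedDefault))
    refine ((hL n).and_eventually hN).mono ?_
    rintro t ⟨e1, e2⟩
    refine EReal.coe_le_coe_iff.2 ?_
    have e3 : 1 / ((n : ℝ) + 2) ≤ 1 / ((n : ℝ) + 1) :=
      one_div_le_one_div_of_le (by positivity) (by linarith)
    rw [le_div_iff₀ e2]
    nlinarith

end Limsup

/-! ### Combining the two halves. -/

section Families

variable {Ω : Type*} [MeasurableSpace Ω] {P : Measure Ω} [IsProbabilityMeasure P]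
  {A : ℕ → ℝ → Set Ω} {ψ : ℝ → ℝ}

-- Countably many constants tending to 1 from each side suffice, so the exceptional null sets can be
-- united.
omit [IsProbabilityMeasure P] in
lemma ae_limsup_eq_one (hψ : RateFunction ψ) (ha : Tendsto (var P A) atTop atTop)
    (hU : ∀ c : ℝ, 1 < c → ∀ᵐ ω ∂P, ∀ᶠ t in atTop,
      deviation P A t ω ≤ c * norming ψ (var P A t))
    (hL : ∀ c : ℝ, 0 < c → c < 1 → ∀ᵐ ω ∂P, ∃ᶠ t in atTop,
      c * norming ψ (var P A t) ≤ deviation P A t ω) :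
    ∀ᵐ ω ∂P, limsup (fun t => ((deviation P A t ω / norming ψ (var P A t) : ℝ) : EReal)) atTop
      = 1 := by
  have h1 : ∀ᵐ ω ∂P, ∀ n : ℕ, ∀ᶠ t in atTop,
      deviation P A t ω ≤ (1 + 1 / ((n : ℝ) + 1)) * norming ψ (var P A t) :=
    ae_all_iff.2 fun n => hU _ (lt_add_of_pos_right _ (by positivity))
  have h2 : ∀ᵐ ω ∂P, ∀ n : ℕ, ∃ᶠ t in atTop,
      (1 - 1 / ((n : ℝ) + 2)) * norming ψ (var P A t) ≤ deviation P A t ω := by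
    refine ae_all_iff.2 fun n => hL _ ?_ (sub_lt_self _ (by positivity))
    rw [sub_pos, div_lt_one (by positivity)]
    linarith [n.cast_nonneg (α := ℝ)]
  filter_upwards [h1, h2] with ω e1 e2
  exact limsup_div_eq_one (ha.eventually (hψ.tendsto_norming.eventually_gt_atTop 0)) e1 e2

omit [IsProbabilityMeasure P] in
/-- The common content of the two assumptions on blocks. -/
lemma exists_blocks {μ q : ℝ}
    (h : HasBlocksUpToSmallVariance P A μ q ∨ HasBlocksOfFullVariance P A μ q) :
    ∀ᶠ γ : ℝ in 𝓝[>] 0, ∀ η : ℝ, 0 < η → ∃ ς < η, ∃ R : ℝ → Set ℕ,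
      EventuallyDisjoint R (varTime (var P A) μ q γ) ∧
      Tendsto (fun t => variance (countOn A (R t) t) P / var P A t) atTop (𝓝 (1 - ς)) := by
  rcases h with ⟨ς₀, hς₀, R, hR, hlim⟩ | ⟨R, hR, hlim⟩
  · filter_upwards [hR] with γ hγ η hη
    have h1 : 0 < min ς₀ η / 2 := by positivity
    have h2 : min ς₀ η / 2 < min ς₀ η := half_lt_self (by positivity)
    exact ⟨_, h2.trans_le (min_le_right _ _), R _, hγ _ h1 (h2.trans_le (min_le_left _ _)),
      hlim _ h1 (h2.trans_le (min_le_left _ _))⟩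
  · filter_upwards [hR] with γ hγ η hη
    exact ⟨0, hη, R, hγ, by simpa using hlim⟩

lemma IndicatorProcess.lower_of_rate (hA : IndicatorProcess P A) (hψ : RateFunction ψ)
    (ha : Tendsto (var P A) atTop atTop) {μ q : ℝ}
    (h : HasBlocksUpToSmallVariance P A μ q ∨ HasBlocksOfFullVariance P A μ q)
    (hτ : ∀ γ : ℝ, 0 < γ → Tendsto (varTime (var P A) μ q γ) atTop atTop) {K : ℝ}
    (hψτ : ∀ γ : ℝ, 0 < γ → ∀ᶠ n : ℕ in atTop,
      |ψ (var P A (varTime (var P A) μ q γ n)) - (1 + γ) * Real.log n| ≤ K)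
    {c : ℝ} (hc : 0 < c) (hc1 : c < 1) :
    ∀ᵐ ω ∂P, ∃ᶠ t in atTop, c * norming ψ (var P A t) ≤ deviation P A t ω := by
  have hsmall : ∀ᶠ γ : ℝ in 𝓝[>] 0, γ < (1 - c) / 2 :=
    nhdsWithin_le_nhds (eventually_lt_nhds (by linarith))
  -- For γ < (1-c)/2 the product (1+γ)(1+c)/2 is at most 1 - ((1-c)/2)² < 1.
  obtain ⟨γ, ⟨hblocks, hγ⟩, hγ0⟩ := (((exists_blocks h).and hsmall).and self_mem_nhdsWithin).exists
  have hγ0' : 0 < γ := hγ0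
  obtain ⟨ς, hς, R, hdisj, hvar⟩ := hblocks ((1 - c) ^ 2 / 16) (by
    have := sub_pos.2 hc1
    positivity)
  exact hA.frequently_ge_of_blocks hψ ha (hτ γ hγ0) hc hc1 hγ0 (by nlinarith) (hψτ γ hγ0) hdisj hς
    hvar

end Families

end IndicatorLIL

theorem theorem1p1 {Ω : Type*} [MeasurableSpace Ω] (P : Measure Ω) [IsProbabilityMeasure P]
    (A : ℕ → ℝ → Set Ω)
    (hmeas : ∀ k t, 0 ≤ t → MeasurableSet (A k t))
    (hindep : iIndep
      (fun k => MeasurableSpace.generateFrom {E : Set Ω | ∃ t : ℝ, 0 ≤ t ∧ E = A k t}) P)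
    (hfin : ∀ t : ℝ, 0 ≤ t → ∑' k, P (A k t) ≠ ∞)
    -- the variance diverges
    (hA1 : Tendsto (var P A) atTop atTop)
    -- the variance is asymptotically monotone
    (hA2 : ∃ a₀ : ℝ → ℝ, MonotoneOn a₀ (Set.Ici 0) ∧
      Tendsto (fun t => var P A t / a₀ t) atTop (𝓝 1))
    -- the mean is at most polynomially larger than the variance, with optimal exponent `μ`
    (hA3 : (growthExponents (var P A) (mean P A)).Nonempty)
    (μ : ℝ) (hμ : μ = growthExponent (var P A) (mean P A))
    -- the additional assumptions in the case `μ = 1`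
    (q : ℝ) (L : ℝ → ℝ)
    (hA3' : μ = 1 →
      (EventuallyContinuous (mean P A) ∨
        0 < liminf (fun t : ℝ =>
          ((Real.log (mean P A (t - 1)) / Real.log (mean P A t) : ℝ) : EReal)) atTop) ∧
      HasLogOrder (var P A) (mean P A) q L)
    -- the events increase in time
    (hA4 : ∀ (k : ℕ) (s t : ℝ), 0 < s → s < t → A k s ⊆ A k t)
    (hA5 : HasFinePartitions (var P A) (mean P A) μ q)
    -- regularity of the variance
    (hB1 : EventuallyContinuous (var P A) ∨
      ((μ = 1 → Tendsto (fun t => Real.log (var P A (t - 1)) / Real.log (var P A t))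
        atTop (𝓝 1)) ∧
      (1 < μ → Tendsto (fun t => var P A (t - 1) / var P A t) atTop (𝓝 1))))
    (hB2 : HasBlocksUpToSmallVariance P A μ q ∨ HasBlocksOfFullVariance P A μ q) :
    (μ = 1 → ∀ᵐ ω ∂P, limsup (fun t : ℝ =>
      (((count A t ω - mean P A t) /
        √(2 * (q + 1) * var P A t * Real.log (Real.log (var P A t))) : ℝ) : EReal)) atTop = 1) ∧
    (1 < μ → ∀ᵐ ω ∂P, limsup (fun t : ℝ =>
      (((count A t ω - mean P A t) /
        √(2 * (μ - 1) * var P A t * Real.log (var P A t)) : ℝ) : EReal)) atTop = 1) := by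
  have hA : IndicatorProcess P A := ⟨hmeas, hindep, hfin, hA4⟩
  obtain ⟨a₀, ha₀, hlim⟩ := hA2
  have hmono := almostMonotone_of_tendsto hA1 ha₀ hlim
  have hle : ∀ᶠ t in atTop, var P A t ≤ mean P A t := by
    filter_upwards [eventually_ge_atTop 0] with t ht using hA.var_le_mean ht
  have hb : Tendsto (mean P A) atTop atTop := tendsto_atTop_mono' _ hle hA1
  have hbmono := fun s t hs hst => hA.mean_mono (s := s) (u := t) hs hst
  have hμ1 : 1 ≤ μ := by
    rw [hμ]
    exact le_csInf hA3 fun m hm => hm.1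
  have hjump := hasBoundedJumps hμ1 (fun h => (hA3' h).2.nonneg) hb hbmono hA5
  have hT := tendsto_levelTime hb (bddAbove_of_mono hbmono)
  have hbdd : ∀ K : ℝ, ∃ M : ℝ, ∀ t, 0 < t → t ≤ K → var P A t ≤ M := fun K => by
    obtain ⟨M, hM⟩ := bddAbove_of_mono hbmono K
    exact ⟨M, fun t ht htK => (hA.var_le_mean ht.le).trans (hM t ht htK)⟩
  have hτ := tendsto_levelTime hA1 hbdd
  refine ⟨fun h1 => ?_, fun h1 => ?_⟩
  · have horder := (hA3' h1).2
    have hψ := rateFunction_log_log (show 0 < q + 1 by linarith [horder.nonneg])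
    have hlog := log_log_levelTime hA1 hbdd hmono (hB1.imp_right fun h => h.1 h1)
    have hU := fun c (hc : 1 < c) => hA.upper_of_logOrder hA1 hmono hb hjump horder.nonneg
      (fun η hη => horder.le_at_levelTime hA1 hle hT hjump hη) hc
    have hL := fun c (hc : 0 < c) (hc1 : c < 1) => hA.lower_of_rate hψ hA1 hB2
      (fun γ hγ => by
        rw [h1]
        exact hτ.comp (tendsto_varLevel_one horder.nonneg hγ))
      (fun γ hγ => by
        rw [h1]
        exact rate_varTime_one horder.nonneg hγ hlog) hc hc1
    filter_upwards [ae_limsup_eq_one hψ hA1 hU hL] with ω hω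
    -- Moves the constant into the rate, after which the denominator is `norming` by definition.
    have h2 : ∀ x : ℝ, 2 * (q + 1) * x * Real.log (Real.log x) =
        2 * x * ((q + 1) * Real.log (Real.log x)) := fun x => by ring
    simp only [h2]
    exact hω
  · have hψ := rateFunction_log (sub_pos.2 h1)
    have hlog := log_levelTime hA1 hbdd hmono (hB1.imp_right fun h => h.2 h1)
    have hU := fun c (hc : 1 < c) => hA.upper_of_power hA1 hmono hb hjump h1
      (fun m hm => le_at_levelTime_of_growthExponent_lt hA3 hA1 hT hjump (hμ ▸ hm)) hc
    have hL := fun c (hc : 0 < c) (hc1 : c < 1) => hA.lower_of_rate hψ hA1 hB2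
      (fun γ hγ => hτ.comp (tendsto_varLevel h1 q hγ))
      (fun γ hγ => rate_varTime h1 hγ hlog) hc hc1
    filter_upwards [ae_limsup_eq_one hψ hA1 hU hL] with ω hω
    have h2 : ∀ x : ℝ, 2 * (μ - 1) * x * Real.log x = 2 * x * ((μ - 1) * Real.log x) :=
      fun x => by ring
    simp only [h2]
    exact hω
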